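/- \textbf{Model.} Let $m\ge 1$, $k\ge 0$, $n\le m$, $0\le s< n$ be integers with $k<n$, and let $\lambda_s,\lambda_e>0$. A source has version $N_0(t)$ at time $t$, where $N_0$ is a Poisson process of rate $\lambda_s$ with jump times $\tau_1<\tau_2<\cdots$. There are $m$ receiver nodes, forming a complete directed graph; $s$ of them, the set $\mathcal S$, are subscribers. At time $\tau_\ell$ the source creates $n$ distinct keys of version $\ell$ and gives one key to every node of $\mathcal K^\ell=\mathcal S\cup\mathcal M^\ell$, where $\mathcal M^\ell$ is a uniformly random set of $n-s$ nonsubscribers. Every edge $(i,j)$, $i\ne j$, is activated at the times of a Poisson process of rate $\lambda_e/(m-1)$. All these Poisson processes and all the sets $\mathcal M^\ell$ are independent. (Memory scheme.) When $(i,j)$ is activated, node $i$ sends to $j$ all keys that the source itself has given to $i$ since the previous activation of $(i,j)$ (since time $0$ at the first activation). A node can decode version $\ell$ as soon as it has $k+1$ distinct keys of version $\ell$; version $0$ is known to all nodes. Let $N_j^k(t)$ be the latest version that node $j$ can decode at time $t$, let $A_j(k,t)=N_0(t)-N_j^k(t)$, and let the version age of $j$ be the almost sure limit $\lim_{t\to\infty}\frac1t\int_0^tA_j(k,\tau)\,d\tau$.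 Write $\Delta^k(n,s,m)=\frac sm a+\frac{m-s}m b$, where the constants $a$ and $b$ are the version age of any subscriber and of any nonsubscriber (if $s=0$, the first term is $0$). \textbf{Statement.} Fix $k\ge 0$, $\lambda_s,\lambda_e>0$ and $\alpha\in(0,1]$, put $n=\lfloor\alpha m\rfloor$, and let $s=s_m$ be integers with $0\le s_m<n$ for all large $m$ (for example, constant). Then for every $m$ with $k<n$ and $s_m<n$ the version ages exist almost surely as constants, the same for all subscribers and the same for all nonsubscribers, and $\Delta^k(n,s_m,m)$ does not depend on which $s_m$ nodes are the subscribers. Moreover $$\frac{k\lambda_s}{\lambda_e}\le\liminf_{m\to\infty}\Delta^k(n,s_m,m)\le\limsup_{m\to\infty}\Delta^k(n,s_m,m)\le\frac{(k+1)\lambda_s}{\alpha\lambda_e},$$ and if $s_m/m$ converges as $m\to\infty$ (in particular, if $s_m=s$ is constant), then $\lim_{m\to\infty}\Delta^k(n,s_m,m)$ exists and $$\frac{k\lambda_s}{\lambda_e}\le\lim_{m\to\infty}\Delta^k(n,s_m,m)\le\frac{(k+1)\lambda_s}{\alpha\lambda_e}.$$ -/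

import Mathlib

namespace CodedGossip

open MeasureTheory ProbabilityTheory

/-- Directed edges of the complete graph on the `m` receiver nodes: `⟨(i, j), _⟩` goes
from node `i` to node `j ≠ i`.  (The source is connected to every receiver node; it acts only
through the keys that it hands out, see `keyed`.) -/
abbrev Edge (m : ℕ) : Type := {e : Fin m × Fin m // e.1 ≠ e.2}

/-- The randomness of the network, `ω = (U, X, M)`:
`U ℓ` is the length of the `ℓ`-th version cycle, i.e. the time between updates `ℓ` and `ℓ + 1`;
`X e r` is the time between the activations number `r` and `r + 1` of the edge `e`;
`M ℓ` is the set of the nonsubscriber nodes selected by the source for version `ℓ`. -/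
abbrev Sample (m : ℕ) : Type := (ℕ → ℝ) × (Edge m → ℕ → ℝ) × (ℕ → Finset (Fin m))

/-- The law of `(U, X, M)` in a scalable homogeneous network on `m` nodes with set of subscribers
`S`, `n` keys per version, source rate `lamS` and gossip rate `lamE`.  All coordinates are
independent; the updates form a Poisson process of rate `lamS`, the activations of every edge form
a Poisson process of rate `lamE / (m - 1)`, and every `M ℓ` is uniform among the sets of
`n - |S|` nonsubscriber nodes. -/
noncomputable def law {m : ℕ} (n : ℕ) (S : Finset (Fin m)) (lamS lamE : ℝ) :
    Measure (Sample m) :=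
  (Measure.infinitePi fun _ : ℕ => expMeasure lamS).prod
    ((Measure.infinitePi fun _ : Edge m =>
        Measure.infinitePi fun _ : ℕ => expMeasure (lamE / ((m : ℝ) - 1))).prod
      (Measure.infinitePi fun _ : ℕ =>
        uniformOn (Finset.powersetCard (n - S.card) Sᶜ : Set (Finset (Fin m)))))

/-- In the admissible range of the parameters, `law` is a probability measure. -/
theorem isProbabilityMeasure_law {m n : ℕ} (S : Finset (Fin m)) {lamS lamE : ℝ}
    (hS : S.card ≤ n) (hn : n ≤ m) (hlamS : 0 < lamS) (hlamE : 0 < lamE) :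
    IsProbabilityMeasure (law n S lamS lamE) := by
  have h1 : IsProbabilityMeasure (expMeasure lamS) := isProbabilityMeasure_expMeasure hlamS
  have h2 : ∀ _ : Edge m, IsProbabilityMeasure
      (Measure.infinitePi fun _ : ℕ => expMeasure (lamE / ((m : ℝ) - 1))) := by
    intro e
    have hm : 1 < m := by
      have := e.2
      have h3 := e.1.1.2
      have h4 := e.1.2.2
      rw [Ne, Fin.ext_iff] at this
      omega
    have hm' : (1 : ℝ) < m := by exact_mod_cast hm
    have : IsProbabilityMeasure (expMeasure (lamE / ((m : ℝ) - 1))) :=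
      isProbabilityMeasure_expMeasure (div_pos hlamE (by linarith))
    infer_instance
  have h3 : IsProbabilityMeasure
      (uniformOn (Finset.powersetCard (n - S.card) Sᶜ : Set (Finset (Fin m)))) := by
    refine isProbabilityMeasure_uniformOn (Finset.finite_toSet _) ?_
    rw [Finset.coe_nonempty, Finset.powersetCard_nonempty, Finset.card_compl, Fintype.card_fin]
    omega
  unfold law
  infer_instance

variable {m : ℕ}

/-- The time `τ_ℓ` of the update number `ℓ`, with `τ_0 = 0`. -/
noncomputable def updateTime (ω : Sample m) (ℓ : ℕ) : ℝ := ∑ i ∈ Finset.range ℓ, ω.1 i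

/-- The time of the activation number `r` of the edge `e` (`0` for `r = 0`, before the first
activation). -/
noncomputable def activationTime (ω : Sample m) (e : Edge m) (r : ℕ) : ℝ :=
  ∑ i ∈ Finset.range r, ω.2.1 e i

/-- `𝒦^ℓ = S ∪ M^ℓ`: the nodes that receive a key of version `ℓ` from the source at `τ_ℓ`. -/
def keyed (S : Finset (Fin m)) (ω : Sample m) (ℓ : ℕ) : Finset (Fin m) := S ∪ ω.2.2 ℓ

/-- Memory scheme: the versions `ℓ` such that the tail of the edge `e` sends its own key of version
`ℓ` over `e` at the activation number `r + 1`.  These are the keys that it was given by the source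
since the preceding activation of `e`. -/
def message (S : Finset (Fin m)) (ω : Sample m) (e : Edge m) (r : ℕ) : Set ℕ :=
  {ℓ | e.1.1 ∈ keyed S ω ℓ ∧
    activationTime ω e r < updateTime ω ℓ ∧ updateTime ω ℓ ≤ activationTime ω e (r + 1)}

/-- The keys of version `ℓ` that node `j` has at time `t`.  The keys of one version are distinct, so
a key is named by the node to which the source gave it. -/
def keys (S : Finset (Fin m)) (ω : Sample m) (j : Fin m) (t : ℝ) (ℓ : ℕ) : Set (Fin m) :=
  {i | (i = j ∧ j ∈ keyed S ω ℓ ∧ updateTime ω ℓ ≤ t) ∨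
    ∃ h : i ≠ j, ∃ r : ℕ, activationTime ω ⟨(i, j), h⟩ (r + 1) ≤ t ∧
      ℓ ∈ message S ω ⟨(i, j), h⟩ r}

/-- The version `N_0(t)` of the source: the number of updates up to time `t`. -/
noncomputable def sourceVersion (ω : Sample m) (t : ℝ) : ℕ :=
  Set.ncard {ℓ : ℕ | 1 ≤ ℓ ∧ updateTime ω ℓ ≤ t}

/-- The latest version that node `j` can decode at time `t`, which takes `k + 1` keys of that
version.  The initial version `0` is known to everybody. -/
noncomputable def nodeVersion (k : ℕ) (S : Finset (Fin m)) (ω : Sample m) (j : Fin m) (t : ℝ) : ℕ :=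
  sSup {ℓ : ℕ | ℓ = 0 ∨ k + 1 ≤ (keys S ω j t ℓ).ncard}

/-- The `k`-keys version age `A_j(k, t)`. -/
noncomputable def age (k : ℕ) (S : Finset (Fin m)) (ω : Sample m) (j : Fin m) (t : ℝ) : ℝ :=
  (sourceVersion ω t : ℝ) - (nodeVersion k S ω j t : ℝ)

/-- With probability one, the time average of the `k`-keys version age of node `j` exists and equals
the constant `a`. -/
def IsNodeAge (k n : ℕ) (S : Finset (Fin m)) (lamS lamE : ℝ) (j : Fin m) (a : ℝ) : Prop :=
  ∀ᵐ ω ∂(law n S lamS lamE),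
    (∀ t : ℝ, 0 ≤ t → IntervalIntegrable (age k S ω j) volume 0 t) ∧
    Filter.Tendsto (fun t : ℝ => (1 / t) * ∫ u in (0 : ℝ)..t, age k S ω j u)
      Filter.atTop (nhds a)

/-- `D` is the average version age of `k` keys over the graph: all subscribers have the same version
age `a`, all nonsubscribers have the same version age `b`, and `D` is the mean of `a` and `b`
weighted by the fractions of subscribers and nonsubscribers. -/
def IsGraphAge (k n : ℕ) (S : Finset (Fin m)) (lamS lamE : ℝ) (D : ℝ) : Prop :=
  ∃ a b : ℝ, (∀ j ∈ S, IsNodeAge k n S lamS lamE j a) ∧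
    (∀ j ∉ S, IsNodeAge k n S lamS lamE j b) ∧
    D = (S.card : ℝ) / m * a + (Sᶜ.card : ℝ) / m * b

end CodedGossip

open MeasureTheory ProbabilityTheory Filter Set
open scoped ENNReal Topology

/-! Reduction to one node. Under the memory scheme the key of `i` for version `ℓ` reaches `j` at the
first activation of `(i, j)` not earlier than `τ_ℓ`, so `j` holds it at time `t` exactly when that
edge is activated in `[τ_ℓ, t]`. Hence the age of `j` is the number of stale versions, those that
are created while neither they nor any later one can be decoded (`lag`, `age_eq_lag`). It depends
only on the marked Poisson process of the source and on the Poisson processes of the edges into `j`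
(`toSys`).

Existence of the ages. At a fixed time `u` this system splits into a past and an independent future
that is a fresh copy (`splits_sysLaw`). The lag at a later time `v` is at least the lag of the
future alone. It exceeds that by at most the lag at `u`, and only if the future has nothing
decodable at `v` (`GoodSys.lag_le_fut_add`). So the mean lag is nondecreasing, its first two moments
are bounded, and covariances decay exponentially, because a fresh system stays without decoding only
with exponentially small probability (`measure_noDec_le`). A second-moment law of large numbers
(`ae_tendsto_timeAverage`) then identifies the almost sure time average with the supremum `nodeAge`
of the mean lag.

Bounds. Seen backwards from `u`, the times since the last activations are independent exponential
times truncated at `u` (`map_brec`), and Campbell's formula turns expected numbers of versions into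
`lamS` times an integral over their age. For the upper bound, count all versions that are
undecodable on their own: the integral is at most the mean time until `k + 1` of `n` exponential
clocks have rung (`nodeAge_le`). For the lower bound, at most one key is the node's own, so decoding
needs `k` activated edges, and later versions have been heard on fewer edges: a version heard on
fewer than `k` edges is stale (`le_nodeAge`). With clocks of rate `lamE / (m - 1)`, the two sums of
reciprocals give the asserted constants in the limit.

Convergence. Given the creation times and the edges, the sets of key holders of distinct versions
are independent, and the probability of staleness is a product of hypergeometric probabilities that
sees the subscribers only through cardinalities (`markLaw_not_decodes`, `meanLag_decodes_eq`). Each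
edge is heard within a bounded time with probability of order `1 / m`, and their number is of order
`m`, so averaging over the edges has a Poisson limit (`exists_tendsto_expAvg_iterate`). Dominated
convergence gives the limit of the mean lag at each fixed time, and a tail bound uniform in `m`
(`exists_tail_le`) transfers it to the ages. -/

namespace CodedGossip

/-! ### I.i.d. sequences, first-step decomposition and the exponential law. -/

section Renewal

/-- Partial sums of a sequence of gaps. -/
noncomputable def psum (x : ℕ → ℝ) (n : ℕ) : ℝ := ∑ i ∈ Finset.range n, x i

/-- Prepend a term to a sequence. -/
def consSeq {α : Type*} (a : α) (x : ℕ → α) : ℕ → α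
  | 0 => a
  | n + 1 => x n

theorem psum_consSeq_succ (a : ℝ) (x : ℕ → ℝ) (n : ℕ) :
    psum (consSeq a x) (n + 1) = a + psum x n := by
  simp [psum, Finset.sum_range_succ', consSeq, add_comm]

theorem psum_zero (x : ℕ → ℝ) : psum x 0 = 0 := by simp [psum]

theorem psum_succ (x : ℕ → ℝ) (n : ℕ) : psum x (n + 1) = psum x n + x n := by
  simp [psum, Finset.sum_range_succ]

@[fun_prop]
theorem measurable_psum (n : ℕ) : Measurable fun x : ℕ → ℝ => psum x n := by
  unfold psum; fun_prop

@[fun_prop]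
theorem measurable_consSeq {α : Type*} [MeasurableSpace α] :
    Measurable fun q : α × (ℕ → α) => consSeq q.1 q.2 := by
  refine measurable_pi_lambda _ fun n => ?_
  cases n with
  | zero => exact measurable_fst
  | succ n => exact (measurable_pi_apply n).comp measurable_snd

/-- A cylinder over a finite set of indices factors into the condition at index `0` and the cylinder
over the remaining indices moved down by one. All factors have the same law, so the product is
unchanged. -/
theorem map_consSeq {α : Type*} [MeasurableSpace α] (μ : Measure α) [IsProbabilityMeasure μ] :
    (μ.prod (Measure.infinitePi fun _ : ℕ => μ)).map (fun q => consSeq q.1 q.2) =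
      Measure.infinitePi fun _ : ℕ => μ := by
  classical
  refine Measure.eq_infinitePi _ fun s t ht => ?_
  rw [Measure.map_apply measurable_consSeq (.pi s.countable_toSet fun _ _ => ht _)]
  have hpre : (fun q : α × (ℕ → α) => consSeq q.1 q.2) ⁻¹' ((s : Set ℕ).pi t) =
      (if 0 ∈ s then t 0 else univ) ×ˢ
        (((s.erase 0).image Nat.pred : Finset ℕ) : Set ℕ).pi fun n => t (n + 1) := by
    ext ⟨a, x⟩
    simp only [mem_preimage, Set.mem_pi, Finset.mem_coe, mem_prod, Finset.mem_image,
      Finset.mem_erase]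
    constructor
    · intro h
      refine ⟨?_, ?_⟩
      · split_ifs with h0
        · exact h 0 h0
        · trivial
      · rintro n ⟨l, ⟨hl0, hl⟩, rfl⟩
        obtain ⟨l, rfl⟩ := Nat.exists_eq_succ_of_ne_zero hl0
        exact h _ hl
    · rintro ⟨h0, h1⟩ n hn
      cases n with
      | zero => simpa [hn, consSeq] using h0
      | succ n => exact h1 n ⟨n + 1, ⟨by simp, hn⟩, rfl⟩
  rw [hpre, Measure.prod_prod, Measure.infinitePi_pi _ (fun i _ => ht _)]
  have hinj : Set.InjOn Nat.pred ((s.erase 0 : Finset ℕ) : Set ℕ) := by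
    intro a ha b hb hab
    simp only [Finset.coe_erase, Set.mem_sdiff, mem_singleton_iff] at ha hb
    exact Nat.pred_inj (Nat.pos_of_ne_zero ha.2) (Nat.pos_of_ne_zero hb.2) hab
  rw [Finset.prod_image hinj]
  have h1 : ∏ i ∈ s.erase 0, μ (t (i.pred + 1)) = ∏ i ∈ s.erase 0, μ (t i) := by
    refine Finset.prod_congr rfl fun i hi => ?_
    rw [Nat.pred_eq_sub_one, Nat.sub_add_cancel]
    exact Nat.pos_of_ne_zero (Finset.ne_of_mem_erase hi)
  rw [h1]
  split_ifs with h0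
  · exact Finset.mul_prod_erase s (fun i => μ (t i)) h0
  · rw [measure_univ, one_mul, Finset.erase_eq_of_notMem h0]

theorem lintegral_infinitePi_cons {α : Type*} [MeasurableSpace α] (μ : Measure α)
    [IsProbabilityMeasure μ] {F : (ℕ → α) → ℝ≥0∞} (hF : Measurable F) :
    ∫⁻ x, F x ∂(Measure.infinitePi fun _ : ℕ => μ) =
      ∫⁻ a, ∫⁻ x, F (consSeq a x) ∂(Measure.infinitePi fun _ : ℕ => μ) ∂μ := by
  conv_lhs => rw [← map_consSeq μ]
  rw [lintegral_map hF measurable_consSeq, lintegral_prod _ (by fun_prop)]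

variable {E : Type*} [MeasurableSpace E]

/-- A sequence of gaps together with a sequence of marks. -/
abbrev MSeq (E : Type*) : Type _ := (ℕ → ℝ) × (ℕ → E)

/-- The law of independent gaps with law `μ` and independent marks with law `ν`. -/
noncomputable abbrev mLaw (μ : Measure ℝ) (ν : Measure E) : Measure (MSeq E) :=
  (Measure.infinitePi fun _ : ℕ => μ).prod (Measure.infinitePi fun _ : ℕ => ν)

/-- First-step decomposition for gaps and marks together; the induction on the number of arrivals
rests on it. -/
theorem lintegral_mLaw_cons (μ : Measure ℝ) (ν : Measure E) [IsProbabilityMeasure μ]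
    [IsProbabilityMeasure ν] {F : MSeq E → ℝ≥0∞} (hF : Measurable F) :
    ∫⁻ ω, F ω ∂(mLaw μ ν) =
      ∫⁻ a, ∫⁻ e, ∫⁻ ω, F (consSeq a ω.1, consSeq e ω.2) ∂(mLaw μ ν) ∂ν ∂μ := by
  rw [lintegral_prod _ hF.aemeasurable]
  rw [lintegral_infinitePi_cons μ (F := fun x => ∫⁻ y, F (x, y) ∂_) hF.lintegral_prod_right']
  refine lintegral_congr fun a => ?_
  have h1 : ∀ x : ℕ → ℝ, ∫⁻ y, F (consSeq a x, y) ∂(Measure.infinitePi fun _ : ℕ => ν) =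
      ∫⁻ e, ∫⁻ y, F (consSeq a x, consSeq e y) ∂(Measure.infinitePi fun _ : ℕ => ν) ∂ν :=
    fun x => lintegral_infinitePi_cons ν (by fun_prop)
  simp_rw [h1]
  rw [lintegral_lintegral_swap]
  · refine lintegral_congr fun e => ?_
    rw [lintegral_prod _ (by fun_prop)]
  · refine Measurable.aemeasurable ?_
    refine Measurable.lintegral_prod_right' (f := fun q : ((ℕ → ℝ) × E) × (ℕ → E) =>
      F (consSeq a q.1.1, consSeq q.1.2 q.2)) ?_
    fun_prop

/-- Memorylessness of the exponential law. -/
theorem lintegral_exp_memoryless {r : ℝ} {u : ℝ} (hu : 0 ≤ u) {g : ℝ → ℝ≥0∞}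
    (hg : Measurable g) :
    ∫⁻ a, (Ioi u).indicator (fun a => g (a - u)) a ∂(expMeasure r) =
      ENNReal.ofReal (Real.exp (-(r * u))) * ∫⁻ a, g a ∂(expMeasure r) := by
  have hd : expMeasure r = volume.withDensity (exponentialPDF r) := rfl
  have hm : Measurable (exponentialPDF r) := (measurable_exponentialPDFReal r).ennreal_ofReal
  rw [hd, lintegral_withDensity_eq_lintegral_mul _ hm (by
      exact (hg.comp (measurable_id.sub_const u)).indicator measurableSet_Ioi),
    lintegral_withDensity_eq_lintegral_mul _ hm hg, ← lintegral_const_mul _ (hm.mul hg)]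
  rw [← lintegral_add_right_eq_self _ u]
  refine lintegral_congr_ae ?_
  -- At `0` the density is positive but the open half-line is missed, so the integrands agree only
  -- almost everywhere.
  have h0 : ∀ᵐ a : ℝ, a ≠ 0 := by simp [ae_iff]
  filter_upwards [h0] with a ha
  simp only [Pi.mul_apply]
  rcases lt_or_gt_of_ne ha with h | h
  · rw [exponentialPDF_of_neg h, indicator_of_notMem (by simp; linarith)]; simp
  · rw [exponentialPDF_of_nonneg h.le, exponentialPDF_of_nonneg (by linarith),
      indicator_of_mem (by simp; linarith), add_sub_cancel_right, ← mul_assoc,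
      ← ENNReal.ofReal_mul (Real.exp_pos _).le]
    congr 2
    rw [show -(r * (a + u)) = -(r * u) + -(r * a) by ring, Real.exp_add]; ring

theorem expMeasure_Ioi {r : ℝ} (hr : 0 < r) {u : ℝ} (hu : 0 ≤ u) :
    expMeasure r (Ioi u) = ENNReal.ofReal (Real.exp (-(r * u))) := by
  have := isProbabilityMeasure_expMeasure hr
  have h := lintegral_exp_memoryless hu (r := r) (g := fun _ => 1) measurable_const
  rw [lintegral_indicator measurableSet_Ioi] at h
  simpa using h

theorem expMeasure_Iic_zero {r : ℝ} (hr : 0 < r) : expMeasure r (Iic 0) = 0 := by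
  have := isProbabilityMeasure_expMeasure hr
  have h : expMeasure r (Ioi 0) = 1 := by rw [expMeasure_Ioi hr le_rfl]; simp
  rw [← compl_Ioi, prob_compl_eq_zero_iff measurableSet_Ioi, h]

end Renewal

/-! ### Past and future of a marked Poisson process at a fixed time. -/

section Splitting

variable {E : Type*} [MeasurableSpace E]

/-- Exactly `n` arrivals up to time `u`. -/
def HasCount (n : ℕ) (u : ℝ) (x : ℕ → ℝ) : Prop :=
  (∀ i ≤ n, psum x i ≤ u) ∧ u < psum x (n + 1)

/-- The first `n` gaps and marks, followed by a constant filling. -/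
def pastN (n : ℕ) (c : ℝ) (e₀ : E) (ω : MSeq E) : MSeq E :=
  (fun i => if i < n then ω.1 i else c, fun i => if i < n then ω.2 i else e₀)

/-- The gaps and marks after time `u`, when there are `n` arrivals up to time `u`. -/
noncomputable def futN (n : ℕ) (u : ℝ) (ω : MSeq E) : MSeq E :=
  (fun i => if i = 0 then psum ω.1 (n + 1) - u else ω.1 (n + i), fun i => ω.2 (n + i))

theorem measurableSet_hasCount (n : ℕ) (u : ℝ) : MeasurableSet {x | HasCount n u x} := by
  have : {x | HasCount n u x} = (⋂ i ∈ Finset.range (n + 1), {x | psum x i ≤ u}) ∩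
      {x | u < psum x (n + 1)} := by
    ext x; simp [HasCount]
  rw [this]
  exact (Finset.measurableSet_biInter _ fun i _ =>
    measurableSet_le (by fun_prop) measurable_const).inter
      (measurableSet_lt measurable_const (by fun_prop))

@[fun_prop]
theorem measurable_pastN (n : ℕ) (c : ℝ) (e₀ : E) : Measurable (pastN n c e₀) := by
  refine Measurable.prodMk ?_ ?_ <;> refine measurable_pi_lambda _ fun i => ?_ <;>
    by_cases h : i < n <;> simp only [h, if_true, if_false] <;> fun_prop

@[fun_prop]
theorem measurable_futN (n : ℕ) (u : ℝ) : Measurable (futN (E := E) n u) := by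
  refine Measurable.prodMk ?_ ?_ <;> refine measurable_pi_lambda _ fun i => ?_
  · by_cases h : i = 0 <;> simp only [h, if_true, if_false] <;> fun_prop
  · fun_prop

theorem hasCount_consSeq_succ (n : ℕ) (u a : ℝ) (x : ℕ → ℝ) :
    HasCount (n + 1) u (consSeq a x) ↔ 0 ≤ u ∧ HasCount n (u - a) x := by
  unfold HasCount
  rw [psum_consSeq_succ]
  constructor
  · rintro ⟨h1, h2⟩
    refine ⟨by simpa [psum_zero] using h1 0 (by omega), fun i hi => ?_, by linarith⟩
    have := h1 (i + 1) (by omega)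
    rw [psum_consSeq_succ] at this
    linarith
  · rintro ⟨h0, h1, h2⟩
    refine ⟨fun i hi => ?_, by linarith⟩
    cases i with
    | zero => simpa [psum_zero]
    | succ i =>
      have := h1 i (by omega)
      rw [psum_consSeq_succ]
      linarith

omit [MeasurableSpace E] in
theorem pastN_consSeq_succ (n : ℕ) (c : ℝ) (e₀ : E) (a : ℝ) (e : E) (ω : MSeq E) :
    pastN (n + 1) c e₀ (consSeq a ω.1, consSeq e ω.2) =
      (consSeq a (pastN n c e₀ ω).1, consSeq e (pastN n c e₀ ω).2) := by
  refine Prod.ext (funext fun i => ?_) (funext fun i => ?_) <;> cases i <;> simp [pastN, consSeq]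

omit [MeasurableSpace E] in
theorem futN_consSeq_succ (n : ℕ) (u a : ℝ) (e : E) (ω : MSeq E) :
    futN (n + 1) u (consSeq a ω.1, consSeq e ω.2) = futN n (u - a) ω := by
  refine Prod.ext (funext fun i => ?_) (funext fun i => ?_)
  · simp only [futN, psum_consSeq_succ]
    split_ifs
    · ring
    · rw [show n + 1 + i = (n + i) + 1 by ring]; rfl
  · simp only [futN]
    rw [show n + 1 + i = (n + i) + 1 by ring]; rfl

omit [MeasurableSpace E] in
theorem futN_zero_consSeq (u a : ℝ) (e : E) (ω : MSeq E) :
    futN 0 u (consSeq a ω.1, consSeq e ω.2) = (consSeq (a - u) ω.1, consSeq e ω.2) := by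
  refine Prod.ext (funext fun i => ?_) (funext fun i => ?_)
  · cases i <;> simp [futN, consSeq, psum]
  · simp [futN]

-- Induction on the number of arrivals before `u`. Without arrivals this is memorylessness of the
-- first gap; otherwise removing the first gap `a` lowers the count by one and replaces `u` by `u -
-- a`. Therefore `u` ranges over all reals, with both sides zero when it is negative, and the
-- filling `c` is kept independent of `u`.
open Classical in
theorem lintegral_split_hasCount {r : ℝ} (hr : 0 < r) (ν : Measure E) [IsProbabilityMeasure ν]
    (c : ℝ) (e₀ : E) (n : ℕ) :
    ∀ (u : ℝ) {F : MSeq E × MSeq E → ℝ≥0∞}, Measurable F →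
      ∫⁻ ω, (if HasCount n u ω.1 then F (pastN n c e₀ ω, futN n u ω) else 0)
          ∂(mLaw (expMeasure r) ν) =
        ∫⁻ ω, (if HasCount n u ω.1 then
          ∫⁻ ω', F (pastN n c e₀ ω, ω') ∂(mLaw (expMeasure r) ν) else 0)
          ∂(mLaw (expMeasure r) ν) := by
  have hP := isProbabilityMeasure_expMeasure hr
  have hms : ∀ n u, MeasurableSet {ω : MSeq E | HasCount n u ω.1} := fun n u =>
    measurable_fst (measurableSet_hasCount n u)
  induction n with
  | zero =>
    intro u F hF
    by_cases hu : 0 ≤ u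
    swap
    · have : ∀ x, ¬ HasCount 0 u x := fun x h => hu (by simpa [psum_zero] using h.1 0 le_rfl)
      simp [this]
    have hp : ∀ ω : MSeq E, pastN 0 c e₀ ω = (fun _ => c, fun _ => e₀) := fun ω => by simp [pastN]
    have hc : ∀ (a : ℝ) (x : ℕ → ℝ), HasCount 0 u (consSeq a x) ↔ u < a := by
      intro a x
      simp [HasCount, psum, consSeq, hu]
    simp_rw [hp]
    set b : MSeq E := (fun _ => c, fun _ => e₀)
    rw [lintegral_mLaw_cons _ _ (by
      exact Measurable.ite (hms 0 u) (by fun_prop) measurable_const)]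
    rw [lintegral_mLaw_cons (F := fun ω : MSeq E => if HasCount 0 u ω.1 then
      ∫⁻ ω', F (b, ω') ∂(mLaw (expMeasure r) ν) else 0) _ _ (by
      exact Measurable.ite (hms 0 u) measurable_const measurable_const)]
    simp_rw [hc, futN_zero_consSeq]
    -- With no arrival before `u`, the future differs from the whole process only in its first gap,
    -- which drops from `a` to `a - u`.
    have hmem := lintegral_exp_memoryless hu (r := r) (g := fun a => ∫⁻ e, ∫⁻ ω, F (b,
      (consSeq a ω.1, consSeq e ω.2)) ∂(mLaw (expMeasure r) ν) ∂ν) (by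
        refine Measurable.lintegral_prod_right' (f := fun q : ℝ × E => ∫⁻ ω, F (b,
          (consSeq q.1 ω.1, consSeq q.2 ω.2)) ∂(mLaw (expMeasure r) ν)) ?_
        refine Measurable.lintegral_prod_right' (f := fun q : (ℝ × E) × MSeq E => F (b,
          (consSeq q.1.1 q.2.1, consSeq q.1.2 q.2.2))) ?_
        fun_prop)
    have e1 : ∀ a : ℝ, ∫⁻ e, ∫⁻ ω, (if u < a then F (b, (consSeq (a - u) ω.1, consSeq e ω.2))
        else 0) ∂(mLaw (expMeasure r) ν) ∂ν = (Ioi u).indicator (fun a => ∫⁻ e, ∫⁻ ω, F (b,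
          (consSeq (a - u) ω.1, consSeq e ω.2)) ∂(mLaw (expMeasure r) ν) ∂ν) a := by
      intro a
      by_cases h : u < a
      · simp [h]
      · simp [h]
    have e2 : ∀ a : ℝ, (∫⁻ _ : E, ∫⁻ _ : MSeq E, (if u < a then
        ∫⁻ ω', F (b, ω') ∂(mLaw (expMeasure r) ν) else 0) ∂(mLaw (expMeasure r) ν) ∂ν) =
          (Ioi u).indicator (fun _ => ∫⁻ ω', F (b, ω') ∂(mLaw (expMeasure r) ν)) a := by
      intro a
      by_cases h : u < a
      · simp [h]
      · simp [h]
    simp_rw [e1, e2]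
    rw [hmem, lintegral_indicator measurableSet_Ioi, setLIntegral_const, expMeasure_Ioi hr hu,
      ← lintegral_mLaw_cons (F := fun ω => F (b, ω)) _ _ (by fun_prop), mul_comm]
  | succ n ih =>
    intro u F hF
    by_cases hu : 0 ≤ u
    swap
    · have : ∀ x, ¬ HasCount (n + 1) u x := fun x h =>
        hu (by simpa [psum_zero] using h.1 0 (by omega))
      simp [this]
    rw [lintegral_mLaw_cons _ _ (by
      exact Measurable.ite (hms (n + 1) u) (by fun_prop) measurable_const)]
    rw [lintegral_mLaw_cons (F := fun ω : MSeq E => if HasCount (n + 1) u ω.1 then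
      ∫⁻ ω', F (pastN (n + 1) c e₀ ω, ω') ∂(mLaw (expMeasure r) ν) else 0) _ _ (by
      refine Measurable.ite (hms (n + 1) u) ?_ measurable_const
      refine Measurable.lintegral_prod_right' (f := fun q : MSeq E × MSeq E =>
        F (pastN (n + 1) c e₀ q.1, q.2)) ?_
      fun_prop)]
    refine lintegral_congr fun a => lintegral_congr fun e => ?_
    simp_rw [hasCount_consSeq_succ, futN_consSeq_succ, pastN_consSeq_succ, hu, true_and]
    exact ih (u - a) (F := fun q => F ((consSeq a q.1.1, consSeq e q.1.2), q.2)) (by fun_prop)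

/-- The number of arrivals up to time `u`. -/
noncomputable def cnt (u : ℝ) (x : ℕ → ℝ) : ℕ := sInf {n | u < psum x (n + 1)}

/-- Positive gaps whose sum diverges. -/
def Good (x : ℕ → ℝ) : Prop := (∀ i, 0 < x i) ∧ ∀ u : ℝ, ∃ n, u < psum x n

theorem Good.strictMono {x : ℕ → ℝ} (hx : Good x) : StrictMono (psum x) :=
  strictMono_nat_of_lt_succ fun n => by rw [psum_succ]; linarith [hx.1 n]

theorem Good.lt_cnt {x : ℕ → ℝ} (hx : Good x) (u : ℝ) : u < psum x (cnt u x + 1) := by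
  obtain ⟨n, hn⟩ := hx.2 u
  have : {n | u < psum x (n + 1)}.Nonempty := ⟨n, hn.trans (hx.strictMono (Nat.lt_succ_self n))⟩
  exact Nat.sInf_mem this

theorem Good.psum_cnt_le {x : ℕ → ℝ} {u : ℝ} (hu : 0 ≤ u) : psum x (cnt u x) ≤ u := by
  rcases h : cnt u x with _ | n
  · simpa [psum_zero]
  · have : n ∉ {n | u < psum x (n + 1)} := Nat.notMem_of_lt_sInf (by
      change n < cnt u x; omega)
    simpa using this

theorem Good.le_iff {x : ℕ → ℝ} (hx : Good x) {u : ℝ} (hu : 0 ≤ u) (n : ℕ) :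
    psum x n ≤ u ↔ n ≤ cnt u x := by
  constructor
  · intro h
    by_contra h'
    have := hx.strictMono.monotone (show cnt u x + 1 ≤ n by omega)
    linarith [hx.lt_cnt u]
  · intro h
    exact (hx.strictMono.monotone h).trans (Good.psum_cnt_le hu)

theorem Good.hasCount_iff {x : ℕ → ℝ} (hx : Good x) {u : ℝ} (hu : 0 ≤ u) (n : ℕ) :
    HasCount n u x ↔ n = cnt u x := by
  constructor
  · rintro ⟨h1, h2⟩
    have a := (hx.le_iff hu n).1 (h1 n le_rfl)
    have b : ¬ (n + 1 ≤ cnt u x) := fun h => by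
      have := (hx.le_iff hu _).2 h
      linarith
    omega
  · rintro rfl
    exact ⟨fun i hi => (hx.le_iff hu i).2 hi, hx.lt_cnt u⟩

theorem measurable_cnt (u : ℝ) : Measurable (cnt u) := by
  refine measurable_to_countable' fun n => ?_
  -- The second alternative accounts for the infimum of the empty set, which is `0` by convention.
  have : cnt u ⁻¹' {n} = {x | (u < psum x (n + 1) ∧ ∀ i < n, ¬ u < psum x (i + 1)) ∨
      (n = 0 ∧ ∀ i, ¬ u < psum x (i + 1))} := by
    ext x
    simp only [mem_preimage, mem_singleton_iff, mem_ofPred_eq]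
    constructor
    · intro h
      by_cases hne : {n | u < psum x (n + 1)}.Nonempty
      · refine Or.inl ⟨?_, fun i hi => ?_⟩
        · rw [← h]; exact Nat.sInf_mem hne
        · exact Nat.notMem_of_lt_sInf (s := {n | u < psum x (n + 1)}) (by
            change i < cnt u x; omega)
      · refine Or.inr ⟨?_, fun i hi => hne ⟨i, hi⟩⟩
        rw [not_nonempty_iff_eq_empty] at hne
        rw [← h, cnt, hne, Nat.sInf_empty]
    · rintro (⟨h1, h2⟩ | ⟨rfl, h2⟩)
      · refine le_antisymm (Nat.sInf_le h1) ?_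
        by_contra h
        exact h2 _ (not_le.1 h) (Nat.sInf_mem (⟨n, h1⟩ : {n | u < psum x (n + 1)}.Nonempty))
      · rw [cnt, Nat.sInf_eq_zero]
        exact Or.inr (eq_empty_of_forall_notMem h2)
  rw [this]
  have hm : ∀ i, Measurable fun x : ℕ → ℝ => u < psum x (i + 1) := fun i =>
    measurableSet_setOfPred.1 (measurableSet_lt measurable_const (by fun_prop))
  exact measurableSet_setOfPred.2 (((hm n).and (Measurable.forall fun i =>
    Measurable.imp measurable_const (hm i).not)).or
      (Measurable.and measurable_const (Measurable.forall fun i => (hm i).not)))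

/-- The arrivals and marks up to time `u`. -/
noncomputable def mpast (e₀ : E) (u : ℝ) (ω : MSeq E) : MSeq E := pastN (cnt u ω.1) (u + 1) e₀ ω

/-- The arrivals and marks after time `u`, seen from time `u`. -/
noncomputable def mfut (u : ℝ) (ω : MSeq E) : MSeq E := futN (cnt u ω.1) u ω

theorem measurable_of_cnt {β : Type*} [MeasurableSpace β] (u : ℝ) {f : ℕ → MSeq E → β}
    (hf : ∀ n, Measurable (f n)) : Measurable fun ω : MSeq E => f (cnt u ω.1) ω :=
  (measurable_from_prod_countable_right (f := fun q : ℕ × MSeq E => f q.1 q.2) hf).comp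
    (((measurable_cnt u).comp measurable_fst).prodMk measurable_id)

@[fun_prop]
theorem measurable_mpast (e₀ : E) (u : ℝ) : Measurable (mpast e₀ u) :=
  measurable_of_cnt u (f := fun n => pastN n (u + 1) e₀) fun n => measurable_pastN n _ _

@[fun_prop]
theorem measurable_mfut (u : ℝ) : Measurable (mfut (E := E) u) :=
  measurable_of_cnt u (f := fun n => futN n u) fun n => measurable_futN n _

theorem lintegral_exp_lt_one {r : ℝ} (hr : 0 < r) :
    ∫⁻ a, ENNReal.ofReal (Real.exp (-a)) ∂(expMeasure r) < 1 := by
  have hP := isProbabilityMeasure_expMeasure hr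
  have h1 : ∀ᵐ a ∂(expMeasure r), 0 < a := by
    rw [ae_iff]; simpa [Iic_def] using expMeasure_Iic_zero hr
  have h2 : ∫⁻ a, ENNReal.ofReal (Real.exp (-a)) ∂(expMeasure r) <
      ∫⁻ _, 1 ∂(expMeasure r) := by
    refine lintegral_strict_mono (IsProbabilityMeasure.ne_zero _) aemeasurable_const ?_ ?_
    · refine ne_of_lt (lt_of_le_of_lt (lintegral_mono_ae (g := fun _ => 1) ?_) (by simp))
      filter_upwards [h1] with a ha
      exact ENNReal.ofReal_le_one.2 (Real.exp_le_one_iff.2 (by linarith))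
    · filter_upwards [h1] with a ha
      exact ENNReal.ofReal_lt_one.2 (Real.exp_lt_one_iff.2 (by linarith))
  simpa using h2

theorem lintegral_exp_psum {r : ℝ} (hr : 0 < r) (n : ℕ) :
    ∫⁻ x, ENNReal.ofReal (Real.exp (-psum x n)) ∂(Measure.infinitePi fun _ : ℕ => expMeasure r) =
      (∫⁻ a, ENNReal.ofReal (Real.exp (-a)) ∂(expMeasure r)) ^ n := by
  have hP := isProbabilityMeasure_expMeasure hr
  induction n with
  | zero => simp [psum_zero]
  | succ n ih =>
    rw [lintegral_infinitePi_cons _ (by fun_prop)]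
    simp_rw [psum_consSeq_succ, neg_add, Real.exp_add, ENNReal.ofReal_mul (Real.exp_pos _).le]
    have : ∀ a : ℝ, ∫⁻ x, ENNReal.ofReal (Real.exp (-a)) * ENNReal.ofReal (Real.exp (-psum x n))
        ∂(Measure.infinitePi fun _ : ℕ => expMeasure r) = ENNReal.ofReal (Real.exp (-a)) *
        (∫⁻ a, ENNReal.ofReal (Real.exp (-a)) ∂(expMeasure r)) ^ n := fun a => by
      rw [lintegral_const_mul _ (by fun_prop), ih]
    simp_rw [this]
    rw [lintegral_mul_const _ (by fun_prop), pow_succ, mul_comm]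

/-- Exponential Markov inequality: on the event, `1 ≤ exp (u - psum x n)`. The geometric decay in
`n` yields both the divergence of the partial sums and the finiteness of moments of the lag. -/
theorem measure_psum_le {r : ℝ} (hr : 0 < r) (u : ℝ) (n : ℕ) :
    (Measure.infinitePi fun _ : ℕ => expMeasure r) {x | psum x n ≤ u} ≤
      ENNReal.ofReal (Real.exp u) *
        (∫⁻ a, ENNReal.ofReal (Real.exp (-a)) ∂(expMeasure r)) ^ n := by
  have hP := isProbabilityMeasure_expMeasure hr
  have hm : MeasurableSet {x : ℕ → ℝ | psum x n ≤ u} :=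
    measurableSet_le (by fun_prop) measurable_const
  rw [← lintegral_exp_psum hr, ← lintegral_const_mul _ (by fun_prop), ← lintegral_indicator_one hm]
  refine lintegral_mono fun x => ?_
  by_cases hx : psum x n ≤ u
  · rw [indicator_of_mem (by exact hx), Pi.one_apply, ← ENNReal.ofReal_mul (Real.exp_pos _).le, ← Real.exp_add]
    simpa using ENNReal.one_le_ofReal.2 (Real.one_le_exp (by linarith : (0:ℝ) ≤ u + -psum x n))
  · rw [indicator_of_notMem (by exact hx)]; exact zero_le

/-- Letting `n` tend to infinity in `measure_psum_le` shows that a bounded sequence of partial sums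
has probability zero; integer bounds suffice. -/
theorem ae_good {r : ℝ} (hr : 0 < r) :
    ∀ᵐ x ∂(Measure.infinitePi fun _ : ℕ => expMeasure r), Good x := by
  have hP := isProbabilityMeasure_expMeasure hr
  have h1 : ∀ᵐ a ∂(expMeasure r), 0 < a := by
    rw [ae_iff]; simpa [Iic_def] using expMeasure_Iic_zero hr
  have h2 : ∀ᵐ x ∂(Measure.infinitePi fun _ : ℕ => expMeasure r), ∀ i, 0 < x i := by
    rw [ae_all_iff]
    intro i
    exact (measurePreserving_eval_infinitePi (fun _ : ℕ => expMeasure r) i).quasiMeasurePreserving.ae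
      h1
  have h3 : ∀ᵐ x ∂(Measure.infinitePi fun _ : ℕ => expMeasure r), ∀ k : ℕ, ∃ n, (k : ℝ) < psum x n := by
    rw [ae_all_iff]
    intro k
    rw [ae_iff]
    have ht : Tendsto (fun n => ENNReal.ofReal (Real.exp k) *
        (∫⁻ a, ENNReal.ofReal (Real.exp (-a)) ∂(expMeasure r)) ^ n) atTop (𝓝 0) := by
      have := ENNReal.Tendsto.const_mul (a := ENNReal.ofReal (Real.exp k))
        (ENNReal.tendsto_pow_atTop_nhds_zero_of_lt_one (lintegral_exp_lt_one hr))
        (Or.inr ENNReal.ofReal_ne_top)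
      simpa using this
    refine le_antisymm (ge_of_tendsto' ht fun n => ?_) zero_le
    refine le_trans (measure_mono fun x hx => ?_) (measure_psum_le hr (k : ℝ) n)
    simp only [mem_ofPred_eq, not_exists, not_lt] at hx ⊢
    exact hx n
  filter_upwards [h2, h3] with x hx1 hx2
  refine ⟨hx1, fun u => ?_⟩
  obtain ⟨k, hk⟩ := exists_nat_ge u
  obtain ⟨n, hn⟩ := hx2 k
  exact ⟨n, by linarith⟩

/-- The past and the future of a system are independent, and the future is a fresh copy. -/
def Splits {Ω : Type*} [MeasurableSpace Ω] (P : Measure Ω) (past fut : Ω → Ω) : Prop :=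
  Measurable past ∧ Measurable fut ∧ P.map (fun ω => (past ω, fut ω)) = (P.map past).prod P

theorem ae_good_mLaw {r : ℝ} (hr : 0 < r) (ν : Measure E) [IsProbabilityMeasure ν] :
    ∀ᵐ ω ∂(mLaw (expMeasure r) ν), Good ω.1 := by
  have hP := isProbabilityMeasure_expMeasure hr
  exact (measurePreserving_fst (μ := Measure.infinitePi fun _ : ℕ => expMeasure r)
    (ν := Measure.infinitePi fun _ : ℕ => ν)).quasiMeasurePreserving.ae (ae_good hr)

-- Almost surely exactly one `n` satisfies `HasCount n u`, so an integral is the sum over `n` of its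
-- restrictions, and `lintegral_split_hasCount` applies to each of them.
open Classical in
theorem splits_mLaw {r : ℝ} (hr : 0 < r) (ν : Measure E) [IsProbabilityMeasure ν] (e₀ : E)
    {u : ℝ} (hu : 0 ≤ u) : Splits (mLaw (expMeasure r) ν) (mpast e₀ u) (mfut u) := by
  have hP := isProbabilityMeasure_expMeasure hr
  refine ⟨by fun_prop, by fun_prop, ?_⟩
  refine Measure.ext_of_lintegral _ fun F hF => ?_
  rw [lintegral_map hF (by fun_prop), lintegral_prod _ hF.aemeasurable,
    lintegral_map (by exact hF.lintegral_prod_right') (by fun_prop)]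
  have key : ∀ G : ℕ → MSeq E → ℝ≥0∞, (∀ n, Measurable (G n)) →
      ∫⁻ ω, G (cnt u ω.1) ω ∂(mLaw (expMeasure r) ν) =
        ∑' n, ∫⁻ ω, (if HasCount n u ω.1 then G n ω else 0) ∂(mLaw (expMeasure r) ν) := by
    intro G hG
    have hm : ∀ n, Measurable fun ω : MSeq E => if HasCount n u ω.1 then G n ω else 0 :=
      fun n => Measurable.ite (measurable_fst (measurableSet_hasCount n u)) (hG n) measurable_const
    rw [← lintegral_tsum fun n => (hm n).aemeasurable]
    refine lintegral_congr_ae ?_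
    filter_upwards [ae_good_mLaw hr ν] with ω hω
    simp_rw [hω.hasCount_iff hu]
    rw [tsum_eq_single (cnt u ω.1) (fun n hn => by simp [hn])]
    simp
  have k1 := key (fun n ω => F (pastN n (u + 1) e₀ ω, futN n u ω)) (fun n => by fun_prop)
  have k2 := key (fun n ω => ∫⁻ ω', F (pastN n (u + 1) e₀ ω, ω') ∂(mLaw (expMeasure r) ν))
    (fun n => by
      refine Measurable.lintegral_prod_right' (f := fun q : MSeq E × MSeq E =>
        F (pastN n (u + 1) e₀ q.1, q.2)) ?_
      fun_prop)
  simp only [mpast, mfut]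
  rw [k1, k2]
  exact tsum_congr fun n => lintegral_split_hasCount hr ν _ e₀ n u hF

end Splitting

/-! ### Stability of the splitting property under products and factors. -/

section SplitsProd

theorem Splits.lintegral {Ω : Type*} [MeasurableSpace Ω] {P : Measure Ω} [SFinite P]
    {past fut : Ω → Ω} (h : Splits P past fut) {F : Ω × Ω → ℝ≥0∞} (hF : Measurable F) :
    ∫⁻ ω, F (past ω, fut ω) ∂P = ∫⁻ ω, ∫⁻ ω', F (past ω, ω') ∂P ∂P := by
  have h1 := congrArg (fun μ => ∫⁻ q, F q ∂μ) h.2.2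
  rwa [lintegral_map hF (h.1.prodMk h.2.1), lintegral_prod _ hF.aemeasurable,
    lintegral_map (by exact hF.lintegral_prod_right') h.1] at h1

theorem Splits.measurePreserving {Ω : Type*} [MeasurableSpace Ω] {P : Measure Ω}
    [IsProbabilityMeasure P] {past fut : Ω → Ω} (h : Splits P past fut) :
    MeasurePreserving fut P P := by
  refine ⟨h.2.1, ?_⟩
  have h1 := congrArg (fun μ => μ.map Prod.snd) h.2.2
  have := h.1
  rw [Measure.map_map measurable_snd (h.1.prodMk h.2.1), Measure.map_snd_prod,
    Measure.map_apply h.1 .univ, preimage_univ, measure_univ, one_smul] at h1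
  exact h1

/-- Fubini: with the first system frozen, the second is replaced by a past and an independent
future, and then the first is treated likewise. What remains is the order of integration. -/
theorem Splits.prod {Ω₁ Ω₂ : Type*} [MeasurableSpace Ω₁] [MeasurableSpace Ω₂] {P₁ : Measure Ω₁}
    {P₂ : Measure Ω₂} [IsProbabilityMeasure P₁] [IsProbabilityMeasure P₂]
    {p₁ f₁ : Ω₁ → Ω₁} {p₂ f₂ : Ω₂ → Ω₂} (h₁ : Splits P₁ p₁ f₁) (h₂ : Splits P₂ p₂ f₂) :
    Splits (P₁.prod P₂) (Prod.map p₁ p₂) (Prod.map f₁ f₂) := by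
  have a1 := h₁.1
  have a2 := h₁.2.1
  have b1 := h₂.1
  have b2 := h₂.2.1
  have a3 : Measurable (Prod.map p₁ p₂) := a1.prodMap b1
  have a4 : Measurable (Prod.map f₁ f₂) := a2.prodMap b2
  refine ⟨a3, a4, ?_⟩
  refine Measure.ext_of_lintegral _ fun F hF => ?_
  rw [lintegral_map hF (a3.prodMk a4), lintegral_prod _ hF.aemeasurable,
    lintegral_map (by exact hF.lintegral_prod_right') a3,
    lintegral_prod _ (by fun_prop),
    lintegral_prod _ (by exact (hF.lintegral_prod_right'.comp a3).aemeasurable)]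
  have s1 : ∀ ω₁, ∫⁻ ω₂, F (Prod.map p₁ p₂ (ω₁, ω₂), Prod.map f₁ f₂ (ω₁, ω₂)) ∂P₂ =
      ∫⁻ q, F ((p₁ ω₁, p₂ q.1), (f₁ ω₁, q.2)) ∂(P₂.prod P₂) := fun ω₁ => by
    rw [lintegral_prod _ (by fun_prop)]
    exact h₂.lintegral (F := fun q => F ((p₁ ω₁, q.1), (f₁ ω₁, q.2))) (by fun_prop)
  simp_rw [s1]
  rw [lintegral_lintegral_swap (by
    exact Measurable.aemeasurable (by fun_prop))]
  have s2 : ∀ q : Ω₂ × Ω₂, ∫⁻ ω₁, F ((p₁ ω₁, p₂ q.1), (f₁ ω₁, q.2)) ∂P₁ =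
      ∫⁻ ω₁, ∫⁻ ω₁', F ((p₁ ω₁, p₂ q.1), (ω₁', q.2)) ∂P₁ ∂P₁ := fun q =>
    h₁.lintegral (F := fun x => F ((x.1, p₂ q.1), (x.2, q.2))) (by fun_prop)
  simp_rw [s2]
  have m1 : Measurable fun q : (Ω₂ × Ω₂) × Ω₁ =>
      ∫⁻ ω₁', F ((p₁ q.2, p₂ q.1.1), (ω₁', q.1.2)) ∂P₁ :=
    Measurable.lintegral_prod_right' (f := fun x : ((Ω₂ × Ω₂) × Ω₁) × Ω₁ =>
      F ((p₁ x.1.2, p₂ x.1.1.1), (x.2, x.1.1.2))) (by fun_prop)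
  rw [lintegral_lintegral_swap m1.aemeasurable]
  refine lintegral_congr fun ω₁ => ?_
  rw [lintegral_prod _ (by exact (m1.comp (measurable_id.prodMk measurable_const)).aemeasurable)]
  refine lintegral_congr fun ω₂ => ?_
  rw [lintegral_prod_symm _ (by fun_prop)]
  rfl

theorem Splits.pi {I : Type*} [Fintype I] {Ω : Type*} [MeasurableSpace Ω] {P : Measure Ω}
    [IsProbabilityMeasure P] {p f : Ω → Ω} (h : Splits P p f) :
    Splits (Measure.pi fun _ : I => P) (fun ω i => p (ω i)) (fun ω i => f (ω i)) := by
  have a1 := h.1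
  have a2 := h.2.1
  refine ⟨by fun_prop, by fun_prop, ?_⟩
  have := Measure.isProbabilityMeasure_map (μ := P) a1.aemeasurable
  have := Measure.isProbabilityMeasure_map (μ := P) (a1.prodMk a2).aemeasurable
  -- A family of independent pairs is a pair of independent families.
  have e1 := (measurePreserving_arrowProdEquivProdArrow Ω Ω I (fun _ => P.map p) (fun _ => P)).map_eq
  rw [← h.2.2, ← Measure.pi_map_pi (fun _ => (a1.prodMk a2).aemeasurable),
    ← Measure.pi_map_pi (fun _ => a1.aemeasurable),
    Measure.map_map (MeasurableEquiv.measurable _) (by fun_prop)] at e1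
  exact e1

/-- Splitting descends along a measure-preserving map that intertwines the past and future maps. It
serves to forget trivial marks. -/
theorem Splits.map {Ω Ω' : Type*} [MeasurableSpace Ω] [MeasurableSpace Ω'] {P : Measure Ω}
    {P' : Measure Ω'} [IsProbabilityMeasure P] [IsProbabilityMeasure P'] {p f : Ω → Ω}
    {p' f' : Ω' → Ω'} (h : Splits P p f) {φ : Ω → Ω'}
    (hφ : MeasurePreserving φ P P') (hp' : Measurable p') (hf' : Measurable f')
    (hp : ∀ ω, φ (p ω) = p' (φ ω)) (hf : ∀ ω, φ (f ω) = f' (φ ω)) : Splits P' p' f' := by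
  refine ⟨hp', hf', ?_⟩
  have hφm := hφ.measurable
  refine Measure.ext_of_lintegral _ fun F hF => ?_
  rw [lintegral_map hF (hp'.prodMk hf'), lintegral_prod _ hF.aemeasurable,
    lintegral_map (by exact hF.lintegral_prod_right') hp', ← hφ.lintegral_comp (by fun_prop),
    ← hφ.lintegral_comp (f := fun ω => ∫⁻ y, F (p' ω, y) ∂P') (by
      exact hF.lintegral_prod_right'.comp hp')]
  simp_rw [← hp, ← hf]
  rw [h.lintegral (F := fun q => F (φ q.1, φ q.2)) (by fun_prop)]
  refine lintegral_congr fun ω => ?_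
  rw [← hφ.lintegral_comp (f := fun y => F (φ (p ω), y)) (by fun_prop)]

end SplitsProd

/-! ### Splitting of an unmarked Poisson process. -/

section Unmarked

/-- The arrivals up to time `u`. -/
noncomputable def spast (u : ℝ) (x : ℕ → ℝ) : ℕ → ℝ := fun i => if i < cnt u x then x i else u + 1

/-- The arrivals after time `u`, seen from time `u`. -/
noncomputable def sfut (u : ℝ) (x : ℕ → ℝ) : ℕ → ℝ :=
  fun i => if i = 0 then psum x (cnt u x + 1) - u else x (cnt u x + i)

@[fun_prop]
theorem measurable_spast (u : ℝ) : Measurable (spast u) :=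
  ((measurable_mpast () u).comp (measurable_id.prodMk (measurable_const (a := fun _ => ())))).fst

@[fun_prop]
theorem measurable_sfut (u : ℝ) : Measurable (sfut u) :=
  ((measurable_mfut (E := Unit) u).comp
    (measurable_id.prodMk (measurable_const (a := fun _ => ())))).fst

theorem splits_infinitePi {r : ℝ} (hr : 0 < r) {u : ℝ} (hu : 0 ≤ u) :
    Splits (Measure.infinitePi fun _ : ℕ => expMeasure r) (spast u) (sfut u) := by
  have hP := isProbabilityMeasure_expMeasure hr
  exact (splits_mLaw hr (Measure.dirac ()) () hu).map measurePreserving_fst (by fun_prop)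
    (by fun_prop) (fun _ => rfl) (fun _ => rfl)

theorem psum_sfut (u : ℝ) (x : ℕ → ℝ) (n : ℕ) :
    psum (sfut u x) (n + 1) = psum x (cnt u x + n + 1) - u := by
  induction n with
  | zero => simp [psum_succ, psum_zero, sfut]
  | succ n ih =>
    rw [psum_succ, ih, psum_succ x (cnt u x + (n + 1)), add_assoc]
    simp [sfut]; ring

theorem psum_spast_of_le {u : ℝ} {x : ℕ → ℝ} {n : ℕ} (hn : n ≤ cnt u x) :
    psum (spast u x) n = psum x n := by
  refine Finset.sum_congr rfl fun i hi => ?_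
  rw [Finset.mem_range] at hi
  simp [spast, show i < cnt u x by omega]

/-- The filling gap `u + 1` alone exceeds `u`, so truncation creates no spurious arrival up to time
`u`. -/
theorem Good.lt_psum_spast {u : ℝ} {x : ℕ → ℝ} (hx : Good x) (hu : 0 ≤ u) {n : ℕ}
    (hn : cnt u x < n) : u < psum (spast u x) n := by
  have h0 : 0 ≤ psum x (cnt u x) := by
    simpa [psum_zero] using hx.strictMono.monotone (Nat.zero_le (cnt u x))
  induction n, (Nat.succ_le_of_lt hn) using Nat.le_induction with
  | base =>
    rw [Nat.succ_eq_add_one, psum_succ, psum_spast_of_le le_rfl]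
    simp only [spast, lt_irrefl, if_false]
    linarith
  | succ n h ih =>
    rw [psum_succ]
    have := ih h
    have h2 : ¬ n < cnt u x := by omega
    simp only [spast, h2, if_false] at this ⊢
    linarith

theorem Good.psum_spast_le_iff {u : ℝ} {x : ℕ → ℝ} (hx : Good x) (hu : 0 ≤ u) (n : ℕ) :
    psum (spast u x) n ≤ u ↔ n ≤ cnt u x := by
  constructor
  · intro h
    by_contra h'
    linarith [hx.lt_psum_spast hu (not_le.1 h')]
  · intro h
    rw [psum_spast_of_le h]
    exact (hx.le_iff hu n).2 h

/-- There is an arrival in `[v, w]`. -/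
def Arr (x : ℕ → ℝ) (v w : ℝ) : Prop := ∃ r, v ≤ psum x (r + 1) ∧ psum x (r + 1) ≤ w

theorem Good.arr_spast {u : ℝ} {x : ℕ → ℝ} (hx : Good x) (hu : 0 ≤ u) (v : ℝ) :
    Arr (spast u x) v u ↔ Arr x v u := by
  refine exists_congr fun r => ?_
  rw [hx.psum_spast_le_iff hu, hx.le_iff hu]
  refine and_congr_left fun h => ?_
  rw [psum_spast_of_le h]

/-- Since `u < v`, every arrival that counts lies after `u` and thus belongs to the future, with its
index lowered by `cnt u x`. -/
theorem Good.arr_sfut {u : ℝ} {x : ℕ → ℝ} (hx : Good x) (hu : 0 ≤ u) {v : ℝ} (hv : u < v) (w : ℝ) :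
    Arr (sfut u x) (v - u) (w - u) ↔ Arr x v w := by
  constructor
  · rintro ⟨r, h1, h2⟩
    rw [psum_sfut] at h1 h2
    exact ⟨cnt u x + r, by linarith, by linarith⟩
  · rintro ⟨r, h1, h2⟩
    have h3 : ¬ (r + 1 ≤ cnt u x) := fun h => by
      have := (hx.le_iff hu _).2 h
      linarith
    obtain ⟨r', rfl⟩ := Nat.exists_eq_add_of_le (show cnt u x ≤ r by omega)
    exact ⟨r', by rw [psum_sfut]; linarith, by rw [psum_sfut]; linarith⟩

end Unmarked

/-! ### Pathwise inequalities for the lag of one node. -/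

section System

variable {E : Type*} {I : Type*}

/-- A source with marks and, for every `i : I`, an incoming edge. -/
abbrev Sys (E I : Type*) : Type _ := MSeq E × (I → ℕ → ℝ)

/-- The time at which the source creates version `p + 1`. -/
noncomputable def born (ω : Sys E I) (p : ℕ) : ℝ := psum ω.1.1 (p + 1)

/-- The edges that are activated between the creation of version `p + 1` and time `t`. -/
def heard (ω : Sys E I) (p : ℕ) (t : ℝ) : Set I := {i | Arr (ω.2 i) (born ω p) t}

variable (dec : E → Set I → Prop)

/-- Version `p + 1` cannot be decoded at time `t`. -/
def Undec (ω : Sys E I) (p : ℕ) (t : ℝ) : Prop := ¬ dec (ω.1.2 p) (heard ω p t)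

/-- Version `p + 1` has been created, but neither it nor any later version can be decoded. -/
def Stale (ω : Sys E I) (p : ℕ) (t : ℝ) : Prop :=
  born ω p ≤ t ∧ ∀ q ≥ p, born ω q ≤ t → Undec dec ω q t

/-- No version can be decoded at time `t`. -/
def NoDec (ω : Sys E I) (t : ℝ) : Prop := ∀ q, born ω q ≤ t → Undec dec ω q t

open Classical in
/-- The number of versions by which the node is behind the source at time `t`. -/
noncomputable def lag (ω : Sys E I) (t : ℝ) : ℝ≥0∞ := ∑' p, if Stale dec ω p t then 1 else 0

/-- All gap sequences are positive with divergent sums. -/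
def GoodSys (ω : Sys E I) : Prop := Good ω.1.1 ∧ ∀ i, Good (ω.2 i)

/-- The system up to time `u`. -/
noncomputable def past (e₀ : E) (u : ℝ) : Sys E I → Sys E I :=
  Prod.map (mpast e₀ u) (fun x i => spast u (x i))

/-- The system after time `u`. -/
noncomputable def fut (u : ℝ) : Sys E I → Sys E I :=
  Prod.map (mfut u) (fun x i => sfut u (x i))

variable {dec}

/-- Staleness at `u` involves only arrivals up to `u`; the past retains them and its filling adds
none. So the lag at `u` is a function of the past, as the independence arguments require. -/
theorem GoodSys.stale_past {ω : Sys E I} (hω : GoodSys ω) (e₀ : E) {u : ℝ} (hu : 0 ≤ u) (p : ℕ) :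
    Stale dec (past e₀ u ω) p u ↔ Stale dec ω p u := by
  have hb : ∀ q, born (past e₀ u ω) q ≤ u ↔ born ω q ≤ u := fun q =>
    (hω.1.psum_spast_le_iff hu _).trans (hω.1.le_iff hu _).symm
  have hd : ∀ q, born ω q ≤ u → (Undec dec (past e₀ u ω) q u ↔ Undec dec ω q u) := by
    intro q hq
    have hq' := (hω.1.le_iff hu _).1 hq
    have e1 : born (past e₀ u ω) q = born ω q := psum_spast_of_le hq'
    have e2 : (past e₀ u ω).1.2 q = ω.1.2 q := if_pos (show q < cnt u ω.1.1 by omega)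
    have e3 : heard (past e₀ u ω) q u = heard ω q u := by
      ext i
      change Arr (spast u (ω.2 i)) (born (past e₀ u ω) q) u ↔ _
      rw [e1]
      exact (hω.2 i).arr_spast hu _
    rw [Undec, Undec, e2, e3]
  unfold Stale
  simp only [hb]
  refine and_congr_right fun _ => forall_congr' fun q => forall_congr' fun _ =>
    forall_congr' fun h => hd q h

theorem born_fut (ω : Sys E I) (u : ℝ) (p : ℕ) :
    born (fut u ω) p = born ω (cnt u ω.1.1 + p) - u := psum_sfut u ω.1.1 p

/-- Versions created after `u` depend only on activations after their creation, hence after `u`, so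
the future sees them correctly. -/
theorem GoodSys.undec_fut {ω : Sys E I} (hω : GoodSys ω) {u : ℝ} (hu : 0 ≤ u) (q : ℕ) (v : ℝ) :
    Undec dec (fut u ω) q (v - u) ↔ Undec dec ω (cnt u ω.1.1 + q) v := by
  have h1 : u < born ω (cnt u ω.1.1 + q) :=
    (hω.1.lt_cnt u).trans_le (hω.1.strictMono.monotone (by omega))
  have e3 : heard (fut u ω) q (v - u) = heard ω (cnt u ω.1.1 + q) v := by
    ext i
    change Arr (sfut u (ω.2 i)) (born (fut u ω) q) (v - u) ↔ _
    rw [born_fut]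
    exact (hω.2 i).arr_sfut hu h1 _
  rw [Undec, Undec, e3]
  rfl

theorem GoodSys.stale_fut {ω : Sys E I} (hω : GoodSys ω) {u : ℝ} (hu : 0 ≤ u) (p : ℕ) (v : ℝ) :
    Stale dec (fut u ω) p (v - u) ↔ Stale dec ω (cnt u ω.1.1 + p) v := by
  unfold Stale
  simp only [born_fut, hω.undec_fut hu, sub_le_sub_iff_right]
  refine and_congr_right fun _ => ⟨fun h q hq => ?_, fun h q hq => h _ (by omega)⟩
  obtain ⟨q', rfl⟩ := Nat.exists_eq_add_of_le (show cnt u ω.1.1 ≤ q by omega)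
  exact h q' (by omega)

/-- Staleness forbids decoding of every later version, in particular of all those created after `u`.
-/
theorem GoodSys.noDec_fut {ω : Sys E I} (hω : GoodSys ω) {u : ℝ} (hu : 0 ≤ u) {p : ℕ} {v : ℝ}
    (hp : p < cnt u ω.1.1) (h : Stale dec ω p v) : NoDec dec (fut u ω) (v - u) := by
  intro q hq
  rw [born_fut, sub_le_sub_iff_right] at hq
  exact (hω.undec_fut hu q v).2 (h.2 _ (by omega) hq)

theorem Undec.anti (hdec : ∀ e A B, A ⊆ B → dec e A → dec e B) {ω : Sys E I} {p : ℕ} {u v : ℝ}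
    (huv : u ≤ v) (h : Undec dec ω p v) : Undec dec ω p u := fun h' =>
  h (hdec _ _ _ (fun _ hi => hi.imp fun _ hr => ⟨hr.1, hr.2.trans huv⟩) h')

/-- Keys are never lost and `dec` is monotone, so what cannot be decoded at `v` could not be decoded
earlier. -/
theorem GoodSys.stale_of_lt_cnt (hdec : ∀ e A B, A ⊆ B → dec e A → dec e B) {ω : Sys E I}
    (hω : GoodSys ω) {u : ℝ} (hu : 0 ≤ u) {p : ℕ} {v : ℝ} (huv : u ≤ v)
    (hp : p < cnt u ω.1.1) (h : Stale dec ω p v) : Stale dec ω p u :=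
  ⟨(hω.1.le_iff hu _).2 hp, fun q hq hb => (h.2 q hq (hb.trans huv)).anti hdec huv⟩

open Classical in
theorem GoodSys.lag_eq {ω : Sys E I} (hω : GoodSys ω) {u : ℝ} (hu : 0 ≤ u) (v : ℝ) :
    lag dec ω v = (∑ p ∈ Finset.range (cnt u ω.1.1), if Stale dec ω p v then 1 else 0) +
      lag dec (fut u ω) (v - u) := by
  have h : ∑' p, (if Stale dec (fut u ω) p (v - u) then (1 : ℝ≥0∞) else 0) =
      ∑' p, if Stale dec ω (p + cnt u ω.1.1) v then 1 else 0 :=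
    tsum_congr fun p => by rw [if_congr (hω.stale_fut hu p v) rfl rfl, add_comm]
  unfold lag
  rw [h]
  exact (Summable.sum_add_tsum_nat_add' (f := fun p => if Stale dec ω p v then (1 : ℝ≥0∞) else 0)
    ENNReal.summable).symm

theorem GoodSys.lag_fut_le {ω : Sys E I} (hω : GoodSys ω) {u : ℝ} (hu : 0 ≤ u) (v : ℝ) :
    lag dec (fut u ω) (v - u) ≤ lag dec ω v := by
  rw [hω.lag_eq hu v]; exact le_add_self

-- An old version still stale at `v` was already stale at `u`, and its staleness means that nothing
-- newer is decodable at `v`. The correction is thus a function of the past times a function of the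
-- future, which become independent factors.
open Classical in
theorem GoodSys.lag_le_fut_add (hdec : ∀ e A B, A ⊆ B → dec e A → dec e B) {ω : Sys E I}
    (hω : GoodSys ω) (e₀ : E) {u : ℝ} (hu : 0 ≤ u) {v : ℝ} (huv : u ≤ v) :
    lag dec ω v ≤ lag dec (fut u ω) (v - u) +
      lag dec (past e₀ u ω) u * (if NoDec dec (fut u ω) (v - u) then 1 else 0) := by
  rw [hω.lag_eq hu v, add_comm]
  refine add_le_add_right ?_ _
  split_ifs with hN
  · rw [mul_one]
    unfold lag
    simp_rw [hω.stale_past e₀ hu]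
    refine le_trans (Finset.sum_le_sum fun p hp => ?_) (ENNReal.sum_le_tsum _)
    by_cases h : Stale dec ω p v
    · rw [if_pos h, if_pos (hω.stale_of_lt_cnt hdec hu huv (Finset.mem_range.1 hp) h)]
    · simp [h]
  · rw [mul_zero, nonpos_iff_eq_zero]
    refine Finset.sum_eq_zero fun p hp => if_neg fun h => hN ?_
    exact hω.noDec_fut hu (Finset.mem_range.1 hp) h

-- A stale version is itself undecodable. Forgetting the condition on later versions leaves events
-- about single versions, to which Campbell's formula applies.
open Classical in
theorem GoodSys.lag_le_fut_add_undec {ω : Sys E I}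
    (hω : GoodSys ω) {u : ℝ} (hu : 0 ≤ u) (v : ℝ) :
    lag dec ω v ≤ lag dec (fut u ω) (v - u) +
      ∑' p, if born ω p ≤ u ∧ Undec dec ω p v ∧ born ω p ≤ v then 1 else 0 := by
  rw [hω.lag_eq hu v, add_comm]
  refine add_le_add_right ?_ _
  refine le_trans (Finset.sum_le_sum fun p hp => ?_) (ENNReal.sum_le_tsum (Finset.range _))
  by_cases h : Stale dec ω p v
  · rw [if_pos h, if_pos ⟨(hω.1.le_iff hu _).2 (Finset.mem_range.1 hp), h.2 p le_rfl h.1, h.1⟩]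
  · simp [h]

end System

/-! ### The law of the system, its splitting and measurability. -/

section SystemLaw

variable {E : Type*} [MeasurableSpace E] {I : Type*} [Fintype I]

/-- The law of a system with source rate `lamS`, mark law `ν` and edge rate `r`. -/
noncomputable abbrev sysLaw (I : Type*) [Fintype I] (lamS r : ℝ) (ν : Measure E) :
    Measure (Sys E I) :=
  (mLaw (expMeasure lamS) ν).prod
    (Measure.pi fun _ : I => Measure.infinitePi fun _ : ℕ => expMeasure r)

theorem isProbabilityMeasure_sysLaw {lamS r : ℝ} (hS : 0 < lamS) (hr : 0 < r) (ν : Measure E)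
    [IsProbabilityMeasure ν] : IsProbabilityMeasure (sysLaw I lamS r ν) := by
  have := isProbabilityMeasure_expMeasure hS
  have := isProbabilityMeasure_expMeasure hr
  infer_instance

theorem splits_sysLaw {lamS r : ℝ} (hS : 0 < lamS) (hr : 0 < r) (ν : Measure E)
    [IsProbabilityMeasure ν] (e₀ : E) {u : ℝ} (hu : 0 ≤ u) :
    Splits (sysLaw I lamS r ν) (past e₀ u) (fut u) := by
  have := isProbabilityMeasure_expMeasure hS
  have := isProbabilityMeasure_expMeasure hr
  exact (splits_mLaw hS ν e₀ hu).prod (splits_infinitePi hr hu).pi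

theorem ae_goodSys {lamS r : ℝ} (hS : 0 < lamS) (hr : 0 < r) (ν : Measure E)
    [IsProbabilityMeasure ν] : ∀ᵐ ω ∂(sysLaw I lamS r ν), GoodSys ω := by
  have := isProbabilityMeasure_expMeasure hS
  have := isProbabilityMeasure_expMeasure hr
  have h1 : ∀ᵐ ω ∂(sysLaw I lamS r ν), Good ω.1.1 :=
    measurePreserving_fst.quasiMeasurePreserving.ae (ae_good_mLaw hS ν)
  have h2 : ∀ᵐ x ∂(Measure.pi fun _ : I => Measure.infinitePi fun _ : ℕ => expMeasure r),
      ∀ i, Good (x i) := ae_all_iff.2 fun i =>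
    (measurePreserving_eval (fun _ : I => Measure.infinitePi fun _ : ℕ => expMeasure r)
      i).quasiMeasurePreserving.ae (ae_good hr)
  have h3 : ∀ᵐ ω ∂(sysLaw I lamS r ν), ∀ i, Good (ω.2 i) :=
    measurePreserving_snd.quasiMeasurePreserving.ae h2
  filter_upwards [h1, h3] with ω a b using ⟨a, b⟩

omit [Fintype I] in
@[fun_prop]
theorem measurable_born (p : ℕ) : Measurable fun ω : Sys E I => born ω p :=
  (measurable_psum (p + 1)).comp (measurable_fst.comp measurable_fst)

variable [Countable E] [MeasurableSingletonClass E] (dec : E → Set I → Prop)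

/-- Nothing is assumed about `dec`; the event is decomposed over the countably many marks and the
finitely many sets of edges. -/
theorem measurable_undec (p : ℕ) :
    Measurable fun q : Sys E I × ℝ => Undec dec q.1 p q.2 := by
  have h1 : ∀ i : I, Measurable fun q : Sys E I × ℝ => i ∈ heard q.1 p q.2 := by
    intro i
    refine Measurable.exists fun r => Measurable.and ?_ ?_
    · exact measurableSet_setOfPred.1 (measurableSet_le
        ((measurable_born p).comp measurable_fst) ((measurable_psum (r + 1)).comp (by fun_prop)))
    · exact measurableSet_setOfPred.1 (measurableSet_le
        ((measurable_psum (r + 1)).comp (by fun_prop)) measurable_snd)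
  have h2 : (fun q : Sys E I × ℝ => Undec dec q.1 p q.2) = fun q => ¬ ∃ e : E, ∃ A : Set I,
      (q.1.1.2 p = e ∧ ∀ i, i ∈ heard q.1 p q.2 ↔ i ∈ A) ∧ dec e A := by
    ext q
    unfold Undec
    refine not_congr ⟨fun h => ⟨_, _, ⟨rfl, fun i => Iff.rfl⟩, h⟩, ?_⟩
    rintro ⟨e, A, ⟨rfl, hA⟩, h⟩
    rwa [Set.ext hA]
  rw [h2]
  refine Measurable.not (Measurable.exists fun e => Measurable.exists fun A =>
    Measurable.and (Measurable.and ?_ ?_) measurable_const)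
  · have : Measurable fun q : Sys E I × ℝ => q.1.1.2 p := by fun_prop
    exact measurableSet_setOfPred.1 (this (measurableSet_singleton e))
  · exact Measurable.forall fun i => (h1 i).iff measurable_const

omit [Fintype I] [Countable E] [MeasurableSingletonClass E] in
theorem measurable_born_le (p : ℕ) : Measurable fun q : Sys E I × ℝ => born q.1 p ≤ q.2 :=
  measurableSet_setOfPred.1 (measurableSet_le
    ((measurable_born p).comp measurable_fst) measurable_snd)

theorem measurable_stale (p : ℕ) : Measurable fun q : Sys E I × ℝ => Stale dec q.1 p q.2 :=
  (measurable_born_le p).and (Measurable.forall fun q => Measurable.imp measurable_const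
    ((measurable_born_le q).imp (measurable_undec dec q)))

theorem measurable_noDec : Measurable fun q : Sys E I × ℝ => NoDec dec q.1 q.2 :=
  Measurable.forall fun q => (measurable_born_le q).imp (measurable_undec dec q)

theorem measurable_lag_uncurry : Measurable fun q : Sys E I × ℝ => lag dec q.1 q.2 := by
  classical
  unfold lag
  exact Measurable.tsum fun p => Measurable.ite
    (measurableSet_setOfPred.2 (measurable_stale dec p)) measurable_const measurable_const

@[fun_prop]
theorem measurable_lag (t : ℝ) : Measurable fun ω : Sys E I => lag dec ω t :=
  (measurable_lag_uncurry dec).comp (measurable_id.prodMk measurable_const)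

theorem measurableSet_noDec (t : ℝ) : MeasurableSet {ω : Sys E I | NoDec dec ω t} :=
  measurableSet_setOfPred.2
    ((measurable_noDec dec).comp ((measurable_id (α := Sys E I)).prodMk (measurable_const (a := t))))

end SystemLaw

/-! ### The probability of an interval without arrivals. -/

section Gap

theorem Good.no_arrival_iff {x : ℕ → ℝ} (hx : Good x) {u : ℝ} (hu : 0 ≤ u) (w : ℝ) :
    (∀ n, ¬ (u < psum x (n + 1) ∧ psum x (n + 1) ≤ w)) ↔ w - u < sfut u x 0 := by
  have h0 : sfut u x 0 = psum x (cnt u x + 1) - u := by simp [sfut]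
  rw [h0]
  constructor
  · intro h
    have := h (cnt u x)
    rw [not_and, not_le] at this
    linarith [this (hx.lt_cnt u)]
  · rintro h n ⟨h1, h2⟩
    have h3 : ¬ (n + 1 ≤ cnt u x) := fun h => by
      have := (hx.le_iff hu _).2 h
      linarith
    have := hx.strictMono.monotone (show cnt u x + 1 ≤ n + 1 by omega)
    linarith

/-- By splitting at `u`, the waiting time from `u` to the next arrival is again exponential. -/
theorem measure_no_arrival {r : ℝ} (hr : 0 < r) {u w : ℝ} (hu : 0 ≤ u) (huw : u ≤ w) :
    (Measure.infinitePi fun _ : ℕ => expMeasure r)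
      {x | ∀ n, ¬ (u < psum x (n + 1) ∧ psum x (n + 1) ≤ w)} =
        ENNReal.ofReal (Real.exp (-(r * (w - u)))) := by
  have hP := isProbabilityMeasure_expMeasure hr
  have h1 := ((measurePreserving_eval_infinitePi (fun _ : ℕ => expMeasure r) 0).comp
    (splits_infinitePi hr hu).measurePreserving).measure_preimage
      (measurableSet_Ioi (a := w - u)).nullMeasurableSet
  rw [expMeasure_Ioi hr (by linarith)] at h1
  rw [← h1]
  refine measure_congr ?_
  filter_upwards [ae_good hr] with x hx
  exact propext (hx.no_arrival_iff hu w)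

end Gap

/-! ### Moments and covariances of the lag. -/

section Moments

variable {E : Type*} [MeasurableSpace E] {I : Type*} [Fintype I]
  [Countable E] [MeasurableSingletonClass E] {dec : E → Set I → Prop}
  {lamS r : ℝ} {ν : Measure E} [IsProbabilityMeasure ν]

-- If version `1` is created in the first half of `[0, t]` and every edge is activated in the second
-- half, that version has been heard on all edges and can be decoded. The bound is the union bound
-- over the failures of these events.
omit [Countable E] [MeasurableSingletonClass E] in
theorem measure_noDec_le (hS : 0 < lamS) (hr : 0 < r) (hfull : ∀ᵐ e ∂ν, dec e univ)
    {t : ℝ} (ht : 0 ≤ t) :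
    sysLaw I lamS r ν {ω | NoDec dec ω t} ≤ ENNReal.ofReal (Real.exp (-(lamS * (t / 2)))) +
      Fintype.card I * ENNReal.ofReal (Real.exp (-(r * (t / 2)))) := by
  have hP1 := isProbabilityMeasure_expMeasure hS
  have hP2 := isProbabilityMeasure_expMeasure hr
  have ht2 : 0 ≤ t / 2 := by linarith
  have hd : ∀ᵐ ω ∂(sysLaw I lamS r ν), dec (ω.1.2 0) univ := by
    have h1 : ∀ᵐ y ∂(Measure.infinitePi fun _ : ℕ => ν), dec (y 0) univ :=
      (measurePreserving_eval_infinitePi (fun _ : ℕ => ν) 0).quasiMeasurePreserving.ae hfull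
    have h2 : ∀ᵐ ω ∂(mLaw (expMeasure lamS) ν), dec (ω.2 0) univ :=
      measurePreserving_snd.quasiMeasurePreserving.ae h1
    exact measurePreserving_fst.quasiMeasurePreserving.ae h2
  have h1 : sysLaw I lamS r ν {ω | t / 2 < ω.1.1 0} =
      ENNReal.ofReal (Real.exp (-(lamS * (t / 2)))) := by
    rw [← expMeasure_Ioi hS ht2]
    exact (((measurePreserving_eval_infinitePi (fun _ : ℕ => expMeasure lamS) 0).comp
      measurePreserving_fst).comp (measurePreserving_fst (μ := mLaw (expMeasure lamS) ν))).measure_preimage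
        (measurableSet_Ioi (a := t / 2)).nullMeasurableSet
  have h2 : ∀ i : I, sysLaw I lamS r ν
      {ω | ∀ n, ¬ (t / 2 < psum (ω.2 i) (n + 1) ∧ psum (ω.2 i) (n + 1) ≤ t)} =
      ENNReal.ofReal (Real.exp (-(r * (t / 2)))) := by
    intro i
    have := measure_no_arrival hr ht2 (show t / 2 ≤ t by linarith)
    rw [show t - t / 2 = t / 2 by ring] at this
    rw [← this]
    have hm : MeasurableSet {x : ℕ → ℝ | ∀ n, ¬ (t / 2 < psum x (n + 1) ∧ psum x (n + 1) ≤ t)} := by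
      refine measurableSet_setOfPred.2 (Measurable.forall fun n => Measurable.not
        (Measurable.and ?_ ?_))
      · exact measurableSet_setOfPred.1 (measurableSet_lt measurable_const (by fun_prop))
      · exact measurableSet_setOfPred.1 (measurableSet_le (by fun_prop) measurable_const)
    exact ((measurePreserving_eval (fun _ : I => Measure.infinitePi fun _ : ℕ => expMeasure r) i).comp
      (measurePreserving_snd (μ := mLaw (expMeasure lamS) ν))).measure_preimage hm.nullMeasurableSet
  calc sysLaw I lamS r ν {ω | NoDec dec ω t}
      ≤ sysLaw I lamS r ν ({ω | t / 2 < ω.1.1 0} ∪ ⋃ i : I,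
          {ω | ∀ n, ¬ (t / 2 < psum (ω.2 i) (n + 1) ∧ psum (ω.2 i) (n + 1) ≤ t)}) := by
        refine measure_mono_ae ?_
        filter_upwards [hd] with ω hω hN
        by_contra hcon
        have hcon' : ¬ (t / 2 < ω.1.1 0 ∨ ∃ i, ∀ n, ¬ (t / 2 < psum (ω.2 i) (n + 1) ∧
            psum (ω.2 i) (n + 1) ≤ t)) := fun h => hcon (by
          rcases h with h | ⟨i, h⟩
          · exact Or.inl h
          · exact Or.inr (mem_iUnion.2 ⟨i, h⟩))
        push Not at hcon'
        obtain ⟨c1, c2⟩ := hcon'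
        have hb : born ω 0 ≤ t / 2 := by simpa [born, psum] using c1
        refine hN 0 (by linarith) ?_
        have : heard ω 0 t = univ := by
          refine eq_univ_of_forall fun i => ?_
          obtain ⟨n, hn1, hn2⟩ := c2 i
          exact ⟨n, by linarith, hn2⟩
        rwa [this]
    _ ≤ _ := by
        refine (measure_union_le _ _).trans (add_le_add h1.le ?_)
        refine (measure_iUnion_le _).trans ?_
        simp_rw [h2]
        simp

theorem Splits.lintegral_mul {Ω : Type*} [MeasurableSpace Ω] {P : Measure Ω} [SFinite P]
    {p f : Ω → Ω} (h : Splits P p f) {F G : Ω → ℝ≥0∞} (hF : Measurable F) (hG : Measurable G) :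
    ∫⁻ ω, F (p ω) * G (f ω) ∂P = (∫⁻ ω, F (p ω) ∂P) * ∫⁻ ω, G ω ∂P := by
  rw [h.lintegral (F := fun q => F q.1 * G q.2) (by fun_prop)]
  simp_rw [lintegral_const_mul _ hG]
  exact lintegral_mul_const _ (hF.comp h.1)

/-- Mean lag at time `u`. -/
noncomputable def meanLag (dec : E → Set I → Prop) (lamS r : ℝ) (ν : Measure E) (u : ℝ) : ℝ≥0∞ :=
  ∫⁻ ω, lag dec ω u ∂(sysLaw I lamS r ν)

/-- Mean square lag at time `u`. -/
noncomputable def sqLag (dec : E → Set I → Prop) (lamS r : ℝ) (ν : Measure E) (u : ℝ) : ℝ≥0∞ :=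
  ∫⁻ ω, lag dec ω u ^ 2 ∂(sysLaw I lamS r ν)

theorem lintegral_lag_fut (hS : 0 < lamS) (hr : 0 < r) {u : ℝ} (hu : 0 ≤ u) (w : ℝ) :
    ∫⁻ ω, lag dec (fut u ω) w ∂(sysLaw I lamS r ν) = meanLag dec lamS r ν w := by
  have := isProbabilityMeasure_sysLaw (I := I) hS hr ν
  have e₀ : E := (nonempty_of_isProbabilityMeasure ν).some
  exact (splits_sysLaw hS hr ν e₀ hu).measurePreserving.lintegral_comp (measurable_lag dec w)

/-- The system restarted at `v - w` is a fresh copy, and its lag at its own time `w` is at most the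
original lag at `v`. -/
theorem meanLag_mono (hS : 0 < lamS) (hr : 0 < r) {w v : ℝ} (h : w ≤ v) :
    meanLag dec lamS r ν w ≤ meanLag dec lamS r ν v := by
  rw [← lintegral_lag_fut hS hr (sub_nonneg.2 h)]
  refine lintegral_mono_ae ?_
  filter_upwards [ae_goodSys hS hr ν] with ω hω
  have := hω.lag_fut_le (dec := dec) (sub_nonneg.2 h) v
  rwa [sub_sub_cancel] at this

theorem sqLag_mono (hS : 0 < lamS) (hr : 0 < r) {w v : ℝ} (h : w ≤ v) :
    sqLag dec lamS r ν w ≤ sqLag dec lamS r ν v := by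
  have := isProbabilityMeasure_sysLaw (I := I) hS hr ν
  have e₀ : E := (nonempty_of_isProbabilityMeasure ν).some
  unfold sqLag
  rw [← (splits_sysLaw hS hr ν e₀ (sub_nonneg.2 h)).measurePreserving.lintegral_comp
    ((measurable_lag dec w).pow_const 2)]
  refine lintegral_mono_ae ?_
  filter_upwards [ae_goodSys hS hr ν] with ω hω
  have := hω.lag_fut_le (dec := dec) (sub_nonneg.2 h) v
  rw [sub_sub_cancel] at this
  gcongr

omit [Countable E] [MeasurableSingletonClass E] in
theorem measure_born_le (hS : 0 < lamS) (hr : 0 < r) (u : ℝ) (p : ℕ) :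
    sysLaw I lamS r ν {ω | born ω p ≤ u} ≤ ENNReal.ofReal (Real.exp u) *
      (∫⁻ a, ENNReal.ofReal (Real.exp (-a)) ∂(expMeasure lamS)) ^ (p + 1) := by
  have hP1 := isProbabilityMeasure_expMeasure hS
  have hP2 := isProbabilityMeasure_expMeasure hr
  refine le_trans (le_of_eq ?_) (measure_psum_le hS u (p + 1))
  exact (measurePreserving_fst.comp
    (measurePreserving_fst (μ := mLaw (expMeasure lamS) ν))).measure_preimage
      (measurableSet_le (measurable_psum (p + 1)) (measurable_const (a := u))).nullMeasurableSet

-- The lag is at most the number of versions created. Its square is a double sum over `p, q` of the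
-- event that version `max p q + 1` exists; since `max p q ≥ (p + q) / 2`, the square root `b` of
-- the geometric ratio makes the double sum a product of geometric series.
omit [Countable E] [MeasurableSingletonClass E] in
theorem sqLag_lt_top (hS : 0 < lamS) (hr : 0 < r) (u : ℝ) : sqLag dec lamS r ν u < ∞ := by
  classical
  have hprob := isProbabilityMeasure_sysLaw (I := I) hS hr ν
  set β := ∫⁻ a, ENNReal.ofReal (Real.exp (-a)) ∂(expMeasure lamS) with hβ
  have hβ1 : β < 1 := lintegral_exp_lt_one hS
  set b := β ^ (1 / 2 : ℝ) with hb
  have hb1 : b < 1 := ENNReal.rpow_lt_one hβ1 (by norm_num)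
  have hbb : b ^ 2 = β := by
    rw [hb, ← ENNReal.rpow_natCast, ← ENNReal.rpow_mul]; norm_num
  have hle : ∀ ω : Sys E I, lag dec ω u ^ 2 ≤ ∑' p : ℕ, ∑' q : ℕ,
      {ω : Sys E I | born ω p ≤ u ∧ born ω q ≤ u}.indicator (fun _ => (1 : ℝ≥0∞)) ω := by
    intro ω
    rw [pow_two, lag, ← ENNReal.tsum_mul_right]
    refine ENNReal.tsum_le_tsum fun p => ?_
    rw [← ENNReal.tsum_mul_left]
    refine ENNReal.tsum_le_tsum fun q => ?_
    by_cases h1 : Stale dec ω p u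
    · by_cases h2 : Stale dec ω q u
      · rw [indicator_of_mem (by exact ⟨h1.1, h2.1⟩)]; simp [h1, h2]
      · simp [h2]
    · simp [h1]
  have hm : ∀ p q : ℕ, MeasurableSet {ω : Sys E I | born ω p ≤ u ∧ born ω q ≤ u} := fun p q =>
    (measurableSet_le (measurable_born p) measurable_const).inter
      (measurableSet_le (measurable_born q) measurable_const)
  have hpq : ∀ p q : ℕ, sysLaw I lamS r ν {ω : Sys E I | born ω p ≤ u ∧ born ω q ≤ u} ≤
      ENNReal.ofReal (Real.exp u) * (b ^ p * b ^ q) := by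
    intro p q
    refine le_trans (measure_mono (t := {ω | born ω (max p q) ≤ u}) ?_)
      ((measure_born_le hS hr u (max p q)).trans ?_)
    · rintro ω ⟨h1, h2⟩
      rcases max_choice p q with h | h <;> rw [h] <;> assumption
    · gcongr
      rw [← hβ, ← hbb, ← pow_mul, ← pow_add]
      exact pow_le_pow_right_of_le_one' hb1.le (by omega)
  calc sqLag dec lamS r ν u ≤ ∫⁻ ω, ∑' p : ℕ, ∑' q : ℕ,
      {ω : Sys E I | born ω p ≤ u ∧ born ω q ≤ u}.indicator (fun _ => (1 : ℝ≥0∞)) ω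
        ∂(sysLaw I lamS r ν) := lintegral_mono hle
    _ = ∑' p : ℕ, ∑' q : ℕ, sysLaw I lamS r ν {ω : Sys E I | born ω p ≤ u ∧ born ω q ≤ u} := by
        rw [lintegral_tsum fun p => (Measurable.tsum fun q =>
          measurable_const.indicator (hm p q)).aemeasurable]
        refine tsum_congr fun p => ?_
        rw [lintegral_tsum fun q => (measurable_const.indicator (hm p q)).aemeasurable]
        refine tsum_congr fun q => ?_
        rw [lintegral_indicator (hm p q)]; simp
    _ ≤ ∑' p : ℕ, ∑' q : ℕ, ENNReal.ofReal (Real.exp u) * (b ^ p * b ^ q) :=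
        ENNReal.tsum_le_tsum fun p => ENNReal.tsum_le_tsum fun q => hpq p q
    _ < ∞ := by
        simp_rw [ENNReal.tsum_mul_left, ENNReal.tsum_mul_right, ENNReal.tsum_geometric]
        have : (1 - b)⁻¹ < ∞ := ENNReal.inv_lt_top.2 (tsub_pos_of_lt hb1)
        exact ENNReal.mul_lt_top ENNReal.ofReal_lt_top (ENNReal.mul_lt_top this this)

-- The lag is zero or at least one.
omit [Countable E] [MeasurableSingletonClass E] [IsProbabilityMeasure ν] in
theorem meanLag_le_sqLag (u : ℝ) : meanLag dec lamS r ν u ≤ sqLag dec lamS r ν u := by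
  classical
  refine lintegral_mono fun ω => ?_
  by_cases h : ∃ p, Stale dec ω p u
  · obtain ⟨p, hp⟩ := h
    have h1 : 1 ≤ lag dec ω u := by
      have := ENNReal.le_tsum (f := fun p => if Stale dec ω p u then (1 : ℝ≥0∞) else 0) p
      rw [lag]; simpa [hp] using this
    calc lag dec ω u = lag dec ω u * 1 := (mul_one _).symm
      _ ≤ lag dec ω u ^ 2 := by rw [pow_two]; gcongr
  · push Not at h
    have : lag dec ω u = 0 := by simp [lag, h]
    simp [this]

/-- A monotone function that contracts under a fixed time shift is bounded. -/
theorem exists_bound_of_contraction {g : ℝ → ℝ≥0∞} (hg : ∀ ⦃u v⦄, u ≤ v → g u ≤ g v)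
    {w : ℝ} (hw : 0 < w) {C ρ : ℝ≥0∞} (hC : C ≠ ∞) (hρ : ρ < 1) (h0 : g 0 ≤ C)
    (h : ∀ u, 0 ≤ u → g (u + w) ≤ C + g u * ρ) : ∃ D : ℝ≥0∞, D ≠ ∞ ∧ ∀ u, g u ≤ D := by
  refine ⟨C * ∑' n : ℕ, ρ ^ n, ?_, ?_⟩
  · rw [ENNReal.tsum_geometric]
    exact ENNReal.mul_ne_top hC (ENNReal.inv_ne_top.2 (tsub_pos_of_lt hρ).ne')
  · have hD : C + (C * ∑' n : ℕ, ρ ^ n) * ρ = C * ∑' n : ℕ, ρ ^ n := by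
      rw [mul_assoc, ← ENNReal.tsum_mul_right]
      conv_rhs => rw [tsum_eq_zero_add' ENNReal.summable]
      simp [mul_add, pow_succ]
    have hn : ∀ n : ℕ, g (n * w) ≤ C * ∑' n : ℕ, ρ ^ n := by
      intro n
      induction n with
      | zero => rw [← hD]; simpa using le_add_right h0
      | succ n ih =>
        rw [← hD]
        push_cast
        rw [add_mul, one_mul]
        exact (h _ (by positivity)).trans (by gcongr)
    intro u
    obtain ⟨n, hn'⟩ := exists_nat_ge (u / w)
    exact (hg ((div_le_iff₀ hw).1 hn')).trans (hn n)

/-- The probability that a fresh system decodes nothing up to time `t`. -/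
noncomputable def noDecProb (dec : E → Set I → Prop) (lamS r : ℝ) (ν : Measure E) (t : ℝ) :
    ℝ≥0∞ := sysLaw I lamS r ν {ω | NoDec dec ω t}

omit [Countable E] [MeasurableSingletonClass E] in
theorem exists_noDecProb_lt_one (hS : 0 < lamS) (hr : 0 < r) (hfull : ∀ᵐ e ∂ν, dec e univ) :
    ∃ w : ℝ, 0 < w ∧ noDecProb dec lamS r ν w < 1 := by
  have ht : Tendsto (fun t : ℝ => ENNReal.ofReal (Real.exp (-(lamS * (t / 2)))) +
      Fintype.card I * ENNReal.ofReal (Real.exp (-(r * (t / 2))))) atTop (𝓝 0) := by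
    have h : ∀ a : ℝ, 0 < a → Tendsto (fun t : ℝ => ENNReal.ofReal (Real.exp (-(a * (t / 2)))))
        atTop (𝓝 0) := by
      intro a ha
      rw [← ENNReal.ofReal_zero]
      refine ENNReal.tendsto_ofReal (Real.tendsto_exp_neg_atTop_nhds_zero.comp ?_)
      exact (tendsto_id.atTop_div_const (by norm_num)).const_mul_atTop ha
    have := (h lamS hS).add (ENNReal.Tendsto.const_mul (a := (Fintype.card I : ℝ≥0∞)) (h r hr)
      (Or.inr (by simp)))
    simpa using this
  obtain ⟨w, hw1, hw2⟩ := ((ht.eventually (gt_mem_nhds zero_lt_one)).and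
    (eventually_gt_atTop 0)).exists
  exact ⟨w, hw2, (measure_noDec_le hS hr hfull hw2.le).trans_lt hw1⟩

open Classical in
theorem lintegral_past_mul_noDec (hS : 0 < lamS) (hr : 0 < r) (e₀ : E) {u : ℝ} (hu : 0 ≤ u)
    (w : ℝ) {F : Sys E I → ℝ≥0∞} (hF : Measurable F) :
    ∫⁻ ω, F (past e₀ u ω) * (if NoDec dec (fut u ω) w then 1 else 0) ∂(sysLaw I lamS r ν) =
      (∫⁻ ω, F (past e₀ u ω) ∂(sysLaw I lamS r ν)) * noDecProb dec lamS r ν w := by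
  have := isProbabilityMeasure_sysLaw (I := I) hS hr ν
  rw [(splits_sysLaw hS hr ν e₀ hu).lintegral_mul (F := F)
    (G := fun ω => if NoDec dec ω w then 1 else 0) hF
      (Measurable.ite (measurableSet_noDec dec w) measurable_const measurable_const)]
  congr 1
  rw [noDecProb, ← lintegral_indicator_one (measurableSet_noDec dec w)]
  rfl

omit [MeasurableSpace E] [Fintype I] [Countable E] [MeasurableSingletonClass E] in
theorem GoodSys.lag_past {ω : Sys E I} (hω : GoodSys ω) (e₀ : E) {u : ℝ} (hu : 0 ≤ u) :
    lag dec (past e₀ u ω) u = lag dec ω u := by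
  classical
  unfold lag
  exact tsum_congr fun p => if_congr (hω.stale_past e₀ hu p) rfl rfl

/-- Over a window of length `w` the old lag survives only if the fresh system has decoded nothing,
an independent event of probability below one. This is the contraction of
`exists_bound_of_contraction`. -/
theorem exists_meanLag_bound (hS : 0 < lamS) (hr : 0 < r) (hfull : ∀ᵐ e ∂ν, dec e univ)
    (hdec : ∀ e A B, A ⊆ B → dec e A → dec e B) :
    ∃ D : ℝ≥0∞, D ≠ ∞ ∧ ∀ u, meanLag dec lamS r ν u ≤ D := by
  classical
  have := isProbabilityMeasure_sysLaw (I := I) hS hr ν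
  have e₀ : E := (nonempty_of_isProbabilityMeasure ν).some
  obtain ⟨w, hw, hρ⟩ := exists_noDecProb_lt_one (dec := dec) hS hr hfull
  refine exists_bound_of_contraction (fun u v h => meanLag_mono hS hr h) hw
    (C := meanLag dec lamS r ν w) ((meanLag_le_sqLag w).trans_lt (sqLag_lt_top hS hr w)).ne hρ
    (meanLag_mono hS hr hw.le) fun u hu => ?_
  calc meanLag dec lamS r ν (u + w) ≤ ∫⁻ ω, (lag dec (fut u ω) w + lag dec (past e₀ u ω) u *
        (if NoDec dec (fut u ω) w then 1 else 0)) ∂(sysLaw I lamS r ν) := by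
        refine lintegral_mono_ae ?_
        filter_upwards [ae_goodSys hS hr ν] with ω hω
        have := hω.lag_le_fut_add hdec e₀ hu (show u ≤ u + w by linarith)
        rwa [add_sub_cancel_left] at this
    _ = _ := by
        have m1 : Measurable fun ω : Sys E I => lag dec (fut u ω) w :=
          (measurable_lag dec w).comp (splits_sysLaw hS hr ν e₀ hu).2.1
        rw [lintegral_add_left m1, lintegral_lag_fut hS hr hu,
          lintegral_past_mul_noDec hS hr e₀ hu w (measurable_lag dec u)]
        congr 2
        refine lintegral_congr_ae ?_
        filter_upwards [ae_goodSys hS hr ν] with ω hω using hω.lag_past e₀ hu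

theorem lintegral_lag_mul_fut (hS : 0 < lamS) (hr : 0 < r) (e₀ : E) {u : ℝ} (hu : 0 ≤ u) (w : ℝ) :
    ∫⁻ ω, lag dec (past e₀ u ω) u * lag dec (fut u ω) w ∂(sysLaw I lamS r ν) =
      meanLag dec lamS r ν u * meanLag dec lamS r ν w := by
  have := isProbabilityMeasure_sysLaw (I := I) hS hr ν
  rw [(splits_sysLaw hS hr ν e₀ hu).lintegral_mul (measurable_lag dec u) (measurable_lag dec w)]
  congr 1
  refine lintegral_congr_ae ?_
  filter_upwards [ae_goodSys hS hr ν] with ω hω using hω.lag_past e₀ hu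

open Classical in
theorem lintegral_sq_lag_mul_noDec (hS : 0 < lamS) (hr : 0 < r) (e₀ : E) {u : ℝ} (hu : 0 ≤ u)
    (w : ℝ) : ∫⁻ ω, lag dec (past e₀ u ω) u ^ 2 * (if NoDec dec (fut u ω) w then 1 else 0)
      ∂(sysLaw I lamS r ν) = sqLag dec lamS r ν u * noDecProb dec lamS r ν w := by
  rw [lintegral_past_mul_noDec hS hr e₀ hu w (F := fun ω => lag dec ω u ^ 2) (by fun_prop)]
  congr 1
  refine lintegral_congr_ae ?_
  filter_upwards [ae_goodSys hS hr ν] with ω hω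
  rw [hω.lag_past e₀ hu]

/-- The same contraction for the square: the cross term is a product of means by independence, hence
bounded by `exists_meanLag_bound`, and the indicator equals its own square. -/
theorem exists_sqLag_bound (hS : 0 < lamS) (hr : 0 < r) (hfull : ∀ᵐ e ∂ν, dec e univ)
    (hdec : ∀ e A B, A ⊆ B → dec e A → dec e B) :
    ∃ D : ℝ≥0∞, D ≠ ∞ ∧ ∀ u, sqLag dec lamS r ν u ≤ D := by
  classical
  have := isProbabilityMeasure_sysLaw (I := I) hS hr ν
  have e₀ : E := (nonempty_of_isProbabilityMeasure ν).some
  obtain ⟨w, hw, hρ⟩ := exists_noDecProb_lt_one (dec := dec) hS hr hfull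
  obtain ⟨D, hD, hyD⟩ := exists_meanLag_bound (dec := dec) hS hr hfull hdec
  refine exists_bound_of_contraction (fun u v h => sqLag_mono hS hr h) hw
    (C := sqLag dec lamS r ν w + 2 * (D * D))
    (ENNReal.add_ne_top.2 ⟨(sqLag_lt_top hS hr w).ne, by finiteness⟩) hρ
    (le_add_right (sqLag_mono hS hr hw.le)) fun u hu => ?_
  have hfm := (splits_sysLaw (I := I) hS hr ν e₀ hu).2.1
  have hpm := (splits_sysLaw (I := I) hS hr ν e₀ hu).1
  calc sqLag dec lamS r ν (u + w) ≤ ∫⁻ ω, (lag dec (fut u ω) w ^ 2 +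
        (2 * (lag dec (past e₀ u ω) u * lag dec (fut u ω) w) + lag dec (past e₀ u ω) u ^ 2 *
        (if NoDec dec (fut u ω) w then 1 else 0))) ∂(sysLaw I lamS r ν) := by
        refine lintegral_mono_ae ?_
        filter_upwards [ae_goodSys hS hr ν] with ω hω
        have := hω.lag_le_fut_add hdec e₀ hu (show u ≤ u + w by linarith)
        rw [add_sub_cancel_left] at this
        refine (pow_le_pow_left₀ zero_le this 2).trans ?_
        split_ifs
        · rw [mul_one, mul_one, add_sq]
          refine le_of_eq ?_
          ring
        · simp
    _ = sqLag dec lamS r ν w + (2 * (meanLag dec lamS r ν u * meanLag dec lamS r ν w) +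
          sqLag dec lamS r ν u * noDecProb dec lamS r ν w) := by
        have m1 : Measurable fun ω : Sys E I => lag dec (fut u ω) w :=
          (measurable_lag dec w).comp hfm
        have m2 : Measurable fun ω : Sys E I => lag dec (past e₀ u ω) u :=
          (measurable_lag dec u).comp hpm
        rw [lintegral_add_left (by fun_prop), lintegral_add_left (by fun_prop),
          lintegral_const_mul _ (by fun_prop), lintegral_lag_mul_fut hS hr e₀ hu,
          lintegral_sq_lag_mul_noDec hS hr e₀ hu]
        congr 1
        exact (splits_sysLaw hS hr ν e₀ hu).measurePreserving.lintegral_comp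
          ((measurable_lag dec w).pow_const 2)
    _ ≤ _ := by
        rw [← add_assoc]
        gcongr
        · exact hyD u
        · exact hyD w

/-- The future lag is independent of the lag at `u`; correlation enters only on the event that the
future has decoded nothing for a time `v - u`. So covariances inherit the decay of
`measure_noDec_le`. -/
theorem lintegral_lag_mul_lag_le (hS : 0 < lamS) (hr : 0 < r)
    (hdec : ∀ e A B, A ⊆ B → dec e A → dec e B) {u v : ℝ} (hu : 0 ≤ u) (huv : u ≤ v) :
    ∫⁻ ω, lag dec ω u * lag dec ω v ∂(sysLaw I lamS r ν) ≤
      meanLag dec lamS r ν u * meanLag dec lamS r ν v +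
        sqLag dec lamS r ν u * noDecProb dec lamS r ν (v - u) := by
  classical
  have := isProbabilityMeasure_sysLaw (I := I) hS hr ν
  have e₀ : E := (nonempty_of_isProbabilityMeasure ν).some
  have hfm := (splits_sysLaw (I := I) hS hr ν e₀ hu).2.1
  have hpm := (splits_sysLaw (I := I) hS hr ν e₀ hu).1
  calc ∫⁻ ω, lag dec ω u * lag dec ω v ∂(sysLaw I lamS r ν)
      ≤ ∫⁻ ω, (lag dec (past e₀ u ω) u * lag dec (fut u ω) (v - u) +
          lag dec (past e₀ u ω) u ^ 2 * (if NoDec dec (fut u ω) (v - u) then 1 else 0))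
          ∂(sysLaw I lamS r ν) := by
        refine lintegral_mono_ae ?_
        filter_upwards [ae_goodSys hS hr ν] with ω hω
        rw [← hω.lag_past e₀ hu (dec := dec)]
        refine (mul_le_mul_right (hω.lag_le_fut_add hdec e₀ hu huv) _).trans ?_
        rw [mul_add, ← mul_assoc, pow_two]
    _ = meanLag dec lamS r ν u * meanLag dec lamS r ν (v - u) +
        sqLag dec lamS r ν u * noDecProb dec lamS r ν (v - u) := by
        have m1 : Measurable fun ω : Sys E I => lag dec (fut u ω) (v - u) :=
          (measurable_lag dec _).comp hfm
        have m2 : Measurable fun ω : Sys E I => lag dec (past e₀ u ω) u :=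
          (measurable_lag dec u).comp hpm
        rw [lintegral_add_left (by fun_prop), lintegral_lag_mul_fut hS hr e₀ hu,
          lintegral_sq_lag_mul_noDec hS hr e₀ hu]
    _ ≤ _ := by
        gcongr
        exact meanLag_mono hS hr (by linarith)

end Moments

/-! ### Averages of monotone functions. -/

section Cesaro

/-- Upper bound: the integrand never exceeds its supremum. Lower bound: beyond a point `s'` where
the function is close to the supremum it stays so, and the fraction `s' / t` lost before tends to
zero. -/
theorem tendsto_lintegral_div {y : ℝ → ℝ≥0∞} (hy : Monotone y) {D : ℝ≥0∞} (hD : D ≠ ∞)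
    (hyD : ∀ u, y u ≤ D) :
    Tendsto (fun t : ℝ => (∫⁻ u in Ioc 0 t, y u).toReal / t) atTop (𝓝 (⨆ u, y u).toReal) := by
  have hc : (⨆ u, y u) ≠ ∞ := ne_top_of_le_ne_top hD (iSup_le hyD)
  have hup : ∀ t : ℝ, 0 ≤ t → ∫⁻ u in Ioc 0 t, y u ≤ (⨆ u, y u) * ENNReal.ofReal t := by
    intro t ht
    calc ∫⁻ u in Ioc 0 t, y u ≤ ∫⁻ _ in Ioc 0 t, (⨆ u, y u) := lintegral_mono fun u => le_iSup y u
      _ = _ := by rw [setLIntegral_const, Real.volume_Ioc, sub_zero]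
  have hfin : ∀ t : ℝ, 0 ≤ t → ∫⁻ u in Ioc 0 t, y u ≠ ∞ := fun t ht =>
    ne_top_of_le_ne_top (ENNReal.mul_ne_top hc ENNReal.ofReal_ne_top) (hup t ht)
  refine tendsto_order.2 ⟨fun a ha => ?_, fun a ha => ?_⟩
  · have hmono : Monotone fun u => (y u).toReal := fun u v h =>
      ENNReal.toReal_mono (ne_top_of_le_ne_top hD (hyD v)) (hy h)
    obtain ⟨s, hs⟩ : ∃ s, a < (y s).toReal := by
      by_contra! hcon
      refine not_le.2 ha ?_
      rw [ENNReal.toReal_iSup fun u => ne_top_of_le_ne_top hD (hyD u)]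
      exact ciSup_le hcon
    set s' := max s 0
    have hs' : a < (y s').toReal := hs.trans_le (hmono (le_max_left _ _))
    have hlim : Tendsto (fun t : ℝ => (y s').toReal * (1 - s' / t)) atTop
        (𝓝 ((y s').toReal * (1 - 0))) :=
      ((tendsto_const_nhds.sub (tendsto_const_nhds.div_atTop tendsto_id))).const_mul _
    rw [sub_zero, mul_one] at hlim
    filter_upwards [hlim.eventually (lt_mem_nhds hs'), eventually_gt_atTop s',
      eventually_gt_atTop 0] with t ht1 ht2 ht3
    refine ht1.trans_le ?_
    rw [le_div_iff₀ ht3]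
    have : y s' * ENNReal.ofReal (t - s') ≤ ∫⁻ u in Ioc 0 t, y u := by
      calc y s' * ENNReal.ofReal (t - s') = ∫⁻ _ in Ioc s' t, y s' := by
            rw [setLIntegral_const, Real.volume_Ioc]
        _ ≤ ∫⁻ u in Ioc s' t, y u :=
            setLIntegral_mono' measurableSet_Ioc fun u hu => hy hu.1.le
        _ ≤ _ := lintegral_mono_set (Ioc_subset_Ioc_left (le_max_right _ _))
    have h2 := ENNReal.toReal_mono (hfin t ht3.le) this
    rw [ENNReal.toReal_mul, ENNReal.toReal_ofReal (by linarith)] at h2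
    refine le_trans (le_of_eq ?_) h2
    field_simp
  · filter_upwards [eventually_gt_atTop 0] with t ht
    refine lt_of_le_of_lt ?_ ha
    rw [div_le_iff₀ ht]
    have h2 := ENNReal.toReal_mono (ENNReal.mul_ne_top hc ENNReal.ofReal_ne_top) (hup t ht.le)
    rwa [ENNReal.toReal_mul, ENNReal.toReal_ofReal ht.le] at h2

/-- A nondecreasing function whose averages converge along the squares has converging averages. -/
theorem tendsto_div_of_tendsto_sq {X : ℝ → ℝ} (hX : Monotone X) (h0 : ∀ t, 0 ≤ X t) {c : ℝ}
    (h : Tendsto (fun p : ℕ => X (((p : ℝ) + 1) ^ 2) / ((p : ℝ) + 1) ^ 2) atTop (𝓝 c)) :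
    Tendsto (fun t : ℝ => X t / t) atTop (𝓝 c) := by
  have hfl : Tendsto (fun t : ℝ => ⌊Real.sqrt t⌋₊) atTop atTop :=
    tendsto_nat_floor_atTop.comp Real.tendsto_sqrt_atTop
  -- Consecutive squares have ratio tending to one, so replacing `t` by either of its neighbouring
  -- squares costs a factor tending to one.
  have hr : Tendsto (fun p : ℕ => ((p : ℝ) + 1) / p) atTop (𝓝 1) := by
    have : Tendsto (fun p : ℕ => 1 + 1 / (p : ℝ)) atTop (𝓝 (1 + 0)) :=
      tendsto_const_nhds.add (tendsto_const_div_atTop_nhds_zero_nat 1)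
    rw [add_zero] at this
    refine this.congr' ?_
    filter_upwards [eventually_gt_atTop 0] with p hp
    field_simp
  have hup : Tendsto (fun p : ℕ => X (((p : ℝ) + 1) ^ 2) / ((p : ℝ) + 1) ^ 2 *
      (((p : ℝ) + 1) / p) ^ 2) atTop (𝓝 c) := by
    simpa using h.mul (hr.pow 2)
  have hlo : Tendsto (fun p : ℕ => X ((p : ℝ) ^ 2) / (p : ℝ) ^ 2 *
      ((((p : ℝ) + 1) / p) ^ 2)⁻¹) atTop (𝓝 c) := by
    have h1 : Tendsto (fun p : ℕ => X ((p : ℝ) ^ 2) / (p : ℝ) ^ 2) atTop (𝓝 c) := by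
      rw [← tendsto_add_atTop_iff_nat 1]
      exact_mod_cast h
    simpa using h1.mul ((hr.pow 2).inv₀ (by norm_num))
  refine tendsto_of_tendsto_of_tendsto_of_le_of_le' (hlo.comp hfl) (hup.comp hfl) ?_ ?_
  · filter_upwards [eventually_ge_atTop 1] with t ht
    have hp : 1 ≤ ⌊Real.sqrt t⌋₊ := Nat.le_floor (by simpa using Real.one_le_sqrt.2 ht)
    have hp' : (0 : ℝ) < ⌊Real.sqrt t⌋₊ := by exact_mod_cast hp
    have h1 : ((⌊Real.sqrt t⌋₊ : ℝ)) ^ 2 ≤ t := by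
      rw [← Real.le_sqrt hp'.le (by linarith)]
      exact Nat.floor_le (Real.sqrt_nonneg t)
    have h2 : t ≤ ((⌊Real.sqrt t⌋₊ : ℝ) + 1) ^ 2 := by
      rw [← Real.sqrt_le_left (by positivity)]
      exact (Nat.lt_floor_add_one _).le
    have e : X ((⌊Real.sqrt t⌋₊ : ℝ) ^ 2) / (⌊Real.sqrt t⌋₊ : ℝ) ^ 2 *
      ((((⌊Real.sqrt t⌋₊ : ℝ) + 1) / ⌊Real.sqrt t⌋₊) ^ 2)⁻¹ =
        X ((⌊Real.sqrt t⌋₊ : ℝ) ^ 2) / ((⌊Real.sqrt t⌋₊ : ℝ) + 1) ^ 2 := by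
      field_simp
    simp only [Function.comp]
    rw [e]
    exact div_le_div₀ (h0 _) (hX h1) (by linarith) h2
  · filter_upwards [eventually_ge_atTop 1] with t ht
    have hp : 1 ≤ ⌊Real.sqrt t⌋₊ := Nat.le_floor (by simpa using Real.one_le_sqrt.2 ht)
    have hp' : (0 : ℝ) < ⌊Real.sqrt t⌋₊ := by exact_mod_cast hp
    have h1 : ((⌊Real.sqrt t⌋₊ : ℝ)) ^ 2 ≤ t := by
      rw [← Real.le_sqrt hp'.le (by linarith)]
      exact Nat.floor_le (Real.sqrt_nonneg t)
    have h2 : t ≤ ((⌊Real.sqrt t⌋₊ : ℝ) + 1) ^ 2 := by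
      rw [← Real.sqrt_le_left (by positivity)]
      exact (Nat.lt_floor_add_one _).le
    have e : X (((⌊Real.sqrt t⌋₊ : ℝ) + 1) ^ 2) / ((⌊Real.sqrt t⌋₊ : ℝ) + 1) ^ 2 *
      (((⌊Real.sqrt t⌋₊ : ℝ) + 1) / ⌊Real.sqrt t⌋₊) ^ 2 =
        X (((⌊Real.sqrt t⌋₊ : ℝ) + 1) ^ 2) / (⌊Real.sqrt t⌋₊ : ℝ) ^ 2 := by
      field_simp
    simp only [Function.comp]
    rw [e]
    exact div_le_div₀ (h0 _) (hX h2) (by positivity) h1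

end Cesaro

/-! ### A law of large numbers for time integrals. -/

section LLN

variable {Ω : Type*} [MeasurableSpace Ω] {P : Measure Ω} [IsProbabilityMeasure P]
  {f : Ω → ℝ → ℝ≥0∞} {y g : ℝ → ℝ≥0∞}

theorem lintegral_timeIntegral (hf : Measurable fun q : Ω × ℝ => f q.1 q.2)
    (hy : ∀ u, ∫⁻ ω, f ω u ∂P = y u) (t : ℝ) :
    ∫⁻ ω, (∫⁻ u in Ioc 0 t, f ω u) ∂P = ∫⁻ u in Ioc 0 t, y u := by
  rw [lintegral_lintegral_swap hf.aemeasurable]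
  simp_rw [hy]

/-- Since the covariance bound depends on `u - v` and is integrable over the line in the
application, the excess over the squared mean grows at most linearly in `t`. -/
theorem lintegral_timeIntegral_sq_le (hf : Measurable fun q : Ω × ℝ => f q.1 q.2)
    (hym : Measurable y)
    (hcov : ∀ u v, 0 ≤ u → 0 ≤ v → ∫⁻ ω, f ω u * f ω v ∂P ≤ y u * y v + g (u - v)) {t : ℝ} :
    ∫⁻ ω, (∫⁻ u in Ioc 0 t, f ω u) ^ 2 ∂P ≤
      (∫⁻ u in Ioc 0 t, y u) ^ 2 + ENNReal.ofReal t * ∫⁻ u, g u := by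
  have hfu : ∀ ω, Measurable (f ω) := fun ω => hf.comp (measurable_const.prodMk measurable_id)
  have h1 : ∀ ω, (∫⁻ u in Ioc 0 t, f ω u) ^ 2 = ∫⁻ u in Ioc 0 t, ∫⁻ v in Ioc 0 t, f ω u * f ω v := by
    intro ω
    rw [pow_two, ← lintegral_mul_const _ (hfu ω)]
    refine lintegral_congr fun u => ?_
    rw [lintegral_const_mul _ (hfu ω)]
  have m3 : Measurable fun q : (Ω × ℝ) × ℝ => f q.1.1 q.1.2 * f q.1.1 q.2 :=
    (hf.comp measurable_fst).mul (hf.comp ((measurable_fst.comp measurable_fst).prodMk measurable_snd))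
  simp_rw [h1]
  rw [lintegral_lintegral_swap (by exact m3.lintegral_prod_right'.aemeasurable)]
  have h2 : ∀ u, ∫⁻ ω, (∫⁻ v in Ioc 0 t, f ω u * f ω v) ∂P =
      ∫⁻ v in Ioc 0 t, ∫⁻ ω, f ω u * f ω v ∂P := fun u =>
    lintegral_lintegral_swap (Measurable.aemeasurable (by
      exact m3.comp (by fun_prop : Measurable fun q : Ω × ℝ => ((q.1, u), q.2))))
  simp_rw [h2]
  calc ∫⁻ u in Ioc 0 t, ∫⁻ v in Ioc 0 t, ∫⁻ ω, f ω u * f ω v ∂P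
      ≤ ∫⁻ u in Ioc 0 t, (y u * (∫⁻ v in Ioc 0 t, y v) + ∫⁻ v, g v) := by
        refine setLIntegral_mono' measurableSet_Ioc fun u hu => ?_
        calc ∫⁻ v in Ioc 0 t, ∫⁻ ω, f ω u * f ω v ∂P
            ≤ ∫⁻ v in Ioc 0 t, (y u * y v + g (u - v)) :=
              setLIntegral_mono' measurableSet_Ioc fun v hv => hcov u v hu.1.le hv.1.le
          _ = y u * (∫⁻ v in Ioc 0 t, y v) + ∫⁻ v in Ioc 0 t, g (u - v) := by
              rw [lintegral_add_left (by fun_prop), lintegral_const_mul _ hym]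
          _ ≤ _ := by
              refine add_le_add_right ?_ _
              exact (setLIntegral_le_lintegral _ _).trans
                (lintegral_sub_left_eq_self (μ := volume) g u).le
    _ = _ := by
        rw [lintegral_add_left (by fun_prop), lintegral_mul_const _ hym, setLIntegral_const,
          Real.volume_Ioc, sub_zero, pow_two, mul_comm (∫⁻ v, g v)]

/-- Law of large numbers in continuous time under decaying covariances. -/
theorem ae_tendsto_timeAverage (hf : Measurable fun q : Ω × ℝ => f q.1 q.2)
    (hy : ∀ u, ∫⁻ ω, f ω u ∂P = y u) (hmono : Monotone y) {D : ℝ≥0∞} (hD : D ≠ ∞)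
    (hyD : ∀ u, y u ≤ D) (hgi : ∫⁻ u, g u ≠ ∞)
    (hcov : ∀ u v, 0 ≤ u → 0 ≤ v → ∫⁻ ω, f ω u * f ω v ∂P ≤ y u * y v + g (u - v)) :
    ∀ᵐ ω ∂P, (∀ t : ℝ, ∫⁻ u in Ioc 0 t, f ω u ≠ ∞) ∧
      Tendsto (fun t : ℝ => (∫⁻ u in Ioc 0 t, f ω u).toReal / t) atTop (𝓝 (⨆ u, y u).toReal) := by
  have hmJ : ∀ t : ℝ, Measurable fun ω => ∫⁻ u in Ioc 0 t, f ω u := fun t =>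
    hf.lintegral_prod_right'
  have hEJ := lintegral_timeIntegral hf hy
  have hmfin : ∀ t : ℝ, ∫⁻ u in Ioc 0 t, y u ≠ ∞ := fun t => by
    refine ne_top_of_le_ne_top ?_ (lintegral_mono hyD)
    rw [setLIntegral_const]
    exact ENNReal.mul_ne_top hD (by simp)
  have hfin : ∀ᵐ ω ∂P, ∀ t : ℝ, ∫⁻ u in Ioc 0 t, f ω u ≠ ∞ := by
    have : ∀ᵐ ω ∂P, ∀ n : ℕ, ∫⁻ u in Ioc 0 (n : ℝ), f ω u < ∞ := ae_all_iff.2 fun n =>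
      ae_lt_top (hmJ n) (by rw [hEJ]; exact hmfin _)
    filter_upwards [this] with ω hω t
    obtain ⟨n, hn⟩ := exists_nat_ge t
    exact ((lintegral_mono_set (Ioc_subset_Ioc_right hn)).trans_lt (hω n)).ne
  set X : ℝ → Ω → ℝ := fun t ω => (∫⁻ u in Ioc 0 t, f ω u).toReal with hX
  set M : ℝ → ℝ := fun t => (∫⁻ u in Ioc 0 t, y u).toReal with hM
  have hXm : ∀ t, Measurable (X t) := fun t => (hmJ t).ennreal_toReal
  have hsq := fun t : ℝ => lintegral_timeIntegral_sq_le (t := t) hf hmono.measurable hcov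
  have hvar : ∀ t : ℝ, 0 ≤ t → ∫⁻ ω, ENNReal.ofReal ((X t ω - M t) ^ 2) ∂P ≤
      ENNReal.ofReal t * ∫⁻ u, g u := by
    intro t ht
    have hRfin : ENNReal.ofReal t * ∫⁻ u, g u ≠ ∞ := ENNReal.mul_ne_top ENNReal.ofReal_ne_top hgi
    have hsqfin : ∫⁻ ω, (∫⁻ u in Ioc 0 t, f ω u) ^ 2 ∂P ≠ ∞ :=
      ne_top_of_le_ne_top (ENNReal.add_ne_top.2 ⟨ENNReal.pow_ne_top (hmfin t), hRfin⟩) (hsq t)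
    have hX2 : (fun ω => X t ω ^ 2) = fun ω => ((∫⁻ u in Ioc 0 t, f ω u) ^ 2).toReal := by
      ext ω; simp [hX]
    have hint2 : Integrable (fun ω => X t ω ^ 2) P := by
      rw [hX2]
      exact integrable_toReal_of_lintegral_ne_top ((hmJ t).pow_const 2).aemeasurable hsqfin
    have hL2 : MemLp (X t) 2 P := (memLp_two_iff_integrable_sq (hXm t).aestronglyMeasurable).2 hint2
    have hmean : ∫ ω, X t ω ∂P = M t := by
      rw [hX, integral_toReal (hmJ t).aemeasurable (ae_lt_top (hmJ t) (by rw [hEJ]; exact hmfin t)),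
        hEJ]
    have hE2 : ∫ ω, X t ω ^ 2 ∂P ≤ M t ^ 2 + (ENNReal.ofReal t * ∫⁻ u, g u).toReal := by
      rw [hX2, integral_toReal ((hmJ t).pow_const 2).aemeasurable
        (ae_lt_top ((hmJ t).pow_const 2) hsqfin), hM, ← ENNReal.toReal_pow,
        ← ENNReal.toReal_add (ENNReal.pow_ne_top (hmfin t)) hRfin]
      exact ENNReal.toReal_mono (ENNReal.add_ne_top.2 ⟨ENNReal.pow_ne_top (hmfin t), hRfin⟩) (hsq t)
    have hI : Integrable (X t) P := hL2.integrable (by norm_num)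
    have hint3 : Integrable (fun ω => (X t ω - M t) ^ 2) P := by
      have : (fun ω => (X t ω - M t) ^ 2) = fun ω => X t ω ^ 2 - 2 * M t * X t ω + M t ^ 2 := by
        ext ω; ring
      rw [this]
      exact (hint2.sub (hI.const_mul _)).add (integrable_const _)
    rw [← ofReal_integral_eq_lintegral_ofReal hint3 (ae_of_all _ fun ω => sq_nonneg _),
      ← ENNReal.ofReal_toReal hRfin]
    refine ENNReal.ofReal_le_ofReal ?_
    have e : ∫ ω, (X t ω - M t) ^ 2 ∂P = ∫ ω, X t ω ^ 2 ∂P - M t ^ 2 := by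
      have : (fun ω => (X t ω - M t) ^ 2) = fun ω => X t ω ^ 2 - 2 * M t * X t ω + M t ^ 2 := by
        ext ω; ring
      have i1 : Integrable (fun ω => 2 * M t * X t ω) P := hI.const_mul _
      have i2 : Integrable (fun ω => X t ω ^ 2 - 2 * M t * X t ω) P := hint2.sub i1
      rw [this, integral_add i2 (integrable_const _), integral_sub hint2 i1, integral_const_mul,
        hmean]
      simp
      ring
    rw [e]
    linarith
  -- Variances are `O (T p)`, so the squared relative deviations have expectations `O (1 / T p)`.
  -- Along squares these are summable, and the deviations tend to zero almost surely without any
  -- maximal inequality.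
  set T : ℕ → ℝ := fun p => ((p : ℝ) + 1) ^ 2 with hT
  have hTpos : ∀ p, 0 < T p := fun p => by positivity
  have hsum : ∫⁻ ω, ∑' p, ENNReal.ofReal (((X (T p) ω - M (T p)) / T p) ^ 2) ∂P ≠ ∞ := by
    rw [lintegral_tsum fun p => by
      exact (((((hXm (T p)).sub_const _).div_const _).pow_const 2).ennreal_ofReal).aemeasurable]
    have hle : ∀ p, ∫⁻ ω, ENNReal.ofReal (((X (T p) ω - M (T p)) / T p) ^ 2) ∂P ≤
        ENNReal.ofReal (1 / T p) * ∫⁻ u, g u := by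
      intro p
      have e : ∀ ω, ENNReal.ofReal (((X (T p) ω - M (T p)) / T p) ^ 2) =
          ENNReal.ofReal (1 / T p ^ 2) * ENNReal.ofReal ((X (T p) ω - M (T p)) ^ 2) := by
        intro ω
        rw [← ENNReal.ofReal_mul (by positivity), div_pow]
        congr 1; ring
      simp_rw [e]
      rw [lintegral_const_mul _ (by
        exact (((hXm (T p)).sub_const _).pow_const 2).ennreal_ofReal)]
      calc _ ≤ ENNReal.ofReal (1 / T p ^ 2) * (ENNReal.ofReal (T p) * ∫⁻ u, g u) := by
            gcongr; exact hvar _ (hTpos p).le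
        _ = _ := by
            rw [← mul_assoc, ← ENNReal.ofReal_mul (by positivity)]
            congr 2
            have := (hTpos p).ne'
            field_simp
    refine ne_top_of_le_ne_top ?_ (ENNReal.tsum_le_tsum hle)
    rw [ENNReal.tsum_mul_right]
    refine ENNReal.mul_ne_top ?_ hgi
    have hs : Summable fun p : ℕ => 1 / T p := by
      have := (summable_nat_add_iff 1).2 (Real.summable_one_div_nat_pow.2 (le_refl 2))
      simpa [hT] using this
    rw [← ENNReal.ofReal_tsum_of_nonneg (fun p => by have := hTpos p; positivity) hs]
    exact ENNReal.ofReal_ne_top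
  have hae := ae_lt_top (Measurable.tsum fun p => by
      exact ((((hXm (T p)).sub_const _).div_const _).pow_const 2).ennreal_ofReal) hsum
  filter_upwards [hfin, hae] with ω hω1 hω2
  refine ⟨hω1, ?_⟩
  have hXmono : Monotone fun t => X t ω := fun s t hst =>
    ENNReal.toReal_mono (hω1 t) (lintegral_mono_set (Ioc_subset_Ioc_right hst))
  refine tendsto_div_of_tendsto_sq hXmono (fun t => ENNReal.toReal_nonneg) ?_
  have h0 := ENNReal.tendsto_atTop_zero_of_tsum_ne_top hω2.ne
  have h1 : Tendsto (fun p => ((X (T p) ω - M (T p)) / T p) ^ 2) atTop (𝓝 0) := by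
    have := (ENNReal.tendsto_toReal ENNReal.zero_ne_top).comp h0
    refine this.congr fun p => ?_
    exact ENNReal.toReal_ofReal (sq_nonneg _)
  have h2 : Tendsto (fun p => (X (T p) ω - M (T p)) / T p) atTop (𝓝 0) := by
    have := (Real.continuous_sqrt.tendsto 0).comp h1
    rw [Real.sqrt_zero] at this
    refine tendsto_zero_iff_abs_tendsto_zero _ |>.2 (this.congr fun p => ?_)
    simp [Real.sqrt_sq_eq_abs]
  have hTt : Tendsto T atTop atTop :=
    (tendsto_pow_atTop (by norm_num)).comp
      (tendsto_atTop_add_const_right _ _ tendsto_natCast_atTop_atTop)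
  have h3 := (tendsto_lintegral_div hmono hD hyD).comp hTt
  have h4 := h2.add h3
  rw [zero_add] at h4
  refine h4.congr fun p => ?_
  simp only [Function.comp, hX, hM, hT]
  ring

end LLN

theorem lintegral_exp_neg_abs_ne_top {c : ℝ} (hc : 0 < c) :
    ∫⁻ w : ℝ, ENNReal.ofReal (Real.exp (-(c * (|w| / 2)))) ≠ ∞ := by
  have h1 : IntegrableOn (fun w : ℝ => Real.exp (-(c * (|w| / 2)))) (Ioi 0) := by
    refine (exp_neg_integrableOn_Ioi 0 (half_pos hc)).congr_fun (fun w hw => ?_) measurableSet_Ioi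
    simp only
    rw [abs_of_pos hw]
    congr 1; ring
  have h2 : Integrable fun w : ℝ => Real.exp (-(c * (|w| / 2))) := by
    rw [← integrableOn_univ, ← Iic_union_Ioi (a := (0 : ℝ))]
    refine IntegrableOn.union ?_ h1
    rw [integrableOn_Iic_iff_integrableOn_Iio]
    have := (MeasurePreserving.integrableOn_comp_preimage
      (Measure.measurePreserving_neg (volume : Measure ℝ))
      (Homeomorph.neg ℝ).measurableEmbedding).2 h1
    simpa [Function.comp_def] using this
  have := h2.lintegral_lt_top
  exact this.ne

/-! ### Almost sure time average of the lag. -/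

section LagAverage

variable {E : Type*} [MeasurableSpace E] {I : Type*} [Fintype I]
  [Countable E] [MeasurableSingletonClass E] {dec : E → Set I → Prop}
  {lamS r : ℝ} {ν : Measure E} [IsProbabilityMeasure ν]

/-- The covariance dominator `g` is the bound of `measure_noDec_le` at `|u - v|` times a uniform
bound `Z` for the mean square lag. -/
theorem ae_tendsto_lag (hS : 0 < lamS) (hr : 0 < r) (hfull : ∀ᵐ e ∂ν, dec e univ)
    (hdec : ∀ e A B, A ⊆ B → dec e A → dec e B) :
    ∀ᵐ ω ∂(sysLaw I lamS r ν), (∀ t : ℝ, ∫⁻ u in Ioc 0 t, lag dec ω u ≠ ∞) ∧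
      Tendsto (fun t : ℝ => (∫⁻ u in Ioc 0 t, lag dec ω u).toReal / t) atTop
        (𝓝 (⨆ u, meanLag dec lamS r ν u).toReal) := by
  have := isProbabilityMeasure_sysLaw (I := I) hS hr ν
  obtain ⟨D, hD, hyD⟩ := exists_meanLag_bound (dec := dec) hS hr hfull hdec
  obtain ⟨Z, hZ, hzZ⟩ := exists_sqLag_bound (dec := dec) hS hr hfull hdec
  refine ae_tendsto_timeAverage (g := fun w => Z * (ENNReal.ofReal (Real.exp (-(lamS * (|w| / 2)))) +
      Fintype.card I * ENNReal.ofReal (Real.exp (-(r * (|w| / 2))))))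
    (measurable_lag_uncurry dec) (fun u => rfl) (fun u v h => meanLag_mono hS hr h) hD hyD ?_ ?_
  · rw [lintegral_const_mul _ (by fun_prop), lintegral_add_left (by fun_prop),
      lintegral_const_mul _ (by fun_prop)]
    have h1 := lintegral_exp_neg_abs_ne_top hS
    have h2 := lintegral_exp_neg_abs_ne_top hr
    exact ENNReal.mul_ne_top hZ (ENNReal.add_ne_top.2 ⟨h1, ENNReal.mul_ne_top (by simp) h2⟩)
  · have key : ∀ u v, 0 ≤ u → u ≤ v → ∫⁻ ω, lag dec ω u * lag dec ω v ∂(sysLaw I lamS r ν) ≤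
        meanLag dec lamS r ν u * meanLag dec lamS r ν v +
          Z * (ENNReal.ofReal (Real.exp (-(lamS * (|u - v| / 2)))) +
            Fintype.card I * ENNReal.ofReal (Real.exp (-(r * (|u - v| / 2))))) := by
      intro u v hu huv
      refine (lintegral_lag_mul_lag_le hS hr hdec hu huv).trans ?_
      rw [abs_sub_comm, abs_of_nonneg (sub_nonneg.2 huv)]
      gcongr
      · exact hzZ u
      · exact measure_noDec_le hS hr hfull (sub_nonneg.2 huv)
    intro u v hu hv
    rcases le_total u v with h | h
    · exact key u v hu h
    · have := key v u hv h
      rw [abs_sub_comm, mul_comm (meanLag dec lamS r ν v)] at this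
      refine le_trans (le_of_eq ?_) this
      exact lintegral_congr fun ω => mul_comm _ _

end LagAverage

/-! ### From the gossip network to the one-node system. -/

section Bridge

variable {m : ℕ}

/-- The part of the network that is relevant for node `j`. -/
def toSys (j : Fin m) (ω : Sample m) : Sys (Finset (Fin m)) {i : Fin m // i ≠ j} :=
  -- Index `p` of the system stands for version `p + 1`, hence the shift of the marks; the set drawn
  -- for version `0` plays no role.
  ((ω.1, fun p => ω.2.2 (p + 1)), fun i => ω.2.1 ⟨(i.1, j), i.2⟩)

/-- The key-holders of a version whose keys node `j` has. -/
def held (S : Finset (Fin m)) (j : Fin m) (e : Finset (Fin m)) (A : Set {i : Fin m // i ≠ j}) :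
    Set (Fin m) := {i | i ∈ S ∪ e ∧ (i = j ∨ ∃ h : i ≠ j, (⟨i, h⟩ : {i // i ≠ j}) ∈ A)}

/-- Decodability of a version with key-holders `S ∪ e`. -/
def decodes (k : ℕ) (S : Finset (Fin m)) (j : Fin m) (e : Finset (Fin m))
    (A : Set {i : Fin m // i ≠ j}) : Prop := k + 1 ≤ (held S j e A).ncard

theorem decodes_mono (k : ℕ) (S : Finset (Fin m)) (j : Fin m) (e : Finset (Fin m))
    (A B : Set {i : Fin m // i ≠ j}) (hAB : A ⊆ B) (h : decodes k S j e A) : decodes k S j e B :=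
  h.trans (ncard_le_ncard (fun _ hi => ⟨hi.1, hi.2.imp_right fun ⟨a, b⟩ => ⟨a, hAB b⟩⟩)
    (toFinite _))

/-- The message carrying the key is the one sent at the first activation at or after `v`. If any
activation falls in `[v, w]`, so does this first one. -/
theorem Good.exists_first {x : ℕ → ℝ} (hx : Good x) {v w : ℝ} (hv : 0 < v) :
    (∃ r, psum x (r + 1) ≤ w ∧ psum x r < v ∧ v ≤ psum x (r + 1)) ↔ Arr x v w := by
  constructor
  · rintro ⟨r, h1, -, h3⟩
    exact ⟨r, h3, h1⟩
  · rintro ⟨r, h1, h2⟩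
    classical
    have hex : ∃ r, v ≤ psum x (r + 1) := ⟨r, h1⟩
    refine ⟨Nat.find hex, ?_, ?_, Nat.find_spec hex⟩
    · exact (hx.strictMono.monotone (Nat.succ_le_succ (Nat.find_min' hex h1))).trans h2
    · rcases h : Nat.find hex with _ | n
      · simpa [psum_zero]
      · exact not_le.1 (Nat.find_min hex (show n < Nat.find hex by omega))

/-- By `Good.exists_first` the existence of a suitable message is the event `Arr`. The key of node
`j` itself is available from the creation of the version, and before that time no key exists. -/
theorem le_ncard_keys_iff {k : ℕ} {S : Finset (Fin m)} {j : Fin m} {ω : Sample m}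
    (hω : GoodSys (toSys j ω)) (p : ℕ) (t : ℝ) :
    k + 1 ≤ (keys S ω j t (p + 1)).ncard ↔
      born (toSys j ω) p ≤ t ∧ ¬ Undec (decodes k S j) (toSys j ω) p t := by
  have hpos : 0 < psum ω.1 (p + 1) := by
    have := hω.1.strictMono (Nat.succ_pos p)
    rwa [psum_zero] at this
  have hkeys : ∀ i, i ∈ keys S ω j t (p + 1) ↔ (i ∈ keyed S ω (p + 1) ∧
      ((i = j ∧ psum ω.1 (p + 1) ≤ t) ∨ ∃ h : i ≠ j, (⟨i, h⟩ : {i // i ≠ j}) ∈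
        heard (toSys j ω) p t)) := by
    intro i
    have hex : ∀ h : i ≠ j, (∃ r : ℕ, activationTime ω ⟨(i, j), h⟩ (r + 1) ≤ t ∧
        p + 1 ∈ message S ω ⟨(i, j), h⟩ r) ↔
          (i ∈ keyed S ω (p + 1) ∧ (⟨i, h⟩ : {i // i ≠ j}) ∈ heard (toSys j ω) p t) := by
      intro h
      have h1 := (hω.2 ⟨i, h⟩).exists_first (w := t) hpos
      change _ ↔ _ ∧ Arr _ _ _
      change _ ↔ _ ∧ Arr (ω.2.1 ⟨(i, j), h⟩) (psum ω.1 (p + 1)) t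
      rw [← show _ ↔ Arr (ω.2.1 ⟨(i, j), h⟩) (psum ω.1 (p + 1)) t from h1]
      constructor
      · rintro ⟨r, a, b, c, d⟩
        exact ⟨b, r, a, c, d⟩
      · rintro ⟨b, r, a, c, d⟩
        exact ⟨r, a, b, c, d⟩
    constructor
    · rintro (⟨rfl, h1, h2⟩ | ⟨h, hr⟩)
      · exact ⟨h1, Or.inl ⟨rfl, h2⟩⟩
      · obtain ⟨h1, h2⟩ := (hex h).1 hr
        exact ⟨h1, Or.inr ⟨h, h2⟩⟩
    · rintro ⟨h1, ⟨rfl, h2⟩ | ⟨h, h2⟩⟩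
      · exact Or.inl ⟨rfl, h1, h2⟩
      · exact Or.inr ⟨h, (hex h).2 ⟨h1, h2⟩⟩
  by_cases hb : psum ω.1 (p + 1) ≤ t
  · have : keys S ω j t (p + 1) = held S j (ω.2.2 (p + 1)) (heard (toSys j ω) p t) := by
      ext i
      rw [hkeys i]
      simp only [hb, and_true]
      rfl
    rw [this, Undec, not_not]
    exact ⟨fun h => ⟨hb, h⟩, fun h => h.2⟩
  · have : keys S ω j t (p + 1) = ∅ := by
      refine eq_empty_of_forall_notMem fun i hi => ?_
      rcases ((hkeys i).1 hi).2 with h | ⟨h, r, h1, h2⟩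
      · exact hb h.2
      · exact hb (le_trans h1 h2)
    rw [this]
    constructor
    · intro h; simp at h
    · intro h; exact absurd h.1 hb

/-- If the source is at version `N` and the node at version `L`, the stale indices are exactly those
in `[L, N)`, because index `p` stands for version `p + 1`. -/
theorem age_eq_lag {k : ℕ} {S : Finset (Fin m)} {j : Fin m} {ω : Sample m}
    (hω : GoodSys (toSys j ω)) {t : ℝ} (ht : 0 ≤ t) :
    age k S ω j t = (lag (decodes k S j) (toSys j ω) t).toReal := by
  classical
  set N := cnt t ω.1 with hN
  have hle : ∀ n, psum ω.1 n ≤ t ↔ n ≤ N := fun n => Good.le_iff hω.1 ht n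
  have hsrc : sourceVersion ω t = N := by
    have : {ℓ : ℕ | 1 ≤ ℓ ∧ updateTime ω ℓ ≤ t} = Finset.Icc 1 N := by
      ext ℓ
      simp only [mem_ofPred_eq, Finset.coe_Icc, mem_Icc]
      exact and_congr_right fun _ => hle ℓ
    rw [sourceVersion, this, ncard_coe_finset]
    simp
  set V : Set ℕ := {ℓ : ℕ | ℓ = 0 ∨ k + 1 ≤ (keys S ω j t ℓ).ncard} with hV
  have hV1 : ∀ p, p + 1 ∈ V ↔ p + 1 ≤ N ∧ ¬ Undec (decodes k S j) (toSys j ω) p t := by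
    intro p
    rw [hV, mem_ofPred_eq, le_ncard_keys_iff hω]
    simp only [Nat.succ_ne_zero, false_or]
    exact and_congr_left fun _ => hle (p + 1)
  have hVle : ∀ ℓ ∈ V, ℓ ≤ N := by
    intro ℓ hℓ
    cases ℓ with
    | zero => exact Nat.zero_le _
    | succ p => exact ((hV1 p).1 hℓ).1
  have hVb : BddAbove V := ⟨N, fun ℓ hℓ => hVle ℓ hℓ⟩
  have hVn : V.Nonempty := ⟨0, Or.inl rfl⟩
  set L := nodeVersion k S ω j t with hL
  have hLV : L ∈ V := Nat.sSup_mem hVn hVb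
  have hLN : L ≤ N := hVle _ hLV
  have hst : ∀ p, Stale (decodes k S j) (toSys j ω) p t ↔ p ∈ Finset.Ico L N := by
    intro p
    rw [Finset.mem_Ico]
    constructor
    · rintro ⟨h1, h2⟩
      have hp : p + 1 ≤ N := (hle (p + 1)).1 h1
      refine ⟨?_, hp⟩
      by_contra hlt
      obtain ⟨q, hq⟩ := Nat.exists_eq_succ_of_ne_zero (show L ≠ 0 by omega)
      rw [hq] at hLV
      obtain ⟨h3, h4⟩ := (hV1 q).1 hLV
      exact h4 (h2 q (by omega) ((hle (q + 1)).2 h3))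
    · rintro ⟨h1, h2⟩
      refine ⟨(hle (p + 1)).2 h2, fun q hq hb => ?_⟩
      by_contra hU
      have : q + 1 ∈ V := (hV1 q).2 ⟨(hle (q + 1)).1 hb, hU⟩
      have : q + 1 ≤ L := le_csSup hVb this
      omega
  have hlag : lag (decodes k S j) (toSys j ω) t = ((N - L : ℕ) : ℝ≥0∞) := by
    unfold lag
    simp_rw [hst]
    rw [tsum_eq_sum (s := Finset.Ico L N) (fun p hp => if_neg hp),
      Finset.sum_congr rfl fun p hp => if_pos hp]
    simp
  rw [age, hsrc, hlag, ENNReal.toReal_natCast, Nat.cast_sub hLN]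

/-- The law of the random set of nonsubscribers that get a key. -/
noncomputable abbrev markLaw (n : ℕ) (S : Finset (Fin m)) : Measure (Finset (Fin m)) :=
  uniformOn (Finset.powersetCard (n - S.card) Sᶜ : Set (Finset (Fin m)))

theorem isProbabilityMeasure_markLaw {n : ℕ} (S : Finset (Fin m)) (hn : n ≤ m) :
    IsProbabilityMeasure (markLaw n S) := by
  refine isProbabilityMeasure_uniformOn (Finset.finite_toSet _) ?_
  rw [Finset.coe_nonempty, Finset.powersetCard_nonempty, Finset.card_compl, Fintype.card_fin]
  omega

/-- The activation rate of an edge (`1` when there are no edges). -/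
noncomputable def edgeRate (lamE : ℝ) (m : ℕ) : ℝ := if m ≤ 1 then 1 else lamE / ((m : ℝ) - 1)

theorem edgeRate_pos {lamE : ℝ} (hlamE : 0 < lamE) (m : ℕ) : 0 < edgeRate lamE m := by
  unfold edgeRate
  split_ifs with h
  · exact one_pos
  · have : (1 : ℝ) < m := by exact_mod_cast not_le.1 h
    exact div_pos hlamE (by linarith)

theorem measurePreserving_toSys {n : ℕ} {S : Finset (Fin m)} {lamS lamE : ℝ} (hn : n ≤ m)
    (hlamS : 0 < lamS) (hlamE : 0 < lamE) (j : Fin m) :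
    MeasurePreserving (toSys j) (law n S lamS lamE)
      (sysLaw {i : Fin m // i ≠ j} lamS (edgeRate lamE m) (markLaw n S)) := by
  have p1 := isProbabilityMeasure_expMeasure hlamS
  have p2 := isProbabilityMeasure_expMeasure (edgeRate_pos hlamE m)
  have p3 := isProbabilityMeasure_markLaw S hn
  have hlaw : law n S lamS lamE = (Measure.infinitePi fun _ : ℕ => expMeasure lamS).prod
      ((Measure.infinitePi fun _ : Edge m => Measure.infinitePi fun _ : ℕ =>
        expMeasure (edgeRate lamE m)).prod (Measure.infinitePi fun _ : ℕ => markLaw n S)) := by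
    unfold law
    congr 2
    congr 1
    ext1 e
    -- An edge exists only when `m ≥ 2`, where `edgeRate` is the rate used in `law`. The value `1`
    -- for smaller `m` merely keeps the rate positive.
    have hm : ¬ m ≤ 1 := by
      have h1 := e.2
      have h2 := e.1.1.2
      have h3 := e.1.2.2
      rw [Ne, Fin.ext_iff] at h1
      omega
    rw [edgeRate, if_neg hm]
  have hM : MeasurePreserving (fun (M : ℕ → Finset (Fin m)) p => M (p + 1))
      (Measure.infinitePi fun _ : ℕ => markLaw n S) (Measure.infinitePi fun _ : ℕ => markLaw n S) :=
    ⟨by fun_prop, Measure.map_infinitePi_infinitePi_of_inj (P := fun _ : ℕ => markLaw n S)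
      (f := fun p : ℕ => p + 1) (add_left_injective 1)⟩
  have hX : MeasurePreserving (fun (X : Edge m → ℕ → ℝ) (i : {i : Fin m // i ≠ j}) =>
        X ⟨(i.1, j), i.2⟩)
      (Measure.infinitePi fun _ : Edge m => Measure.infinitePi fun _ : ℕ =>
        expMeasure (edgeRate lamE m))
      (Measure.pi fun _ => Measure.infinitePi fun _ : ℕ => expMeasure (edgeRate lamE m)) := by
    refine ⟨by fun_prop, ?_⟩
    rw [← Measure.infinitePi_eq_pi]
    refine Measure.map_infinitePi_infinitePi_of_inj (P := fun _ : Edge m =>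
      Measure.infinitePi fun _ : ℕ => expMeasure (edgeRate lamE m))
      (f := fun i : {i : Fin m // i ≠ j} => (⟨(i.1, j), i.2⟩ : Edge m)) ?_
    intro a b hab
    simp only [Subtype.mk.injEq, Prod.mk.injEq, and_true] at hab
    exact Subtype.ext hab
  have h1 := (MeasurePreserving.id (Measure.infinitePi fun _ : ℕ => expMeasure lamS)).prod
    (Measure.measurePreserving_swap.comp (hX.prod hM))
  have h2 := (measurePreserving_prodAssoc (Measure.infinitePi fun _ : ℕ => expMeasure lamS)
    (Measure.infinitePi fun _ : ℕ => markLaw n S)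
    (Measure.pi fun _ : {i : Fin m // i ≠ j} => Measure.infinitePi fun _ : ℕ =>
      expMeasure (edgeRate lamE m))).symm
  rw [hlaw]
  exact h2.comp h1

/-- Once every edge has been heard, the node holds all `n` keys, and `k < n`. -/
theorem ae_decodes_univ {k n : ℕ} {S : Finset (Fin m)} (hk : k < n) (hS : S.card ≤ n)
    (j : Fin m) : ∀ᵐ e ∂(markLaw n S), decodes k S j e univ := by
  have h1 : ∀ e ∈ (Finset.powersetCard (n - S.card) Sᶜ : Set (Finset (Fin m))),
      decodes k S j e univ := by
    intro e he
    have he' := Finset.mem_powersetCard.1 (Finset.mem_coe.1 he)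
    have hheld : held S j e univ = ((S ∪ e : Finset (Fin m)) : Set (Fin m)) := by
      ext i
      by_cases hi : i = j <;> simp [held, hi]
    have hdisj : Disjoint S e := by
      refine Finset.disjoint_left.2 fun i hi hie => ?_
      exact Finset.mem_compl.1 (he'.1 hie) hi
    rw [decodes, hheld, ncard_coe_finset, Finset.card_union_of_disjoint hdisj, he'.2]
    omega
  have h2 : ∀ᵐ e ∂(markLaw n S),
      e ∈ (Finset.powersetCard (n - S.card) Sᶜ : Set (Finset (Fin m))) :=
    ProbabilityTheory.ae_cond_mem (Finset.measurableSet _)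
  filter_upwards [h2] with e he using h1 e he

/-- The limiting mean lag of node `j`. -/
noncomputable def nodeAge (k n : ℕ) (S : Finset (Fin m)) (lamS lamE : ℝ) (j : Fin m) : ℝ≥0∞ :=
  ⨆ u, meanLag (decodes k S j) lamS (edgeRate lamE m) (markLaw n S) u

theorem isNodeAge_nodeAge {k n : ℕ} {S : Finset (Fin m)} {lamS lamE : ℝ} (hk : k < n)
    (hS : S.card ≤ n) (hn : n ≤ m) (hlamS : 0 < lamS) (hlamE : 0 < lamE) (j : Fin m) :
    IsNodeAge k n S lamS lamE j (nodeAge k n S lamS lamE j).toReal := by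
  have p3 := isProbabilityMeasure_markLaw S hn
  have hmp := measurePreserving_toSys (S := S) hn hlamS hlamE j
  have hr := edgeRate_pos hlamE m
  have h1 := hmp.quasiMeasurePreserving.ae (ae_tendsto_lag (dec := decodes k S j) hlamS hr
    (ae_decodes_univ hk hS j) (decodes_mono k S j))
  have h2 := hmp.quasiMeasurePreserving.ae (ae_goodSys hlamS hr (markLaw n S))
  filter_upwards [h1, h2] with ω hω1 hω2
  have hm : Measurable fun u => lag (decodes k S j) (toSys j ω) u :=
    (measurable_lag_uncurry _).comp (measurable_const.prodMk measurable_id)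
  have hae : ∀ t : ℝ, 0 ≤ t → EqOn (fun u => (lag (decodes k S j) (toSys j ω) u).toReal)
      (age k S ω j) (Ioc 0 t) := fun t _ u hu => (age_eq_lag hω2 hu.1.le).symm
  refine ⟨fun t ht => ?_, ?_⟩
  · rw [intervalIntegrable_iff_integrableOn_Ioc_of_le ht]
    exact (integrable_toReal_of_lintegral_ne_top hm.aemeasurable (hω1.1 t)).congr
      ((ae_restrict_iff' measurableSet_Ioc).2 (ae_of_all _ fun u hu => hae t ht hu))
  · refine hω1.2.congr' ?_
    filter_upwards [eventually_gt_atTop 0] with t ht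
    rw [intervalIntegral.integral_of_le ht.le, ← setIntegral_congr_fun measurableSet_Ioc (hae t ht.le),
      integral_toReal hm.aemeasurable (ae_lt_top hm (hω1.1 t))]
    ring

end Bridge

/-! ### Erlang densities and Campbell's formula. -/

section Campbell

theorem lintegral_expMeasure {r : ℝ} {g : ℝ → ℝ≥0∞} (hg : Measurable g) :
    ∫⁻ a, g a ∂(expMeasure r) =
      ∫⁻ a in Ioi 0, ENNReal.ofReal (r * Real.exp (-(r * a))) * g a := by
  have hd : expMeasure r = volume.withDensity (exponentialPDF r) := rfl
  have hm : Measurable (exponentialPDF r) := (measurable_exponentialPDFReal r).ennreal_ofReal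
  rw [hd, lintegral_withDensity_eq_lintegral_mul _ hm hg, ← lintegral_indicator measurableSet_Ioi]
  refine lintegral_congr_ae ?_
  have h0 : ∀ᵐ a : ℝ, a ≠ 0 := by simp [ae_iff]
  filter_upwards [h0] with a ha
  rcases lt_or_gt_of_ne ha with h | h
  · rw [indicator_of_notMem (by simp [h.le]), Pi.mul_apply, exponentialPDF_of_neg h, zero_mul]
  · rw [indicator_of_mem (by exact h), Pi.mul_apply, exponentialPDF_of_nonneg h.le]

/-- The density of the time of the arrival number `p + 1`. -/
noncomputable def erlang (r : ℝ) (p : ℕ) (t : ℝ) : ℝ :=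
  r * Real.exp (-(r * t)) * ((r * t) ^ p / p.factorial)

theorem continuous_erlang (r : ℝ) (p : ℕ) : Continuous (erlang r p) := by
  unfold erlang; fun_prop

/-- The exponentials multiply to one that does not depend on `a`, so only the integral of `(t - a) ^
p` is left. -/
theorem lintegral_erlang_conv {r : ℝ} (hr : 0 < r) (p : ℕ) {t : ℝ} (ht : 0 < t) :
    ∫⁻ a in Ioo 0 t, ENNReal.ofReal (r * Real.exp (-(r * a))) * ENNReal.ofReal (erlang r p (t - a)) =
      ENNReal.ofReal (erlang r (p + 1) t) := by
  have h1 : ∀ a, ENNReal.ofReal (r * Real.exp (-(r * a))) * ENNReal.ofReal (erlang r p (t - a)) =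
      ENNReal.ofReal (r * Real.exp (-(r * t)) * (r ^ (p + 1) / p.factorial) * (t - a) ^ p) := by
    intro a
    rw [← ENNReal.ofReal_mul (by positivity), erlang]
    congr 1
    have : Real.exp (-(r * t)) = Real.exp (-(r * a)) * Real.exp (-(r * (t - a))) := by
      rw [← Real.exp_add]; congr 1; ring
    rw [this, mul_pow]
    ring
  simp_rw [h1]
  rw [← ofReal_integral_eq_lintegral_ofReal]
  · rw [← integral_Ioc_eq_integral_Ioo, ← intervalIntegral.integral_of_le ht.le,
      intervalIntegral.integral_const_mul,
      intervalIntegral.integral_comp_sub_left (fun x => x ^ p) t]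
    congr 1
    simp only [sub_self, sub_zero, integral_pow, erlang]
    rw [Nat.factorial_succ]
    push_cast
    have : ((p : ℝ) + 1) ≠ 0 := by positivity
    have h2 : (p.factorial : ℝ) ≠ 0 := by positivity
    field_simp
    ring
  · refine Continuous.integrableOn_Ioc (by fun_prop) |>.mono_set Ioo_subset_Ioc_self
  · refine (ae_restrict_iff' measurableSet_Ioo).2 (ae_of_all _ fun a ha => ?_)
    have : 0 < t - a := by linarith [ha.2]
    positivity

theorem lintegral_psum_succ {r : ℝ} (hr : 0 < r) (p : ℕ) : ∀ {g : ℝ → ℝ≥0∞}, Measurable g →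
    ∫⁻ x, g (psum x (p + 1)) ∂(Measure.infinitePi fun _ : ℕ => expMeasure r) =
      ∫⁻ t in Ioi 0, ENNReal.ofReal (erlang r p t) * g t := by
  have hP := isProbabilityMeasure_expMeasure hr
  induction p with
  | zero =>
    intro g hg
    have h := (measurePreserving_eval_infinitePi (fun _ : ℕ => expMeasure r) 0).lintegral_comp hg
    simp only [psum, zero_add, Finset.sum_range_one]
    rw [show (∫⁻ x, g (x 0) ∂(Measure.infinitePi fun _ : ℕ => expMeasure r)) = _ from h,
      lintegral_expMeasure hg]
    simp [erlang]
  | succ p ih =>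
    intro g hg
    rw [lintegral_infinitePi_cons _ (by fun_prop)]
    simp_rw [psum_consSeq_succ]
    have h1 : ∀ a : ℝ, ∫⁻ x, g (a + psum x (p + 1)) ∂(Measure.infinitePi fun _ : ℕ => expMeasure r) =
        ∫⁻ t, (Ioi a).indicator (fun t => ENNReal.ofReal (erlang r p (t - a)) * g t) t := by
      intro a
      rw [ih (g := fun t => g (a + t)) (by fun_prop), ← lintegral_indicator measurableSet_Ioi,
        ← lintegral_sub_right_eq_self _ a]
      refine lintegral_congr fun t => ?_
      by_cases h : a < t
      · rw [indicator_of_mem (by simpa using h), indicator_of_mem (by exact h)]; simp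
      · rw [indicator_of_notMem (by simpa using h), indicator_of_notMem (by exact h)]
    have hce := continuous_erlang r p
    have hm0 : Measurable fun q : ℝ × ℝ => (Ioi q.1).indicator
        (fun t => ENNReal.ofReal (erlang r p (t - q.1)) * g t) q.2 := by
      have hs : MeasurableSet {q : ℝ × ℝ | q.1 < q.2} := measurableSet_lt measurable_fst measurable_snd
      have : Measurable fun q : ℝ × ℝ => ENNReal.ofReal (erlang r p (q.2 - q.1)) * g q.2 := by
        have := hce.measurable
        fun_prop
      exact this.indicator hs
    simp_rw [h1]
    rw [lintegral_expMeasure (by exact hm0.lintegral_prod_right')]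
    have h2 : ∀ a : ℝ, ENNReal.ofReal (r * Real.exp (-(r * a))) *
        ∫⁻ t, (Ioi a).indicator (fun t => ENNReal.ofReal (erlang r p (t - a)) * g t) t =
        ∫⁻ t, ENNReal.ofReal (r * Real.exp (-(r * a))) *
          (Ioi a).indicator (fun t => ENNReal.ofReal (erlang r p (t - a)) * g t) t := fun a => by
      rw [lintegral_const_mul _ (by exact hm0.comp (measurable_const.prodMk measurable_id))]
    simp_rw [h2]
    rw [lintegral_lintegral_swap (by
      refine Measurable.aemeasurable ?_
      exact Measurable.mul (by fun_prop) hm0), ← lintegral_indicator measurableSet_Ioi]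
    refine lintegral_congr fun t => ?_
    have h3 : ∀ a, ENNReal.ofReal (r * Real.exp (-(r * a))) *
          (Ioi a).indicator (fun t => ENNReal.ofReal (erlang r p (t - a)) * g t) t =
        (Iio t).indicator (fun a => ENNReal.ofReal (r * Real.exp (-(r * a))) *
          ENNReal.ofReal (erlang r p (t - a))) a * g t := by
      intro a
      by_cases h : a < t
      · rw [indicator_of_mem (by exact h), indicator_of_mem (by exact h), mul_assoc]
      · rw [indicator_of_notMem (by exact h), indicator_of_notMem (by exact h)]; simp
    simp_rw [h3]
    have hm1 : Measurable fun a => ENNReal.ofReal (r * Real.exp (-(r * a))) *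
          ENNReal.ofReal (erlang r p (t - a)) := by
      have := hce.measurable
      fun_prop
    rw [lintegral_mul_const _ (hm1.indicator measurableSet_Iio),
      lintegral_indicator measurableSet_Iio, Measure.restrict_restrict measurableSet_Iio,
      Iio_inter_Ioi]
    by_cases ht : 0 < t
    · rw [indicator_of_mem (by exact ht), lintegral_erlang_conv hr p ht]
    · rw [indicator_of_notMem (by exact ht), Ioo_eq_empty ht]; simp

/-- The Poisson weights sum to one, so the densities of all arrival times add up to the constant
intensity. -/
theorem tsum_erlang {r : ℝ} (hr : 0 < r) {t : ℝ} (ht : 0 ≤ t) :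
    ∑' p, ENNReal.ofReal (erlang r p t) = ENNReal.ofReal r := by
  have hs : HasSum (fun p => erlang r p t) (r * Real.exp (-(r * t)) * Real.exp (r * t)) := by
    unfold erlang
    refine HasSum.mul_left _ ?_
    rw [Real.exp_eq_exp_ℝ]
    exact NormedSpace.expSeries_div_hasSum_exp (r * t)
  rw [← ENNReal.ofReal_tsum_of_nonneg (fun p => by unfold erlang; positivity) hs.summable,
    hs.tsum_eq, mul_assoc, ← Real.exp_add]
  simp

/-- Campbell's formula for the Poisson process. -/
theorem tsum_lintegral_psum {r : ℝ} (hr : 0 < r) {g : ℝ → ℝ≥0∞} (hg : Measurable g) :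
    ∑' p, ∫⁻ x, g (psum x (p + 1)) ∂(Measure.infinitePi fun _ : ℕ => expMeasure r) =
      ENNReal.ofReal r * ∫⁻ t in Ioi 0, g t := by
  simp_rw [lintegral_psum_succ hr _ hg]
  rw [← lintegral_tsum fun p => by
    have := (continuous_erlang r p).measurable
    exact Measurable.aemeasurable (by fun_prop)]
  simp_rw [ENNReal.tsum_mul_right]
  rw [← lintegral_const_mul _ hg]
  exact setLIntegral_congr_fun measurableSet_Ioi fun t ht => by rw [tsum_erlang hr (le_of_lt ht)]

/-- Campbell's formula for a window of length `u`, seen from its end. -/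
theorem tsum_lintegral_window {r : ℝ} (hr : 0 < r) {G : ℝ → ℝ≥0∞} (hG : Measurable G) (w u : ℝ) :
    ∑' p, ∫⁻ x, {x | psum x (p + 1) ≤ u - w}.indicator (fun x => G (u - psum x (p + 1))) x
        ∂(Measure.infinitePi fun _ : ℕ => expMeasure r) =
      ENNReal.ofReal r * ∫⁻ t in Ico w u, G t := by
  have h := tsum_lintegral_psum hr (g := (Iic (u - w)).indicator fun t => G (u - t))
    ((hG.comp (by fun_prop)).indicator measurableSet_Iic)
  refine Eq.trans ?_ (h.trans ?_)
  · rfl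
  · congr 1
    rw [← lintegral_indicator measurableSet_Ioi, ← lintegral_sub_left_eq_self _ u,
      ← lintegral_indicator measurableSet_Ico]
    refine lintegral_congr fun t => ?_
    by_cases h : t ∈ Ico w u
    · rw [indicator_of_mem h, indicator_of_mem (by simpa using h.2),
        indicator_of_mem (by rw [mem_Iic]; linarith [h.1])]
      simp
    · rw [indicator_of_notMem h]
      by_cases h2 : t < u
      · rw [indicator_of_mem (by simpa using h2), indicator_of_notMem]
        intro h3
        have h4 : u - t ≤ u - w := h3
        exact h ⟨by linarith, h2⟩
      · rw [indicator_of_notMem (by simpa using h2)]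

end Campbell

/-! ### Backward recurrence times. -/

section Recurrence

/-- The time since the last arrival before `u` (`u` if there is none). -/
noncomputable def brec (u : ℝ) (x : ℕ → ℝ) : ℝ := u - psum x (cnt u x)

@[fun_prop]
theorem measurable_brec (u : ℝ) : Measurable (brec u) := by
  refine measurable_const.sub ?_
  exact (measurable_from_prod_countable_right (f := fun q : ℕ × (ℕ → ℝ) => psum q.2 q.1)
    fun n => measurable_psum n).comp ((measurable_cnt u).prodMk measurable_id)

theorem Good.arr_iff_brec {x : ℕ → ℝ} (hx : Good x) {u v : ℝ} (hv : 0 < v) (hvu : v ≤ u) :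
    Arr x v u ↔ brec u x ≤ u - v := by
  have hu : 0 ≤ u := by linarith
  unfold brec
  constructor
  · rintro ⟨r, h1, h2⟩
    have := hx.strictMono.monotone ((hx.le_iff hu _).1 h2)
    linarith
  · intro h
    rcases hc : cnt u x with _ | n
    · rw [hc, psum_zero] at h; linarith
    · refine ⟨n, ?_, ?_⟩
      · rw [hc] at h; linarith
      · rw [hx.le_iff hu]; omega

theorem Good.le_brec_iff {x : ℕ → ℝ} (hx : Good x) {u t : ℝ} (ht : 0 ≤ t) (htu : t ≤ u) :
    t ≤ brec u x ↔ ∀ n, ¬ (u - t < psum x (n + 1) ∧ psum x (n + 1) ≤ u) := by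
  have hu : 0 ≤ u := by linarith
  unfold brec
  constructor
  · rintro h n ⟨h1, h2⟩
    have := hx.strictMono.monotone ((hx.le_iff hu _).1 h2)
    linarith
  · intro h
    rcases hc : cnt u x with _ | n
    · rw [psum_zero]; linarith
    · have h1 := h n
      rw [not_and_or, not_lt] at h1
      rcases h1 with h1 | h1
      · linarith
      · exact absurd ((hx.le_iff hu _).2 (by omega)) h1

/-- For `0 < t ≤ u` the backward recurrence time is at least `t` iff there is no arrival in `(u - t,
u]`, which has probability `exp (-(r * t))`; it never exceeds `u`. These are the tails of a
truncated exponential time. -/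
theorem map_brec {r : ℝ} (hr : 0 < r) {u : ℝ} (hu : 0 ≤ u) :
    (Measure.infinitePi fun _ : ℕ => expMeasure r).map (brec u) =
      (expMeasure r).map (fun b => min b u) := by
  have hP := isProbabilityMeasure_expMeasure hr
  have hP2 := Measure.isProbabilityMeasure_map
    (μ := Measure.infinitePi fun _ : ℕ => expMeasure r) (measurable_brec u).aemeasurable
  have hmin : Measurable fun b : ℝ => min b u := measurable_id.min measurable_const
  have hnn : ∀ᵐ b ∂(expMeasure r), 0 < b := by
    rw [ae_iff]; simpa [Iic_def] using expMeasure_Iic_zero hr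
  -- The exponential law has no atoms; this reconciles the closed half-lines used to identify the
  -- measures with the open ones in `expMeasure_Ioi`.
  have hae : ∀ t : ℝ, (Ioi t : Set ℝ) =ᵐ[expMeasure r] Ici t := fun t =>
    (withDensity_absolutelyContinuous (volume : Measure ℝ) (exponentialPDF r)).ae_le
      (Ioi_ae_eq_Ici (μ := volume) (a := t))
  refine Measure.ext_of_Ici _ _ fun t => ?_
  rw [Measure.map_apply (measurable_brec u) measurableSet_Ici, Measure.map_apply hmin
    measurableSet_Ici]
  rcases lt_or_ge u t with h1 | h1
  · have e2 : (fun b : ℝ => min b u) ⁻¹' Ici t = ∅ := by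
      refine eq_empty_of_forall_notMem fun b hb => ?_
      exact absurd ((mem_Ici.1 hb).trans (min_le_right _ _)) (not_le.2 h1)
    rw [e2, measure_empty]
    refine measure_mono_null (t := {x | ¬ Good x}) (fun x hx hg => ?_) (ae_iff.1 (ae_good hr))
    have h0 : 0 ≤ psum x (cnt u x) := by
      simpa [psum_zero] using hg.strictMono.monotone (Nat.zero_le (cnt u x))
    have : t ≤ brec u x := hx
    unfold brec at this
    linarith
  · rcases le_or_gt t 0 with h2 | h2
    · have e1 : ∀ᵐ x ∂(Measure.infinitePi fun _ : ℕ => expMeasure r), x ∈ brec u ⁻¹' Ici t := by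
        refine ae_of_all _ fun x => ?_
        have := Good.psum_cnt_le (x := x) hu
        change t ≤ u - psum x (cnt u x)
        linarith
      have e2 : ∀ᵐ b ∂(expMeasure r), b ∈ (fun b : ℝ => min b u) ⁻¹' Ici t := by
        filter_upwards [hnn] with b hb
        exact le_min (by linarith) h1
      rw [(mem_ae_iff_prob_eq_one (measurable_brec u measurableSet_Ici)).1 e1,
        (mem_ae_iff_prob_eq_one (hmin measurableSet_Ici)).1 e2]
    · have e2 : (fun b : ℝ => min b u) ⁻¹' Ici t = Ici t := by
        ext b
        simp [h1]
      rw [e2, ← measure_congr (hae t), expMeasure_Ioi hr h2.le]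
      have := measure_no_arrival hr (sub_nonneg.2 h1) (show u - t ≤ u by linarith)
      rw [sub_sub_cancel] at this
      rw [← this]
      refine measure_congr ?_
      filter_upwards [ae_good hr] with x hx
      exact propext (hx.le_brec_iff h2.le h1)

end Recurrence

/-! ### Replacing the edge processes by independent exponential times. -/

section Static

variable {E : Type*} [MeasurableSpace E] {I : Type*} [Fintype I]
  [Countable E] [MeasurableSingletonClass E] {dec : E → Set I → Prop}
  {lamS r : ℝ} {ν : Measure E} [IsProbabilityMeasure ν]

/-- Staleness of version `p + 1` at time `u` in terms of the times since the last activations. -/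
def SStale (dec : E → Set I → Prop) (u : ℝ) (p : ℕ) (s : MSeq E) (B : I → ℝ) : Prop :=
  psum s.1 (p + 1) ≤ u ∧ ∀ q ≥ p, psum s.1 (q + 1) ≤ u →
    ¬ dec (s.2 q) {i | B i ≤ u - psum s.1 (q + 1)}

theorem measurable_dec_le (dec : E → Set I → Prop) {α : Type*} [MeasurableSpace α] {e : α → E}
    (he : Measurable e) {B : α → I → ℝ} (hB : Measurable B) {t : α → ℝ} (ht : Measurable t) :
    Measurable fun a => dec (e a) {i | B a i ≤ t a} := by
  have h2 : (fun a => dec (e a) {i | B a i ≤ t a}) = fun a => ∃ e' : E, ∃ A : Set I,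
      (e a = e' ∧ ∀ i, B a i ≤ t a ↔ i ∈ A) ∧ dec e' A := by
    ext a
    refine ⟨fun h => ⟨_, _, ⟨rfl, fun i => Iff.rfl⟩, h⟩, ?_⟩
    rintro ⟨e', A, ⟨rfl, hA⟩, h⟩
    have : {i | B a i ≤ t a} = A := Set.ext hA
    rwa [this]
  rw [h2]
  refine Measurable.exists fun e' => Measurable.exists fun A =>
    Measurable.and (Measurable.and ?_ ?_) measurable_const
  · exact measurableSet_setOfPred.1 (he (measurableSet_singleton e'))
  · refine Measurable.forall fun i => Measurable.iff ?_ measurable_const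
    exact measurableSet_setOfPred.1 (measurableSet_le ((measurable_pi_apply i).comp hB) ht)

theorem measurable_sStale (u : ℝ) (p : ℕ) :
    Measurable fun q : MSeq E × (I → ℝ) => SStale dec u p q.1 q.2 := by
  have h1 : ∀ q : ℕ, Measurable fun a : MSeq E × (I → ℝ) => psum a.1.1 (q + 1) := fun q =>
    (measurable_psum (q + 1)).comp (measurable_fst.comp measurable_fst)
  have h2 : ∀ q : ℕ, Measurable fun a : MSeq E × (I → ℝ) => psum a.1.1 (q + 1) ≤ u := fun q =>
    measurableSet_setOfPred.1 (measurableSet_le (h1 q) measurable_const)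
  refine (h2 p).and (Measurable.forall fun q => Measurable.imp measurable_const
    ((h2 q).imp (Measurable.not ?_)))
  exact measurable_dec_le dec (e := fun a : MSeq E × (I → ℝ) => a.1.2 q) (by fun_prop)
    (B := fun a : MSeq E × (I → ℝ) => a.2) (by fun_prop)
    (t := fun a : MSeq E × (I → ℝ) => u - psum a.1.1 (q + 1)) (measurable_const.sub (h1 q))

/-- The law of the source and of independent exponential times, one for each edge. -/
noncomputable abbrev statLaw (I : Type*) [Fintype I] (lamS r : ℝ) (ν : Measure E) :
    Measure (MSeq E × (I → ℝ)) :=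
  (mLaw (expMeasure lamS) ν).prod (Measure.pi fun _ : I => expMeasure r)

omit [Countable E] [MeasurableSingletonClass E] in
/-- The times since the last activations have the law of truncated exponential times. -/
theorem measure_brec_eq (hS : 0 < lamS) (hr : 0 < r) {u : ℝ} (hu : 0 ≤ u)
    {T : MSeq E → (I → ℝ) → Prop} (hT : Measurable fun q : MSeq E × (I → ℝ) => T q.1 q.2)
    (hinv : ∀ s B, Good s.1 → (T s (fun i => min (B i) u) ↔ T s B)) :
    sysLaw I lamS r ν {ω | T ω.1 fun i => brec u (ω.2 i)} =
      statLaw I lamS r ν {q | T q.1 q.2} := by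
  have hP1 := isProbabilityMeasure_expMeasure hS
  have hP2 := isProbabilityMeasure_expMeasure hr
  have hmin : Measurable fun b : ℝ => min b u := measurable_id.min measurable_const
  have hms : MeasurableSet {q : MSeq E × (I → ℝ) | T q.1 q.2} := measurableSet_setOfPred.2 hT
  have i1 := Measure.isProbabilityMeasure_map
    (μ := Measure.infinitePi fun _ : ℕ => expMeasure r) (measurable_brec u).aemeasurable
  have i2 := Measure.isProbabilityMeasure_map (μ := expMeasure r) hmin.aemeasurable
  have mp1 : MeasurePreserving (fun (x : I → ℕ → ℝ) i => brec u (x i))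
      (Measure.pi fun _ : I => Measure.infinitePi fun _ : ℕ => expMeasure r)
      (Measure.pi fun _ : I => (expMeasure r).map fun b => min b u) := by
    refine ⟨by fun_prop, ?_⟩
    rw [Measure.pi_map_pi fun _ => (measurable_brec u).aemeasurable, map_brec hr hu]
  have mp2 : MeasurePreserving (fun (B : I → ℝ) i => min (B i) u)
      (Measure.pi fun _ : I => expMeasure r)
      (Measure.pi fun _ : I => (expMeasure r).map fun b => min b u) := by
    refine ⟨by fun_prop, ?_⟩
    rw [Measure.pi_map_pi (f := fun _ b => min b u) fun _ => hmin.aemeasurable]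
  have q1 := ((MeasurePreserving.id (mLaw (expMeasure lamS) ν)).prod mp1).measure_preimage
    hms.nullMeasurableSet
  have q2 := ((MeasurePreserving.id (mLaw (expMeasure lamS) ν)).prod mp2).measure_preimage
    hms.nullMeasurableSet
  refine Eq.trans ?_ ((q1.trans q2.symm).trans ?_)
  · rfl
  · refine measure_congr ?_
    have hg : ∀ᵐ q ∂(statLaw I lamS r ν), Good q.1.1 :=
      measurePreserving_fst.quasiMeasurePreserving.ae (ae_good_mLaw hS ν)
    filter_upwards [hg] with q hq using propext (hinv q.1 q.2 hq)

theorem Good.psum_succ_pos {x : ℕ → ℝ} (hx : Good x) (n : ℕ) : 0 < psum x (n + 1) := by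
  have := hx.strictMono (Nat.succ_pos n)
  rwa [psum_zero] at this

-- Truncation at `u` is invisible: every version is created at a positive time `τ`, so its age stays
-- below `u`.
omit [Fintype I] in
theorem setOf_min_le {B : I → ℝ} {u τ : ℝ} (hτ : 0 < τ) :
    {i | min (B i) u ≤ u - τ} = {i | B i ≤ u - τ} := by
  ext i
  simp only [mem_ofPred_eq, min_le_iff]
  constructor
  · rintro (h | h)
    · exact h
    · linarith
  · exact Or.inl

omit [MeasurableSpace E] [Fintype I] [Countable E] [MeasurableSingletonClass E] in
theorem GoodSys.heard_eq {ω : Sys E I} (hω : GoodSys ω) {u : ℝ} {q : ℕ} (hb : born ω q ≤ u) :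
    heard ω q u = {i | brec u (ω.2 i) ≤ u - psum ω.1.1 (q + 1)} :=
  Set.ext fun i => (hω.2 i).arr_iff_brec (hω.1.psum_succ_pos q) hb

/-- At the fixed time `u`, the edges heard since a creation time are those whose last activation is
recent enough. One family of exponential ages thus describes all versions at once. -/
theorem measure_stale_eq (hS : 0 < lamS) (hr : 0 < r) {u : ℝ} (hu : 0 ≤ u) (p : ℕ) :
    sysLaw I lamS r ν {ω | Stale dec ω p u} =
      statLaw I lamS r ν {q | SStale dec u p q.1 q.2} := by
  rw [← measure_brec_eq hS hr hu (measurable_sStale u p)]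
  · refine measure_congr ?_
    filter_upwards [ae_goodSys hS hr ν] with ω hω
    refine propext (and_congr_right fun _ => forall_congr' fun q => forall_congr' fun _ =>
      forall_congr' fun hb => ?_)
    unfold Undec
    rw [hω.heard_eq hb]
  · intro s B hs
    refine and_congr_right fun _ => forall_congr' fun n => forall_congr' fun _ =>
      forall_congr' fun hb => ?_
    rw [setOf_min_le (hs.psum_succ_pos n)]

theorem measurable_undec_static (v u : ℝ) (p : ℕ) : Measurable fun q : MSeq E × (I → ℝ) =>
    psum q.1.1 (p + 1) ≤ v ∧ psum q.1.1 (p + 1) ≤ u ∧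
      ¬ dec (q.1.2 p) {i | q.2 i ≤ u - psum q.1.1 (p + 1)} := by
  have h1 : Measurable fun a : MSeq E × (I → ℝ) => psum a.1.1 (p + 1) :=
    (measurable_psum (p + 1)).comp (measurable_fst.comp measurable_fst)
  refine Measurable.and (measurableSet_setOfPred.1 (measurableSet_le h1 measurable_const))
    (Measurable.and (measurableSet_setOfPred.1 (measurableSet_le h1 measurable_const))
      (Measurable.not ?_))
  exact measurable_dec_le dec (e := fun a : MSeq E × (I → ℝ) => a.1.2 p) (by fun_prop)
    (B := fun a : MSeq E × (I → ℝ) => a.2) (by fun_prop)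
    (t := fun a : MSeq E × (I → ℝ) => u - psum a.1.1 (p + 1)) (measurable_const.sub h1)

theorem measure_undec_eq (hS : 0 < lamS) (hr : 0 < r) {u : ℝ} (hu : 0 ≤ u) (v : ℝ) (p : ℕ) :
    sysLaw I lamS r ν {ω | born ω p ≤ v ∧ born ω p ≤ u ∧ Undec dec ω p u} =
      statLaw I lamS r ν {q | psum q.1.1 (p + 1) ≤ v ∧ psum q.1.1 (p + 1) ≤ u ∧
        ¬ dec (q.1.2 p) {i | q.2 i ≤ u - psum q.1.1 (p + 1)}} := by
  rw [← measure_brec_eq hS hr hu (T := fun s B => psum s.1 (p + 1) ≤ v ∧ psum s.1 (p + 1) ≤ u ∧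
    ¬ dec (s.2 p) {i | B i ≤ u - psum s.1 (p + 1)}) (measurable_undec_static v u p)]
  · refine measure_congr ?_
    filter_upwards [ae_goodSys hS hr ν] with ω hω
    refine propext (and_congr_right fun _ => and_congr_right fun hb => ?_)
    unfold Undec
    rw [hω.heard_eq hb]
  · intro s B hs
    rw [setOf_min_le (hs.psum_succ_pos p)]

theorem meanLag_eq_tsum (hS : 0 < lamS) (hr : 0 < r) {u : ℝ} (hu : 0 ≤ u) :
    meanLag dec lamS r ν u = ∑' p, statLaw I lamS r ν {q | SStale dec u p q.1 q.2} := by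
  classical
  have hm : ∀ p, MeasurableSet {ω : Sys E I | Stale dec ω p u} := fun p =>
    measurableSet_setOfPred.2 ((measurable_stale dec p).comp
      ((measurable_id (α := Sys E I)).prodMk (measurable_const (a := u))))
  unfold meanLag lag
  rw [lintegral_tsum fun p =>
    (Measurable.ite (hm p) measurable_const measurable_const).aemeasurable]
  refine tsum_congr fun p => ?_
  rw [← measure_stale_eq hS hr hu, ← lintegral_indicator_one (hm p)]
  rfl

end Static

/-! ### Counting independent exponential clocks. -/

section Binomial

/-- Resampling one coordinate independently preserves a product law; this permits integrating out
one edge at a time. -/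
theorem map_update_pi {I α : Type*} [Fintype I] [DecidableEq I] [MeasurableSpace α] (μ : Measure α)
    [IsProbabilityMeasure μ] (a : I) :
    ((Measure.pi fun _ : I => μ).prod μ).map (fun q => Function.update q.1 a q.2) =
      Measure.pi fun _ : I => μ := by
  have hm : Measurable fun q : (I → α) × α => Function.update q.1 a q.2 := by
    refine measurable_pi_lambda _ fun i => ?_
    by_cases h : i = a
    · subst h; simpa using measurable_snd
    · simp only [Function.update_of_ne h]; fun_prop
  refine (Measure.pi_eq fun s hs => ?_).symm
  rw [Measure.map_apply hm (.univ_pi hs)]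
  have hpre : (fun q : (I → α) × α => Function.update q.1 a q.2) ⁻¹' univ.pi s =
      (univ.pi (Function.update s a univ)) ×ˢ s a := by
    ext ⟨B, b⟩
    simp only [mem_preimage, Set.mem_pi, mem_univ, true_imp_iff, mem_prod]
    constructor
    · intro h
      refine ⟨fun i => ?_, by simpa using h a⟩
      by_cases hi : i = a
      · subst hi; simp
      · simpa [hi] using h i
    · rintro ⟨h1, h2⟩ i
      by_cases hi : i = a
      · subst hi; simpa using h2
      · simpa [hi] using h1 i
  rw [hpre, Measure.prod_prod, Measure.pi_pi, ← Finset.mul_prod_erase _ _ (Finset.mem_univ a),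
    ← Finset.mul_prod_erase Finset.univ (fun i => μ (s i)) (Finset.mem_univ a)]
  rw [Function.update_self, measure_univ, one_mul, mul_comm]
  congr 1
  exact Finset.prod_congr rfl fun i hi => by rw [Function.update_of_ne (Finset.ne_of_mem_erase hi)]

theorem lintegral_pi_update {I α : Type*} [Fintype I] [DecidableEq I] [MeasurableSpace α]
    (μ : Measure α) [IsProbabilityMeasure μ] (a : I) {F : (I → α) → ℝ≥0∞} (hF : Measurable F) :
    ∫⁻ B, F B ∂(Measure.pi fun _ : I => μ) =
      ∫⁻ B, ∫⁻ b, F (Function.update B a b) ∂μ ∂(Measure.pi fun _ : I => μ) := by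
  have hm : Measurable fun q : (I → α) × α => Function.update q.1 a q.2 := by
    refine measurable_pi_lambda _ fun i => ?_
    by_cases h : i = a
    · subst h; simpa using measurable_snd
    · simp only [Function.update_of_ne h]; fun_prop
  conv_lhs => rw [← map_update_pi μ a]
  rw [lintegral_map hF hm]
  exact lintegral_prod _ (hF.comp hm).aemeasurable

/-- The probability that `d` of `n` independent events of probability `1 - q` occur. -/
noncomputable def binEq (q : ℝ) (n d : ℕ) : ℝ := n.choose d * (1 - q) ^ d * q ^ (n - d)

/-- The probability that fewer than `k` of `n` independent events of probability `1 - q` occur. -/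
noncomputable def binLt (q : ℝ) (n k : ℕ) : ℝ := ∑ d ∈ Finset.range k, binEq q n d

theorem binEq_nonneg {q : ℝ} (h0 : 0 ≤ q) (h1 : q ≤ 1) (n d : ℕ) : 0 ≤ binEq q n d := by
  have : 0 ≤ 1 - q := by linarith
  unfold binEq; positivity

theorem binLt_nonneg {q : ℝ} (h0 : 0 ≤ q) (h1 : q ≤ 1) (n k : ℕ) : 0 ≤ binLt q n k :=
  Finset.sum_nonneg fun d _ => binEq_nonneg h0 h1 n d

theorem binEq_succ_zero (q : ℝ) (n : ℕ) : binEq q (n + 1) 0 = q * binEq q n 0 := by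
  simp [binEq, pow_succ, mul_comm]

theorem binEq_succ_succ (q : ℝ) (n d : ℕ) :
    binEq q (n + 1) (d + 1) = q * binEq q n (d + 1) + (1 - q) * binEq q n d := by
  unfold binEq
  rw [Nat.choose_succ_succ, Nat.add_sub_add_right]
  rcases Nat.lt_or_ge d n with h | h
  · have : n - d = (n - (d + 1)) + 1 := by omega
    rw [this]
    push_cast
    ring
  · rw [Nat.choose_eq_zero_of_lt (show n < d + 1 by omega)]
    push_cast
    ring

theorem binLt_succ_succ (q : ℝ) (n k : ℕ) :
    binLt q (n + 1) (k + 1) = q * binLt q n (k + 1) + (1 - q) * binLt q n k := by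
  unfold binLt
  rw [Finset.sum_range_succ', Finset.sum_range_succ' _ k]
  simp_rw [binEq_succ_succ, binEq_succ_zero]
  rw [Finset.sum_add_distrib, ← Finset.mul_sum, ← Finset.mul_sum]
  ring

/-- One additional trial adds at most one success. It compares a node that is itself a key holder
with one that is not. -/
theorem binLt_le_succ_succ {q : ℝ} (h0 : 0 ≤ q) (h1 : q ≤ 1) (n k : ℕ) :
    binLt q n k ≤ binLt q (n + 1) (k + 1) := by
  rw [binLt_succ_succ]
  have : binLt q n k ≤ binLt q n (k + 1) := by
    unfold binLt
    rw [Finset.sum_range_succ]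
    linarith [binEq_nonneg h0 h1 n k]
  nlinarith

theorem binLt_zero_succ (q : ℝ) (k : ℕ) : binLt q 0 (k + 1) = 1 := by
  unfold binLt
  rw [Finset.sum_range_succ']
  simp [binEq]

theorem expMeasure_Iic {r : ℝ} (hr : 0 < r) {t : ℝ} (ht : 0 ≤ t) :
    expMeasure r (Iic t) = ENNReal.ofReal (1 - Real.exp (-(r * t))) := by
  have hP := isProbabilityMeasure_expMeasure hr
  rw [← compl_Ioi, prob_compl_eq_one_sub measurableSet_Ioi, expMeasure_Ioi hr ht,
    ← ENNReal.ofReal_one, ENNReal.ofReal_sub _ (Real.exp_pos _).le]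

variable {I : Type*} [Fintype I]

-- Induction on `T`: resample the clock `a` and distinguish whether it has rung by time `t`, which
-- is the recursion `binLt_succ_succ`.
open Classical in
theorem measure_count_lt {r : ℝ} (hr : 0 < r) {t : ℝ} (ht : 0 ≤ t) (T : Finset I) : ∀ k : ℕ,
    (Measure.pi fun _ : I => expMeasure r) {B | (T.filter fun i => B i ≤ t).card < k} =
      ENNReal.ofReal (binLt (Real.exp (-(r * t))) T.card k) := by
  have hP := isProbabilityMeasure_expMeasure hr
  set q := Real.exp (-(r * t)) with hq
  have hq0 : 0 ≤ q := (Real.exp_pos _).le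
  have hq1 : q ≤ 1 := Real.exp_le_one_iff.2 (by have := mul_nonneg hr.le ht; linarith)
  have hmeas : ∀ (T : Finset I) (k : ℕ),
      MeasurableSet {B : I → ℝ | (T.filter fun i => B i ≤ t).card < k} := by
    intro T k
    have : (fun B : I → ℝ => (T.filter fun i => B i ≤ t).card) =
        fun B => ∑ i ∈ T, if B i ≤ t then 1 else 0 := by
      ext B; rw [Finset.card_filter]
    have hm : Measurable fun B : I → ℝ => (T.filter fun i => B i ≤ t).card := by
      rw [this]
      exact Finset.measurable_sum _ fun i _ => Measurable.ite
        (measurableSet_le (measurable_pi_apply i) measurable_const) measurable_const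
          measurable_const
    exact hm (measurableSet_Iio (a := k))
  induction T using Finset.induction_on with
  | empty =>
    intro k
    rcases k with _ | k
    · simp [binLt]
    · rw [Finset.card_empty, binLt_zero_succ]; simp
  | insert a T ha ih =>
    intro k
    rcases k with _ | k
    · simp [binLt]
    rw [Finset.card_insert_of_notMem ha, binLt_succ_succ, ← lintegral_indicator_one (hmeas _ _),
      lintegral_pi_update _ a (measurable_one.indicator (hmeas _ _))]
    have h1 : ∀ (B : I → ℝ) (b : ℝ),
        {B : I → ℝ | ((insert a T).filter fun i => B i ≤ t).card < k + 1}.indicator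
          (1 : (I → ℝ) → ℝ≥0∞) (Function.update B a b) =
        (Ioi t).indicator (fun _ => {B : I → ℝ | (T.filter fun i => B i ≤ t).card < k + 1}.indicator
          (1 : (I → ℝ) → ℝ≥0∞) B) b +
        (Iic t).indicator (fun _ => {B : I → ℝ | (T.filter fun i => B i ≤ t).card < k}.indicator
          (1 : (I → ℝ) → ℝ≥0∞) B) b := by
      intro B b
      have e : T.filter (fun i => Function.update B a b i ≤ t) = T.filter fun i => B i ≤ t := by
        refine Finset.filter_congr fun i hi => ?_
        rw [Function.update_of_ne (ne_of_mem_of_not_mem hi ha)]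
      simp only [indicator, mem_ofPred_eq, Finset.filter_insert, Function.update_self, e, mem_Ioi,
        mem_Iic, Pi.one_apply]
      by_cases hb : b ≤ t
      · rw [if_pos hb, Finset.card_insert_of_notMem (by simp [ha])]
        simp [hb, not_lt.2 hb]
      · simp [hb, not_le.1 hb]
    simp_rw [h1]
    have h2 : ∀ B : I → ℝ, ∫⁻ b, ((Ioi t).indicator
          (fun _ => {B : I → ℝ | (T.filter fun i => B i ≤ t).card < k + 1}.indicator
            (1 : (I → ℝ) → ℝ≥0∞) B) b +
        (Iic t).indicator (fun _ => {B : I → ℝ | (T.filter fun i => B i ≤ t).card < k}.indicator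
          (1 : (I → ℝ) → ℝ≥0∞) B) b) ∂(expMeasure r) =
        ENNReal.ofReal q * {B : I → ℝ | (T.filter fun i => B i ≤ t).card < k + 1}.indicator
            (1 : (I → ℝ) → ℝ≥0∞) B +
        ENNReal.ofReal (1 - q) * {B : I → ℝ | (T.filter fun i => B i ≤ t).card < k}.indicator
            (1 : (I → ℝ) → ℝ≥0∞) B := by
      intro B
      rw [lintegral_add_left (measurable_const.indicator measurableSet_Ioi),
        lintegral_indicator measurableSet_Ioi, lintegral_indicator measurableSet_Iic,
        setLIntegral_const, setLIntegral_const, expMeasure_Ioi hr ht, expMeasure_Iic hr ht,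
        mul_comm, mul_comm (ENNReal.ofReal (1 - q))]
    simp_rw [h2]
    rw [lintegral_add_left (by exact (measurable_one.indicator (hmeas _ _)).const_mul _),
      lintegral_const_mul _ (measurable_one.indicator (hmeas _ _)),
      lintegral_const_mul _ (measurable_one.indicator (hmeas _ _)),
      lintegral_indicator_one (hmeas _ _), lintegral_indicator_one (hmeas _ _), ih, ih,
      ← ENNReal.ofReal_mul hq0, ← ENNReal.ofReal_mul (by linarith),
      ← ENNReal.ofReal_add (mul_nonneg hq0 (binLt_nonneg hq0 hq1 _ _))
        (mul_nonneg (by linarith) (binLt_nonneg hq0 hq1 _ _))]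

theorem hasDerivAt_binEq_zero (r : ℝ) (n : ℕ) (t : ℝ) :
    HasDerivAt (fun t => binEq (Real.exp (-(r * t))) n 0)
      (-(r * n * binEq (Real.exp (-(r * t))) n 0)) t := by
  have he : HasDerivAt (fun t => Real.exp (-(r * t))) (Real.exp (-(r * t)) * -(r * 1)) t :=
    (((hasDerivAt_id t).const_mul r).neg).exp
  have := he.pow n
  simp only [binEq, Nat.choose_zero_right, Nat.cast_one, pow_zero, one_mul, Nat.sub_zero]
  refine this.congr_deriv ?_
  rcases n with _ | n
  · simp
  · rw [Nat.add_sub_cancel, pow_succ]; ring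

/-- The number of clocks that have rung is a pure birth chain leaving state `d` at rate `r * (n -
d)`; this is its forward equation. -/
theorem hasDerivAt_binEq_succ (r : ℝ) {n d : ℕ} (hd : d < n) (t : ℝ) :
    HasDerivAt (fun t => binEq (Real.exp (-(r * t))) n (d + 1))
      (r * ((n - d : ℝ) * binEq (Real.exp (-(r * t))) n d -
        (n - (d + 1) : ℝ) * binEq (Real.exp (-(r * t))) n (d + 1))) t := by
  have he : HasDerivAt (fun t => Real.exp (-(r * t))) (Real.exp (-(r * t)) * -(r * 1)) t :=
    (((hasDerivAt_id t).const_mul r).neg).exp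
  have h1 := (((he.const_sub 1).pow (d + 1)).const_mul (n.choose (d + 1) : ℝ)).mul
    (he.pow (n - (d + 1)))
  refine h1.congr_deriv ?_
  simp only [Pi.pow_apply]
  unfold binEq
  have hc : (n.choose (d + 1) : ℝ) * (d + 1) = n.choose d * (n - d : ℝ) := by
    have := Nat.choose_succ_right_eq n d
    rw [← Nat.cast_sub hd.le]
    exact_mod_cast this
  obtain ⟨l, rfl⟩ := Nat.exists_eq_add_of_le (Nat.succ_le_of_lt hd)
  have e1 : d.succ + l - (d + 1) = l := by omega
  have e2 : d.succ + l - d = l + 1 := by omega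
  rw [e1, e2]
  simp only [Nat.add_sub_cancel, Nat.succ_eq_add_one]
  push_cast at hc ⊢
  set x := Real.exp (-(r * t))
  have e3 : ((l : ℝ)) * x ^ (l - 1) * x = l * x ^ l := by
    rcases l with _ | l
    · simp
    · rw [Nat.add_sub_cancel, pow_succ]; push_cast; ring
  have hc' : ((d + 1 + l).choose (d + 1) : ℝ) * (d + 1) = ((d + 1 + l).choose d : ℝ) * (l + 1) := by
    rw [hc]; ring
  linear_combination r * (1 - x) ^ d * x ^ (l + 1) * hc' -
    ((d + 1 + l).choose (d + 1) : ℝ) * (1 - x) ^ (d + 1) * r * e3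

/-- The integral is the mean time spent in state `d`. Integrating the forward equation, whose
boundary values vanish for positive states, shows that `(n - d)` times this integral does not depend
on `d`; state `0` gives the constant. -/
theorem integral_binEq {r : ℝ} (hr : 0 < r) {n d : ℕ} (hd : d < n) :
    IntegrableOn (fun t => binEq (Real.exp (-(r * t))) n d) (Ioi 0) ∧
      ∫ t in Ioi 0, binEq (Real.exp (-(r * t))) n d = 1 / (r * (n - d : ℝ)) := by
  have hint : ∀ d, d < n → IntegrableOn (fun t => binEq (Real.exp (-(r * t))) n d) (Ioi 0) := by
    intro d hd
    refine Integrable.mono' ((exp_neg_integrableOn_Ioi 0 hr).const_mul (n.choose d : ℝ))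
      (by unfold binEq; fun_prop) ((ae_restrict_iff' measurableSet_Ioi).2
        (ae_of_all _ fun t ht => ?_))
    have hq0 : 0 ≤ Real.exp (-(r * t)) := (Real.exp_pos _).le
    have hq1 : Real.exp (-(r * t)) ≤ 1 :=
      Real.exp_le_one_iff.2 (by have := mul_pos hr ht; linarith)
    rw [Real.norm_of_nonneg (binEq_nonneg hq0 hq1 _ _), binEq, mul_assoc, neg_mul]
    refine mul_le_mul_of_nonneg_left ?_ (by positivity)
    obtain ⟨l, hl⟩ := Nat.exists_eq_add_of_lt hd
    rw [show n - d = l + 1 by omega, pow_succ, ← mul_assoc]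
    refine mul_le_of_le_one_left hq0 ?_
    exact mul_le_one₀ (pow_le_one₀ (by linarith) (by linarith)) (by positivity)
      (pow_le_one₀ hq0 hq1)
  have hexp : Tendsto (fun t : ℝ => Real.exp (-(r * t))) atTop (𝓝 0) :=
    Real.tendsto_exp_neg_atTop_nhds_zero.comp (tendsto_id.const_mul_atTop hr)
  have hlim : ∀ d, d < n → Tendsto (fun t => binEq (Real.exp (-(r * t))) n d) atTop (𝓝 0) := by
    intro d hd
    unfold binEq
    have := (((tendsto_const_nhds (x := (1 : ℝ))).sub hexp).pow d).const_mul (n.choose d : ℝ)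
      |>.mul (hexp.pow (n - d))
    simpa [show n - d ≠ 0 by omega] using this
  refine ⟨hint d hd, ?_⟩
  induction d with
  | zero =>
    have hn : (0 : ℝ) < n := by exact_mod_cast hd
    have h1 := integral_Ioi_of_hasDerivAt_of_tendsto' (a := 0)
      (fun t _ => hasDerivAt_binEq_zero r n t) ((hint 0 hd).const_mul (r * n)).neg (hlim 0 hd)
    rw [integral_neg, integral_const_mul] at h1
    simp only [mul_zero, neg_zero, Real.exp_zero, zero_sub, neg_inj] at h1
    rw [show binEq 1 n 0 = 1 by simp [binEq]] at h1
    simp only [Nat.cast_zero, sub_zero]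
    field_simp
    linarith
  | succ d ih =>
    have hd' : d < n := by omega
    have hn : (0 : ℝ) < (n : ℝ) - d := by
      have : (d : ℝ) < n := by exact_mod_cast hd'
      linarith
    have hn2 : (0 : ℝ) < (n : ℝ) - (d + 1) := by
      have : ((d + 1 : ℕ) : ℝ) < n := by exact_mod_cast hd
      push_cast at this
      linarith
    have i1 := (hint d hd').const_mul ((n : ℝ) - d)
    have i2 := (hint (d + 1) hd).const_mul ((n : ℝ) - (d + 1))
    have h1 := integral_Ioi_of_hasDerivAt_of_tendsto' (a := 0)
      (fun t _ => hasDerivAt_binEq_succ r hd' t) ((i1.sub i2).const_mul r) (hlim (d + 1) hd)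
    rw [integral_const_mul, integral_sub i1 i2, integral_const_mul, integral_const_mul,
      ih hd'] at h1
    simp only [mul_zero, neg_zero, Real.exp_zero, zero_sub] at h1
    rw [show binEq 1 n (d + 1) = 0 by simp [binEq]] at h1
    push_cast
    field_simp at h1 ⊢
    linarith

/-- This is the mean of the `k`-th order statistic of `n` exponential times, the sum of the mean
times spent in the states below `k`. -/
theorem lintegral_binLt {r : ℝ} (hr : 0 < r) {n k : ℕ} (hk : k ≤ n) :
    ∫⁻ t in Ioi 0, ENNReal.ofReal (binLt (Real.exp (-(r * t))) n k) =
      ENNReal.ofReal (∑ d ∈ Finset.range k, 1 / (r * (n - d : ℝ))) := by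
  have hi : ∀ d ∈ Finset.range k, IntegrableOn (fun t => binEq (Real.exp (-(r * t))) n d) (Ioi 0) :=
    fun d hd => (integral_binEq hr ((Finset.mem_range.1 hd).trans_le hk)).1
  rw [← ofReal_integral_eq_lintegral_ofReal]
  · unfold binLt
    rw [integral_finsetSum _ hi]
    congr 1
    exact Finset.sum_congr rfl fun d hd =>
      (integral_binEq hr ((Finset.mem_range.1 hd).trans_le hk)).2
  · unfold binLt
    exact integrable_finsetSum _ hi
  · refine (ae_restrict_iff' measurableSet_Ioi).2 (ae_of_all _ fun t ht => ?_)
    exact binLt_nonneg (Real.exp_pos _).le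
      (Real.exp_le_one_iff.2 (by have := mul_pos hr ht; linarith)) _ _

end Binomial

/-! ### Bounds for the mean lag by integrals over the age of a version. -/

section Window

variable {E : Type*} [MeasurableSpace E] {I : Type*} [Fintype I]
  [Countable E] [MeasurableSingletonClass E] {dec : E → Set I → Prop}
  {lamS r : ℝ} {ν : Measure E} [IsProbabilityMeasure ν]

/-- The probability that a version cannot be decoded `t` time units after its creation. -/
noncomputable def failProb (dec : E → Set I → Prop) (r : ℝ) (ν : Measure E) (t : ℝ) : ℝ≥0∞ :=
  (ν.prod (Measure.pi fun _ : I => expMeasure r)) {q | ¬ dec q.1 {i | q.2 i ≤ t}}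

theorem measurableSet_fail (dec : E → Set I → Prop) :
    MeasurableSet {q : ℝ × E × (I → ℝ) | ¬ dec q.2.1 {i | q.2.2 i ≤ q.1}} :=
  measurableSet_setOfPred.2 (measurable_dec_le dec (e := fun q : ℝ × E × (I → ℝ) => q.2.1)
    (by fun_prop) (B := fun q : ℝ × E × (I → ℝ) => q.2.2) (by fun_prop)
    (t := fun q : ℝ × E × (I → ℝ) => q.1) (by fun_prop)).not

omit [IsProbabilityMeasure ν] in
theorem measurable_failProb (dec : E → Set I → Prop) (hr : 0 < r) :
    Measurable (failProb dec r ν) := by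
  have hP := isProbabilityMeasure_expMeasure hr
  exact measurable_measure_prodMk_left (measurableSet_fail dec)

theorem measure_static_eq (hS : 0 < lamS) (hr : 0 < r) {v u : ℝ} (hvu : v ≤ u) (p : ℕ) :
    statLaw I lamS r ν {q | psum q.1.1 (p + 1) ≤ v ∧ psum q.1.1 (p + 1) ≤ u ∧
        ¬ dec (q.1.2 p) {i | q.2 i ≤ u - psum q.1.1 (p + 1)}} =
      ∫⁻ x, {x | psum x (p + 1) ≤ v}.indicator (fun x => failProb dec r ν (u - psum x (p + 1))) x
        ∂(Measure.infinitePi fun _ : ℕ => expMeasure lamS) := by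
  have hP1 := isProbabilityMeasure_expMeasure hS
  have hP2 := isProbabilityMeasure_expMeasure hr
  have mp := ((MeasurePreserving.id (Measure.infinitePi fun _ : ℕ => expMeasure lamS)).prod
    ((measurePreserving_eval_infinitePi (fun _ : ℕ => ν) p).prod
      (MeasurePreserving.id (Measure.pi fun _ : I => expMeasure r)))).comp
    (measurePreserving_prodAssoc (Measure.infinitePi fun _ : ℕ => expMeasure lamS)
      (Measure.infinitePi fun _ : ℕ => ν) (Measure.pi fun _ : I => expMeasure r))
  have h1 : Measurable fun x : ℕ → ℝ => psum x (p + 1) := measurable_psum (p + 1)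
  have hs : MeasurableSet {q : (ℕ → ℝ) × E × (I → ℝ) | psum q.1 (p + 1) ≤ v ∧
      ¬ dec q.2.1 {i | q.2.2 i ≤ u - psum q.1 (p + 1)}} :=
    MeasurableSet.inter (measurableSet_le (h1.comp measurable_fst) measurable_const)
      ((measurable_const.sub (h1.comp measurable_fst)).prodMk measurable_snd (measurableSet_fail dec))
  have h2 := mp.measure_preimage hs.nullMeasurableSet
  refine Eq.trans ?_ (h2.trans ?_)
  · congr 1
    ext q
    exact and_congr_right fun h => ⟨fun h' => h'.2, fun h' => ⟨h.trans hvu, h'⟩⟩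
  · rw [Measure.prod_apply hs]
    refine lintegral_congr fun x => ?_
    by_cases hx : psum x (p + 1) ≤ v
    · rw [indicator_of_mem (by exact hx), failProb]
      congr 1
      ext q
      exact and_iff_right hx
    · rw [indicator_of_notMem (by exact hx)]
      refine measure_mono_null (t := ∅) (fun q hq => hx hq.1) measure_empty

/-- Restart the system at `v - u`: the future contributes the mean lag at `u`. Versions created
before are counted when undecodable at `v`, where their ages fill `[u, v)`, and Campbell's formula
integrates over these ages. -/
theorem meanLag_le_add (hS : 0 < lamS) (hr : 0 < r) {u v : ℝ} (hu : 0 ≤ u) (huv : u ≤ v) :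
    meanLag dec lamS r ν v ≤ meanLag dec lamS r ν u +
      ENNReal.ofReal lamS * ∫⁻ t in Ico u v, failProb dec r ν t := by
  classical
  have hP := isProbabilityMeasure_sysLaw (I := I) hS hr ν
  have h0 : 0 ≤ v - u := sub_nonneg.2 huv
  have hm : ∀ p, MeasurableSet
      {ω : Sys E I | born ω p ≤ v - u ∧ born ω p ≤ v ∧ Undec dec ω p v} := fun p =>
    measurableSet_setOfPred.2 (((measurable_born_le p).comp (g := fun q : Sys E I × ℝ => _)
      ((measurable_id (α := Sys E I)).prodMk (measurable_const (a := v - u)))).and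
      (((measurable_born_le p).comp
      ((measurable_id (α := Sys E I)).prodMk (measurable_const (a := v)))).and
      ((measurable_undec dec p).comp
      ((measurable_id (α := Sys E I)).prodMk (measurable_const (a := v))))))
  have h1 : meanLag dec lamS r ν v ≤ ∫⁻ ω, (lag dec (fut (v - u) ω) u +
      ∑' p, {ω : Sys E I | born ω p ≤ v - u ∧ born ω p ≤ v ∧ Undec dec ω p v}.indicator
        (1 : Sys E I → ℝ≥0∞) ω) ∂(sysLaw I lamS r ν) := by
    refine lintegral_mono_ae ?_
    filter_upwards [ae_goodSys hS hr ν] with ω hω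
    refine (hω.lag_le_fut_add_undec h0 v).trans (le_of_eq ?_)
    rw [sub_sub_cancel]
    congr 1
    refine tsum_congr fun p => ?_
    simp only [indicator, mem_ofPred_eq, Pi.one_apply]
    refine if_congr (and_congr_right fun _ => and_comm) rfl rfl
  refine h1.trans (le_of_eq ?_)
  have e₀ : E := (nonempty_of_isProbabilityMeasure ν).some
  rw [lintegral_add_left (by exact (measurable_lag dec u).comp (splits_sysLaw hS hr ν e₀ h0).2.1),
    lintegral_lag_fut hS hr h0,
    lintegral_tsum fun p => (measurable_one.indicator (hm p)).aemeasurable]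
  congr 1
  rw [← tsum_lintegral_window hS (measurable_failProb dec hr) u v]
  refine tsum_congr fun p => ?_
  rw [lintegral_indicator_one (hm p), measure_undec_eq hS hr (hu.trans huv) (v - u) p,
    measure_static_eq hS hr (by linarith) p]

theorem meanLag_zero (hS : 0 < lamS) (hr : 0 < r) : meanLag dec lamS r ν 0 = 0 := by
  unfold meanLag
  rw [lintegral_eq_zero_iff (measurable_lag dec 0)]
  filter_upwards [ae_goodSys hS hr ν] with ω hω
  unfold lag
  simp only [Pi.zero_apply, ENNReal.tsum_eq_zero]
  intro p
  exact if_neg fun h => absurd h.1 (not_le.2 (hω.1.psum_succ_pos p))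

/-- Later versions have been heard on fewer edges. If `dec'` fails for version `p + 1`, the
hypothesis excludes `dec` for it and all later ones whatever their marks, so the version is stale.
The lag is at least the number of such versions. -/
theorem le_meanLag (hS : 0 < lamS) (hr : 0 < r) {u : ℝ} (hu : 0 ≤ u) {dec' : E → Set I → Prop}
    (h : ∀ e e' A A', A ⊆ A' → dec e A → dec' e' A') :
    ENNReal.ofReal lamS * ∫⁻ t in Ico 0 u, failProb dec' r ν t ≤ meanLag dec lamS r ν u := by
  have hP1 := isProbabilityMeasure_expMeasure hS
  have hP2 := isProbabilityMeasure_expMeasure hr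
  rw [meanLag_eq_tsum hS hr hu, ← tsum_lintegral_window hS (measurable_failProb dec' hr) 0 u]
  refine ENNReal.tsum_le_tsum fun p => ?_
  rw [← measure_static_eq hS hr (by linarith) p]
  refine measure_mono_ae ?_
  have hg : ∀ᵐ q ∂(statLaw I lamS r ν), Good q.1.1 :=
    measurePreserving_fst.quasiMeasurePreserving.ae (ae_good_mLaw hS ν)
  filter_upwards [hg] with q hq
  rintro ⟨_, h1, h2⟩
  refine ⟨h1, fun n hn _ h3 => h2 (h _ _ _ _ (fun i hi => ?_) h3)⟩
  have := hq.strictMono.monotone (Nat.succ_le_succ hn)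
  have h4 : q.2 i ≤ u - psum q.1.1 (n + 1) := hi
  exact h4.trans (by simp only [Nat.succ_eq_add_one] at this; linarith)

end Window

/-! ### Explicit bounds for the age of a node. -/

section NodeBounds

variable {m : ℕ}

-- If `j` is not a key holder it needs `k + 1` of `n` foreign keys. If it is, it needs only `k` of
-- `n - 1`, and that case is dominated by the first through `binLt_le_succ_succ`.
open Classical in
theorem failProb_decodes_le {k n : ℕ} {S : Finset (Fin m)} {r t : ℝ} (hr : 0 < r) (ht : 0 ≤ t)
    (hS : S.card ≤ n) (hn : n ≤ m) (hk : k < n) (j : Fin m) :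
    failProb (decodes k S j) r (markLaw n S) t ≤
      ENNReal.ofReal (binLt (Real.exp (-(r * t))) n (k + 1)) := by
  have hP := isProbabilityMeasure_expMeasure hr
  have hP3 := isProbabilityMeasure_markLaw S hn
  have hq0 : 0 ≤ Real.exp (-(r * t)) := (Real.exp_pos _).le
  have hq1 : Real.exp (-(r * t)) ≤ 1 :=
    Real.exp_le_one_iff.2 (by have := mul_nonneg hr.le ht; linarith)
  have hms : MeasurableSet {q : Finset (Fin m) × ({i : Fin m // i ≠ j} → ℝ) |
      ¬ decodes k S j q.1 {i | q.2 i ≤ t}} :=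
    (measurable_const.prodMk measurable_id) (measurableSet_fail (decodes k S j))
  rw [failProb, Measure.prod_apply hms]
  refine le_trans (lintegral_mono_ae (g := fun _ =>
    ENNReal.ofReal (binLt (Real.exp (-(r * t))) n (k + 1))) ?_) (by simp)
  have h2 : ∀ᵐ e ∂(markLaw n S),
      e ∈ (Finset.powersetCard (n - S.card) Sᶜ : Set (Finset (Fin m))) :=
    ProbabilityTheory.ae_cond_mem (Finset.measurableSet _)
  filter_upwards [h2] with e he
  obtain ⟨he1, he2⟩ := Finset.mem_powersetCard.1 (Finset.mem_coe.1 he)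
  set T : Finset {i : Fin m // i ≠ j} := Finset.univ.filter fun i => i.1 ∈ S ∪ e with hT
  have hdisj : Disjoint S e := Finset.disjoint_left.2 fun i hi hie =>
    Finset.mem_compl.1 (he1 hie) hi
  have hcard : (S ∪ e).card = n := by
    rw [Finset.card_union_of_disjoint hdisj, he2]; omega
  have hTc : T.card = ((S ∪ e).erase j).card := by
    refine Finset.card_bij (fun i _ => i.1) (fun i hi => ?_) (fun a _ b _ h => Subtype.ext h)
      (fun i hi => ?_)
    · exact Finset.mem_erase.2 ⟨i.2, (Finset.mem_filter.1 hi).2⟩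
    · exact ⟨⟨i, (Finset.mem_erase.1 hi).1⟩, by simpa [hT] using (Finset.mem_erase.1 hi).2, rfl⟩
  have hheld : ∀ B : {i : Fin m // i ≠ j} → ℝ, (held S j e {i | B i ≤ t}).ncard =
      (T.filter fun i => B i ≤ t).card + if j ∈ S ∪ e then 1 else 0 := by
    intro B
    have e1 : held S j e {i | B i ≤ t} = ((((T.filter fun i => B i ≤ t).map
        (Function.Embedding.subtype _)) ∪ if j ∈ S ∪ e then {j} else ∅ : Finset (Fin m)) :
          Set (Fin m)) := by
      ext i
      by_cases hij : i = j
      · subst hij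
        by_cases hi : i ∈ S ∪ e <;> simp [held, hi] <;> simpa using hi
      · have : i ∉ (if j ∈ S ∨ j ∈ e then {j} else ∅ : Finset (Fin m)) := by
          split_ifs <;> simp [hij]
        simp [held, hij, hT, this]
    rw [e1, ncard_coe_finset, Finset.card_union_of_disjoint, Finset.card_map]
    · congr 1
      split_ifs <;> simp
    · refine Finset.disjoint_left.2 fun i hi => ?_
      obtain ⟨a, _, rfl⟩ := Finset.mem_map.1 hi
      split_ifs
      · simpa using a.2
      · simp
  have hset : Prod.mk e ⁻¹' {q : Finset (Fin m) × ({i : Fin m // i ≠ j} → ℝ) |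
      ¬ decodes k S j q.1 {i | q.2 i ≤ t}} =
      {B | (T.filter fun i => B i ≤ t).card + (if j ∈ S ∪ e then 1 else 0) < k + 1} := by
    ext B
    simp only [mem_preimage, mem_ofPred_eq, decodes, hheld B, not_le]
  rw [hset]
  by_cases hj : j ∈ S ∪ e
  · simp only [hj, if_true, Nat.add_lt_add_iff_right]
    rw [measure_count_lt hr ht T k, hTc, Finset.card_erase_of_mem hj, hcard]
    refine ENNReal.ofReal_le_ofReal ?_
    obtain ⟨n', rfl⟩ := Nat.exists_eq_succ_of_ne_zero (show n ≠ 0 by omega)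
    exact binLt_le_succ_succ hq0 hq1 n' k
  · simp only [hj, if_false, add_zero]
    rw [measure_count_lt hr ht T (k + 1), hTc, Finset.erase_eq_of_notMem hj, hcard]

open Classical in
theorem le_failProb_ncard {k n : ℕ} {S : Finset (Fin m)} {r t : ℝ} (hr : 0 < r) (ht : 0 ≤ t)
    (hn : n ≤ m) (j : Fin m) :
    failProb (fun (_ : Finset (Fin m)) (A : Set {i : Fin m // i ≠ j}) => k ≤ A.ncard) r
      (markLaw n S) t = ENNReal.ofReal (binLt (Real.exp (-(r * t))) (m - 1) k) := by
  have hP := isProbabilityMeasure_expMeasure hr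
  have hP3 := isProbabilityMeasure_markLaw S hn
  have h := measure_count_lt hr ht (Finset.univ : Finset {i : Fin m // i ≠ j}) k
  rw [Finset.card_univ, Fintype.card_subtype_compl, Fintype.card_subtype_eq,
    Fintype.card_fin] at h
  rw [failProb, ← h]
  have : {q : Finset (Fin m) × ({i : Fin m // i ≠ j} → ℝ) | ¬ k ≤ {i | q.2 i ≤ t}.ncard} =
      univ ×ˢ {B | (Finset.univ.filter fun i => B i ≤ t).card < k} := by
    ext q
    have : {i | q.2 i ≤ t}.ncard = (Finset.univ.filter fun i => q.2 i ≤ t).card := by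
      rw [← ncard_coe_finset]; simp
    simp [this]
  rw [this, Measure.prod_prod, measure_univ, one_mul]

/-- At most one of the keys is the node's own; all others came over distinct edges. -/
theorem subset_decodes {k : ℕ} {S : Finset (Fin m)} {j : Fin m} {e : Finset (Fin m)}
    {A A' : Set {i : Fin m // i ≠ j}} (h : A ⊆ A') (hd : decodes k S j e A) : k ≤ A'.ncard := by
  classical
  have h1 : held S j e A ⊆ insert j (Subtype.val '' A') := by
    rintro i ⟨_, h2 | ⟨h2, h3⟩⟩
    · exact Or.inl h2
    · exact Or.inr ⟨_, h h3, rfl⟩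
  have h2 := ncard_le_ncard h1 (toFinite _)
  have h3 := ncard_insert_le j (Subtype.val '' A')
  rw [ncard_image_of_injective _ Subtype.val_injective] at h3
  have h4 : k + 1 ≤ (held S j e A).ncard := hd
  omega

/-- An upper bound for the mean lag that is accumulated `t` time units later. -/
noncomputable def lagTail (k n : ℕ) (r u : ℝ) : ℝ≥0∞ :=
  ∫⁻ t in Ici u, ENNReal.ofReal (binLt (Real.exp (-(r * t))) n (k + 1))

variable {k n : ℕ} {S : Finset (Fin m)} {lamS lamE : ℝ}

theorem nodeAge_le_add (hk : k < n) (hS : S.card ≤ n) (hn : n ≤ m)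
    (hlamS : 0 < lamS) (hlamE : 0 < lamE) (j : Fin m) {u : ℝ} (hu : 0 ≤ u) :
    nodeAge k n S lamS lamE j ≤
      meanLag (decodes k S j) lamS (edgeRate lamE m) (markLaw n S) u +
        ENNReal.ofReal lamS * lagTail k n (edgeRate lamE m) u := by
  have p3 := isProbabilityMeasure_markLaw S hn
  have hr := edgeRate_pos hlamE m
  refine iSup_le fun v => ?_
  rcases le_total v u with h | h
  · exact (meanLag_mono hlamS hr h).trans le_self_add
  · refine (meanLag_le_add hlamS hr hu h).trans (add_le_add_right ?_ _)
    refine mul_le_mul_right ?_ _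
    refine (lintegral_mono_set Ico_subset_Ici_self).trans ?_
    refine setLIntegral_mono' measurableSet_Ici fun t ht => ?_
    exact failProb_decodes_le hr (hu.trans ht) hS hn hk j

/-- The case `u = 0` of `nodeAge_le_add`, where the mean lag vanishes and the tail is the full mean
of an order statistic. -/
theorem nodeAge_le (hk : k < n) (hS : S.card ≤ n) (hn : n ≤ m)
    (hlamS : 0 < lamS) (hlamE : 0 < lamE) (j : Fin m) :
    nodeAge k n S lamS lamE j ≤
      ENNReal.ofReal (lamS * ∑ d ∈ Finset.range (k + 1), 1 / (edgeRate lamE m * (n - d : ℝ))) := by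
  have p3 := isProbabilityMeasure_markLaw S hn
  have hr := edgeRate_pos hlamE m
  refine (nodeAge_le_add hk hS hn hlamS hlamE j le_rfl).trans ?_
  rw [meanLag_zero hlamS hr, zero_add, lagTail, setLIntegral_congr Ioi_ae_eq_Ici.symm,
    lintegral_binLt hr (Nat.succ_le_of_lt hk), ENNReal.ofReal_mul hlamS.le]

theorem le_nodeAge (hk : k < n) (hn : n ≤ m)
    (hlamS : 0 < lamS) (hlamE : 0 < lamE) (j : Fin m) :
    ENNReal.ofReal (lamS * ∑ d ∈ Finset.range k, 1 / (edgeRate lamE m * ((m - 1 : ℕ) - d : ℝ))) ≤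
      nodeAge k n S lamS lamE j := by
  have p3 := isProbabilityMeasure_markLaw S hn
  have hr := edgeRate_pos hlamE m
  rw [ENNReal.ofReal_mul hlamS.le, ← lintegral_binLt hr (show k ≤ m - 1 by omega),
    setLIntegral_congr Ioi_ae_eq_Ici]
  -- The lower bound holds on each window `[0, N)`; monotone convergence extends it to the
  -- half-line.
  have hU : (⋃ N : ℕ, Ico (0 : ℝ) N) = Ici 0 := by
    ext t
    simp only [mem_iUnion, mem_Ico, mem_Ici, exists_and_left, and_iff_left_iff_imp]
    exact fun _ => exists_nat_gt t
  rw [← hU, setLIntegral_iUnion_of_directed _ (Monotone.directed_le fun a b hab =>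
      Ico_subset_Ico_right (by exact_mod_cast hab)), ENNReal.mul_iSup]
  refine iSup_le fun N => le_trans ?_ (le_iSup _ (N : ℝ))
  refine le_trans (le_of_eq ?_) (le_meanLag hlamS hr (Nat.cast_nonneg N)
    (dec' := fun (_ : Finset (Fin m)) (A : Set {i : Fin m // i ≠ j}) => k ≤ A.ncard)
    fun e e' A A' h hd => subset_decodes h hd)
  congr 1
  exact setLIntegral_congr_fun measurableSet_Ico fun t ht =>
    (le_failProb_ncard hr ht.1 hn j).symm

end NodeBounds

/-! ### Hypergeometric probabilities and their limits. -/

section Hypergeometric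

/-- The probability that a given element lies in a uniformly random `K`-subset of an `N`-set. -/
noncomputable def inclProb (N K : ℕ) : ℝ := if N ≤ K then 1 else K / N

/-- The probability that a uniformly random `K`-subset of an `N`-set meets a given `b`-subset in at
most `k - a` elements. -/
noncomputable def hyp (k : ℕ) : ℕ → ℕ → ℕ → ℕ → ℝ
  | 0, _, _, a => if a ≤ k then 1 else 0
  | b + 1, N, K, a => inclProb N K * hyp k b (N - 1) (K - 1) (a + 1) +
      (1 - inclProb N K) * hyp k b (N - 1) K a

theorem inclProb_mem (N K : ℕ) : 0 ≤ inclProb N K ∧ inclProb N K ≤ 1 := by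
  unfold inclProb
  split_ifs with h
  · simp
  · refine ⟨by positivity, div_le_one_of_le₀ ?_ (by positivity)⟩
    exact_mod_cast (not_le.1 h).le

theorem hyp_mem (k b : ℕ) : ∀ N K a, 0 ≤ hyp k b N K a ∧ hyp k b N K a ≤ 1 := by
  induction b with
  | zero => intro N K a; unfold hyp; split_ifs <;> simp
  | succ b ih =>
    intro N K a
    obtain ⟨h1, h2⟩ := inclProb_mem N K
    obtain ⟨h3, h4⟩ := ih (N - 1) (K - 1) (a + 1)
    obtain ⟨h5, h6⟩ := ih (N - 1) K a
    have h7 : 0 ≤ 1 - inclProb N K := by linarith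
    unfold hyp
    constructor
    · positivity
    · nlinarith

/-- Remove an element `d` of `D` from the ground set: the subsets that contain `d` and those that do
not give the two terms of the recursion of `hyp`, with `a` counting the hits already made. -/
theorem card_filter_inter_le {α : Type*} [DecidableEq α] (k : ℕ) (D : Finset α) :
    ∀ (W : Finset α) (K a : ℕ), D ⊆ W →
      ((((Finset.powersetCard K W).filter fun e => a + (e ∩ D).card ≤ k).card : ℕ) : ℝ) =
        hyp k D.card W.card K a * W.card.choose K := by
  induction D using Finset.induction_on with
  | empty =>
    intro W K a _
    by_cases h : a ≤ k <;> simp [hyp, h]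
  | insert d D hd ih =>
    intro W K a hDW
    have hdW : d ∈ W := hDW (Finset.mem_insert_self d D)
    obtain ⟨W', hdW', rfl⟩ : ∃ W', d ∉ W' ∧ W = insert d W' :=
      ⟨W.erase d, Finset.notMem_erase d W, (Finset.insert_erase hdW).symm⟩
    have hDW' : D ⊆ W' := fun x hx => by
      rcases Finset.mem_insert.1 (hDW (Finset.mem_insert_of_mem hx)) with h | h
      · exact absurd (h ▸ hx) hd
      · exact h
    have hout : ∀ K, ((Finset.powersetCard K W').filter fun e => a + (e ∩ insert d D).card ≤ k) =
        (Finset.powersetCard K W').filter fun e => a + (e ∩ D).card ≤ k := by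
      intro K
      refine Finset.filter_congr fun e he => ?_
      have hde : d ∉ e := fun h => hdW' ((Finset.mem_powersetCard.1 he).1 h)
      rw [Finset.inter_insert_of_notMem hde]
    rw [Finset.card_insert_of_notMem hd, Finset.card_insert_of_notMem hdW']
    rcases K with _ | K
    · have := ih W' 0 a hDW'
      rw [← hout 0] at this
      simp only [Finset.powersetCard_zero, Nat.choose_zero_right] at this ⊢
      rw [this]
      simp [hyp, inclProb]
    · rw [Finset.powersetCard_succ_insert hdW', Finset.filter_union, Finset.card_union_of_disjoint,
        hout (K + 1), Finset.filter_image, Finset.card_image_of_injOn]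
      · have hin : ((Finset.powersetCard K W').filter
            fun e => a + (insert d e ∩ insert d D).card ≤ k) =
            (Finset.powersetCard K W').filter fun e => (a + 1) + (e ∩ D).card ≤ k := by
          refine Finset.filter_congr fun e he => ?_
          have hde : d ∉ e := fun h => hdW' ((Finset.mem_powersetCard.1 he).1 h)
          rw [← Finset.insert_inter_distrib, Finset.card_insert_of_notMem
            (fun h => hde (Finset.mem_inter.1 h).1)]
          omega
        rw [hin]
        push_cast
        rw [ih W' (K + 1) a hDW', ih W' K (a + 1) hDW', hyp, Nat.add_sub_cancel, Nat.add_sub_cancel]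
        set N := W'.card
        -- If `N < K` both binomial coefficients vanish, so the value `1` of `inclProb` does no harm
        -- there; if `N = K` it is the true probability.
        have e1 : inclProb (N + 1) (K + 1) * ((N + 1).choose (K + 1) : ℝ) = N.choose K := by
          unfold inclProb
          split_ifs with h
          · rcases Nat.lt_or_ge N K with h2 | h2
            · rw [Nat.choose_eq_zero_of_lt h2, Nat.choose_eq_zero_of_lt (by omega)]; simp
            · obtain rfl : N = K := by omega
              simp
          · have h3 : ((N + 1 : ℕ) : ℝ) * N.choose K = (N + 1).choose (K + 1) * (K + 1 : ℕ) := by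
              exact_mod_cast Nat.add_one_mul_choose_eq N K
            have h4 : ((N + 1 : ℕ) : ℝ) ≠ 0 := by positivity
            field_simp
            linarith
        have e2 : ((N + 1).choose (K + 1) : ℝ) = N.choose K + N.choose (K + 1) := by
          exact_mod_cast Nat.choose_succ_succ N K
        linear_combination (hyp k D.card N (K + 1) a - hyp k D.card N K (a + 1)) * e1 -
          hyp k D.card N (K + 1) a * e2
      · intro e he e' he' h
        have hde : d ∉ e := fun h => hdW'
          ((Finset.mem_powersetCard.1 (Finset.mem_filter.1 he).1).1 h)
        have hde' : d ∉ e' := fun h => hdW'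
          ((Finset.mem_powersetCard.1 (Finset.mem_filter.1 he').1).1 h)
        rw [← Finset.erase_insert hde, ← Finset.erase_insert hde']
        exact congrArg (fun x => Finset.erase x d) h
      · refine Finset.disjoint_left.2 fun e he he' => ?_
        obtain ⟨f, _, rfl⟩ := Finset.mem_image.1 (Finset.mem_filter.1 he').1
        exact hdW' ((Finset.mem_powersetCard.1 (Finset.mem_filter.1 he).1).1
          (Finset.mem_insert_self d f))

theorem tendsto_div_of_bounded_shift {l : Filter ℕ} {x y x' y' : ℕ → ℝ} {C θ : ℝ}
    (hy : Tendsto y l atTop) (h : Tendsto (fun m => x m / y m) l (𝓝 θ))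
    (hx' : ∀ m, |x' m - x m| ≤ C) (hy' : ∀ m, |y' m - y m| ≤ C) :
    Tendsto (fun m => x' m / y' m) l (𝓝 θ) := by
  have h1 : Tendsto (fun m => (x' m - x m) / y m) l (𝓝 0) :=
    tendsto_bdd_div_atTop_nhds_zero (b := -C) (B := C)
      (Eventually.of_forall fun m => (abs_le.1 (hx' m)).1)
      (Eventually.of_forall fun m => (abs_le.1 (hx' m)).2) hy
  have h2 : Tendsto (fun m => (y' m - y m) / y m) l (𝓝 0) :=
    tendsto_bdd_div_atTop_nhds_zero (b := -C) (B := C)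
      (Eventually.of_forall fun m => (abs_le.1 (hy' m)).1)
      (Eventually.of_forall fun m => (abs_le.1 (hy' m)).2) hy
  have h3 := (h.add h1).div (tendsto_const_nhds.add h2) (by norm_num : (1 : ℝ) + 0 ≠ 0)
  simp only [add_zero, div_one] at h3
  refine h3.congr' ?_
  filter_upwards [hy.eventually_gt_atTop 0] with m hm
  rw [Pi.div_apply, ← add_div, add_sub_cancel, one_add_div hm.ne', add_sub_cancel, div_div_div_cancel_right₀ hm.ne']

/-- Here every element is chosen. The case is needed separately for `α = 1`, where the number of
nonsubscribers need not tend to infinity. -/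
theorem tendsto_hyp_of_le {l : Filter ℕ} (k b : ℕ) : ∀ (N K : ℕ → ℕ) (a : ℕ),
    (∀ᶠ m in l, N m ≤ K m) → ∃ θ, Tendsto (fun m => hyp k b (N m) (K m) a) l (𝓝 θ) := by
  induction b with
  | zero => exact fun N K a _ => ⟨_, tendsto_const_nhds⟩
  | succ b ih =>
    intro N K a h
    obtain ⟨θ, hθ⟩ := ih (fun m => N m - 1) (fun m => K m - 1) (a + 1)
      (h.mono fun m hm => Nat.sub_le_sub_right hm 1)
    refine ⟨θ, hθ.congr' ?_⟩
    filter_upwards [h] with m hm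
    simp [hyp, inclProb, hm]

/-- The recursion lowers both parameters, so bounded shifts `i` and `j` are carried along. They do
not change the limit of `K / N`, and the inclusion probabilities converge to `min 1 ρ`. -/
theorem tendsto_hyp_of_div {l : Filter ℕ} {N K : ℕ → ℕ} {ρ : ℝ} (hN : Tendsto N l atTop)
    (h : Tendsto (fun m => (K m : ℝ) / N m) l (𝓝 ρ)) (k b : ℕ) : ∀ i j a : ℕ,
    ∃ θ, Tendsto (fun m => hyp k b (N m - i) (K m - j) a) l (𝓝 θ) := by
  induction b with
  | zero => exact fun i j a => ⟨_, tendsto_const_nhds⟩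
  | succ b ih =>
    intro i j a
    obtain ⟨θ₁, h1⟩ := ih (i + 1) (j + 1) (a + 1)
    obtain ⟨θ₂, h2⟩ := ih (i + 1) j a
    have hshift : ∀ (x : ℕ → ℕ) (i' : ℕ), i' ≤ i + j → ∀ m, |((x m - i' : ℕ) : ℝ) - x m| ≤
        ((i + j : ℕ) : ℝ) := by
      intro x i' hi' m
      rw [abs_sub_comm, abs_of_nonneg (sub_nonneg.2 (by exact_mod_cast Nat.sub_le _ _)),
        sub_le_iff_le_add]
      exact_mod_cast (show x m ≤ i + j + (x m - i') by omega)
    have h3 := tendsto_div_of_bounded_shift (tendsto_natCast_atTop_atTop.comp hN) h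
      (hshift K j (by omega)) (hshift N i (by omega))
    have h4 : Tendsto (fun m => inclProb (N m - i) (K m - j)) l (𝓝 (min 1 ρ)) := by
      refine (tendsto_const_nhds.min h3).congr' ?_
      filter_upwards [hN.eventually_gt_atTop i] with m hm
      have hpos : (0 : ℝ) < ((N m - i : ℕ) : ℝ) := by exact_mod_cast (by omega : 0 < N m - i)
      unfold inclProb
      split_ifs with hle
      · refine min_eq_left ((one_le_div hpos).2 ?_)
        exact_mod_cast hle
      · refine min_eq_right ((div_le_one hpos).2 ?_)
        exact_mod_cast (not_le.1 hle).le
    exact ⟨_, (h4.mul h1).add ((tendsto_const_nhds.sub h4).mul h2)⟩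

variable {m : ℕ}

/-- Subscribers in `C` hold a key for certain and form the starting count; the random set matters
only on the nonsubscribers in `C`. -/
theorem markLaw_inter_le {k n : ℕ} {S : Finset (Fin m)} (hS : S.card ≤ n) (hn : n ≤ m)
    (C : Finset (Fin m)) :
    markLaw n S {e | (C ∩ (S ∪ e)).card ≤ k} =
      ENNReal.ofReal (hyp k (C \ S).card (m - S.card) (n - S.card) (C ∩ S).card) := by
  have hW : (Sᶜ).card = m - S.card := by rw [Finset.card_compl, Fintype.card_fin]
  have h := card_filter_inter_le k (C \ S) Sᶜ (n - S.card) (C ∩ S).card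
    (fun x hx => Finset.mem_compl.2 (Finset.mem_sdiff.1 hx).2)
  rw [hW] at h
  set P := Finset.powersetCard (n - S.card) Sᶜ with hP
  have hPc : P.card = (m - S.card).choose (n - S.card) := by
    rw [hP, Finset.card_powersetCard, hW]
  have hpos : 0 < (m - S.card).choose (n - S.card) := Nat.choose_pos (by omega)
  have hinter : (P : Set (Finset (Fin m))) ∩ {e | (C ∩ (S ∪ e)).card ≤ k} =
      (P.filter fun e => (C ∩ S).card + (e ∩ (C \ S)).card ≤ k : Finset (Finset (Fin m))) := by
    ext e
    simp only [mem_inter_iff, Finset.mem_coe, mem_ofPred_eq, Finset.mem_filter]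
    refine and_congr_right fun he => ?_
    have heS := (Finset.mem_powersetCard.1 he).1
    have : C ∩ (S ∪ e) = (C ∩ S) ∪ (e ∩ (C \ S)) := by
      ext x
      have : x ∈ e → x ∉ S := fun hx => Finset.mem_compl.1 (heS hx)
      simp only [Finset.mem_inter, Finset.mem_union, Finset.mem_sdiff]
      tauto
    rw [this, Finset.card_union_of_disjoint]
    refine Finset.disjoint_left.2 fun x hx hx' => ?_
    exact (Finset.mem_sdiff.1 (Finset.mem_inter.1 hx').2).2 (Finset.mem_inter.1 hx).2
  have hu : markLaw n S {e | (C ∩ (S ∪ e)).card ≤ k} =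
      (Measure.count (P : Set (Finset (Fin m))))⁻¹ *
        Measure.count ((P : Set (Finset (Fin m))) ∩ {e | (C ∩ (S ∪ e)).card ≤ k}) :=
    cond_apply (Finset.measurableSet _) _ _
  rw [hu, hinter, Measure.count_apply_finset,
    Measure.count_apply_finset, hPc]
  have h2 : (((P.filter fun e => (C ∩ S).card + (e ∩ (C \ S)).card ≤ k).card : ℕ) : ℝ≥0∞) =
      ENNReal.ofReal (hyp k (C \ S).card (m - S.card) (n - S.card) (C ∩ S).card) *
        (((m - S.card).choose (n - S.card) : ℕ) : ℝ≥0∞) := by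
    rw [← ENNReal.ofReal_natCast, h, ENNReal.ofReal_mul (hyp_mem _ _ _ _ _).1,
      ENNReal.ofReal_natCast]
  rw [h2, mul_comm, mul_assoc, ENNReal.mul_inv_cancel (by exact_mod_cast hpos.ne')
    (ENNReal.natCast_ne_top _), mul_one]

open Classical in
theorem markLaw_not_decodes {k n : ℕ} {S : Finset (Fin m)} (hS : S.card ≤ n) (hn : n ≤ m)
    (j : Fin m) (A : Set {i : Fin m // i ≠ j}) :
    markLaw n S {e | ¬ decodes k S j e A} =
      ENNReal.ofReal (hyp k ((if j ∈ S then 0 else 1) +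
          (Finset.univ.filter fun i : {i : Fin m // i ≠ j} => i.1 ∉ S ∧ i ∈ A).card)
        (m - S.card) (n - S.card) ((if j ∈ S then 1 else 0) +
          (Finset.univ.filter fun i : {i : Fin m // i ≠ j} => i.1 ∈ S ∧ i ∈ A).card)) := by
  set C : Finset (Fin m) := insert j ((Finset.univ.filter fun i => i ∈ A).map
    (Function.Embedding.subtype _)) with hC
  have hcard : ∀ (D : Finset (Fin m)), (C ∩ D).card = (if j ∈ D then 1 else 0) +
      (Finset.univ.filter fun i : {i : Fin m // i ≠ j} => i.1 ∈ D ∧ i ∈ A).card := by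
    intro D
    have e1 : C ∩ D = (if j ∈ D then {j} else ∅) ∪ ((Finset.univ.filter fun
        i : {i : Fin m // i ≠ j} => i.1 ∈ D ∧ i ∈ A).map (Function.Embedding.subtype _)) := by
      ext i
      by_cases hij : i = j
      · subst hij
        by_cases hi : i ∈ D <;> simp [hC, hi]
      · have : i ∉ (if j ∈ D then {j} else ∅ : Finset (Fin m)) := by split_ifs <;> simp [hij]
        simp [hC, hij, this, and_comm]
    rw [e1, Finset.card_union_of_disjoint, Finset.card_map]
    · congr 1
      split_ifs <;> simp
    · refine Finset.disjoint_right.2 fun i hi => ?_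
      obtain ⟨a, _, rfl⟩ := Finset.mem_map.1 hi
      split_ifs
      · simpa using a.2
      · simp
  have h1 : (C \ S).card = (if j ∈ S then 0 else 1) +
      (Finset.univ.filter fun i : {i : Fin m // i ≠ j} => i.1 ∉ S ∧ i ∈ A).card := by
    have := hcard Sᶜ
    simp only [Finset.mem_compl] at this
    rw [Finset.sdiff_eq_inter_compl, this]
    congr 1
    split_ifs <;> simp_all
  rw [← h1, ← hcard S, ← markLaw_inter_le hS hn C]
  congr 1
  ext e
  have : held S j e A = ((C ∩ (S ∪ e) : Finset (Fin m)) : Set (Fin m)) := by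
    ext i
    by_cases hij : i = j
    · subst hij; simp [held, hC]
    · simp [held, hC, hij, and_comm]
  simp only [mem_ofPred_eq, decodes, this, ncard_coe_finset]
  omega

end Hypergeometric

/-! ### Powers of near-identity operators. -/

section Generator

variable {X : Type*} [AddCommMonoid X]

/-- The generator of a random walk on `X` that jumps by `v ∈ V` with rate `w v`. -/
def gen (V : Finset X) (w : X → ℝ) : Module.End ℝ (X → ℝ) where
  toFun f x := ∑ v ∈ V, w v * (f (x + v) - f x)
  map_add' f g := by
    ext x
    simp only [Pi.add_apply, ← Finset.sum_add_distrib]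
    exact Finset.sum_congr rfl fun v _ => by ring
  map_smul' a f := by
    ext x
    simp only [Pi.smul_apply, smul_eq_mul, RingHom.id_apply, Finset.mul_sum]
    exact Finset.sum_congr rfl fun v _ => by ring

theorem gen_apply (V : Finset X) (w : X → ℝ) (f : X → ℝ) (x : X) :
    gen V w f x = ∑ v ∈ V, w v * (f (x + v) - f x) := rfl

theorem abs_gen_pow_le {V : Finset X} {w : X → ℝ} {W C : ℝ} (hw : ∀ v ∈ V, 0 ≤ w v)
    (hW : ∑ v ∈ V, w v ≤ W) {f : X → ℝ} (hf : ∀ x, |f x| ≤ C) (d : ℕ) :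
    ∀ x, |(gen V w ^ d) f x| ≤ (2 * W) ^ d * C := by
  have hW0 : 0 ≤ W := (Finset.sum_nonneg hw).trans hW
  induction d with
  | zero => simpa using hf
  | succ d ih =>
    intro x
    have hC : 0 ≤ (2 * W) ^ d * C := (abs_nonneg _).trans (ih x)
    rw [pow_succ', Module.End.mul_apply, gen_apply]
    refine (Finset.abs_sum_le_sum_abs _ _).trans ?_
    have h1 : ∀ v ∈ V, |w v * ((gen V w ^ d) f (x + v) - (gen V w ^ d) f x)| ≤
        w v * (2 * ((2 * W) ^ d * C)) := by
      intro v hv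
      rw [abs_mul, abs_of_nonneg (hw v hv)]
      refine mul_le_mul_of_nonneg_left ((abs_sub _ _).trans ?_) (hw v hv)
      linarith [ih (x + v), ih x]
    refine (Finset.sum_le_sum h1).trans ?_
    rw [← Finset.sum_mul]
    refine (mul_le_mul_of_nonneg_right hW (by linarith)).trans (le_of_eq ?_)
    ring

theorem exists_tendsto_gen_pow {l : Filter ℕ} {V : Finset X} {w : ℕ → X → ℝ}
    (hw : ∀ v ∈ V, ∃ θ, Tendsto (fun m => w m v) l (𝓝 θ)) {f : ℕ → X → ℝ}
    (hf : ∀ x, ∃ θ, Tendsto (fun m => f m x) l (𝓝 θ)) (d : ℕ) :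
    ∀ x, ∃ θ, Tendsto (fun m => (gen V (w m) ^ d) (f m) x) l (𝓝 θ) := by
  induction d with
  | zero => simpa using hf
  | succ d ih =>
    intro x
    choose! W hW using hw
    choose F hF using ih
    simp_rw [pow_succ', Module.End.mul_apply, gen_apply]
    exact ⟨_, tendsto_finsetSum _ fun v hv => (hW v hv).mul ((hF (x + v)).sub (hF x))⟩

-- The binomial theorem, written as an infinite series whose range does not depend on `s`, so that
-- dominated convergence can be used.
omit [AddCommMonoid X] in
theorem one_add_smul_pow_apply (g : Module.End ℝ (X → ℝ)) (r : ℝ) (s : ℕ) (f : X → ℝ) (x : X) :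
    ((1 + r • g) ^ s) f x = ∑' d, s.choose d * r ^ d * (g ^ d) f x := by
  rw [add_comm, (Commute.one_right (r • g)).add_pow, tsum_eq_sum (s := Finset.range (s + 1))]
  · simp only [LinearMap.sum_apply, Finset.sum_apply, one_pow, mul_one]
    refine Finset.sum_congr rfl fun d _ => ?_
    rw [← nsmul_eq_mul', smul_pow, LinearMap.smul_apply, LinearMap.smul_apply, Pi.smul_apply,
      Pi.smul_apply, nsmul_eq_mul, smul_eq_mul]
    ring
  · intro d hd
    rw [Nat.choose_eq_zero_of_lt (by simpa [Nat.lt_succ_iff] using hd)]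
    simp

/-- Passing from `d` to `d + 1` multiplies by `(s - d) * r / (d + 1)`, which converges because `s *
r` does and `r` tends to zero. -/
theorem exists_tendsto_choose_mul_pow {l : Filter ℕ} {r : ℕ → ℝ} {s : ℕ → ℕ} {c : ℝ}
    (hr : Tendsto r l (𝓝 0)) (hs : Tendsto (fun m => s m * r m) l (𝓝 c)) (d : ℕ) :
    ∃ θ, Tendsto (fun m => ((s m).choose d : ℝ) * r m ^ d) l (𝓝 θ) := by
  induction d with
  | zero => exact ⟨1, by simpa using tendsto_const_nhds⟩
  | succ d ih =>
    obtain ⟨θ, hθ⟩ := ih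
    refine ⟨_, ((hθ.mul (hs.sub (hr.const_mul (d : ℝ)))).div_const (d + 1 : ℝ)).congr fun m => ?_⟩
    have h1 : ((s m).choose (d + 1) : ℝ) * (d + 1) = (s m).choose d * (s m - d) := by
      rcases Nat.lt_or_ge (s m) d with h | h
      · rw [Nat.choose_eq_zero_of_lt h, Nat.choose_eq_zero_of_lt (by omega)]; simp
      · rw [← Nat.cast_sub h]
        exact_mod_cast Nat.choose_succ_right_eq (s m) d
    have h2 : (d : ℝ) + 1 ≠ 0 := by positivity
    rw [div_eq_iff h2]
    linear_combination -(r m ^ (d + 1)) * h1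

/-- Termwise limits in the binomial series. The terms are dominated by those of an exponential
series, since `choose` is at most `s ^ d / d!`, `s * r` is eventually at most `c + 1`, and the
generator has norm at most `2 * W`. -/
theorem exists_tendsto_one_add_pow {l : Filter ℕ} {V : Finset X} {w : ℕ → X → ℝ} {W : ℝ}
    (hw0 : ∀ m, ∀ v ∈ V, 0 ≤ w m v) (hW : ∀ m, ∑ v ∈ V, w m v ≤ W)
    (hw : ∀ v ∈ V, ∃ θ, Tendsto (fun m => w m v) l (𝓝 θ)) {f : ℕ → X → ℝ}
    (hf1 : ∀ m x, |f m x| ≤ 1)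
    (hf : ∀ x, ∃ θ, Tendsto (fun m => f m x) l (𝓝 θ)) {r : ℕ → ℝ} {s : ℕ → ℕ} {c : ℝ}
    (hr0 : ∀ m, 0 ≤ r m) (hr : Tendsto r l (𝓝 0)) (hs : Tendsto (fun m => s m * r m) l (𝓝 c))
    (x : X) :
    ∃ θ, Tendsto (fun m => ((1 + r m • gen V (w m)) ^ s m) (f m) x) l (𝓝 θ) := by
  rcases eq_or_neBot l with rfl | hl
  · exact ⟨0, tendsto_bot⟩
  have hW0 : 0 ≤ W := (Finset.sum_nonneg (hw0 0)).trans (hW 0)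
  choose θ₁ h1 using exists_tendsto_choose_mul_pow hr hs
  choose θ₂ h2 using fun d => exists_tendsto_gen_pow hw hf d x
  simp_rw [one_add_smul_pow_apply]
  refine ⟨_, tendsto_tsum_of_dominated_convergence
    (bound := fun d => ((c + 1) * (2 * W)) ^ d / d.factorial)
    (Real.summable_pow_div_factorial _) (fun d => (h1 d).mul (h2 d)) ?_⟩
  filter_upwards [hs.eventually_le_const (lt_add_one c)] with m hm d
  have h3 := abs_gen_pow_le (hw0 m) (hW m) (hf1 m) d x
  rw [mul_one] at h3
  have h4 : (0 : ℝ) ≤ s m * r m := mul_nonneg (Nat.cast_nonneg _) (hr0 m)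
  rw [Real.norm_eq_abs, abs_mul, abs_of_nonneg (mul_nonneg (Nat.cast_nonneg _)
    (pow_nonneg (hr0 m) d))]
  calc ((s m).choose d : ℝ) * r m ^ d * |(gen V (w m) ^ d) (f m) x|
      ≤ ((s m : ℝ) ^ d / d.factorial) * r m ^ d * (2 * W) ^ d := by
        have := pow_nonneg (hr0 m) d
        have h5 : ((s m).choose d : ℝ) ≤ (s m : ℝ) ^ d / d.factorial := Nat.choose_le_pow_div d (s m)
        gcongr
    _ = (s m * r m) ^ d * (2 * W) ^ d / d.factorial := by rw [mul_pow]; ring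
    _ ≤ ((c + 1) * (2 * W)) ^ d / d.factorial := by
        rw [mul_pow (c + 1)]
        gcongr

end Generator

/-! ### Averages over exponential times and their Poisson limit. -/

section Averaging

variable {X : Type*} [AddCommMonoid X] [MeasurableSpace X] [MeasurableSingletonClass X]
  {δ : ℝ → X}

/-- The mean of `f` after an independent exponential time `b` has moved the point by `δ b`. -/
noncomputable def expAvg (δ : ℝ → X) (r : ℝ) (f : X → ℝ) (x : X) : ℝ :=
  ∫ b, f (x + δ b) ∂(expMeasure r)

-- Sort the integral by the finitely many values of the jump; the jump `0` contributes only to the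
-- identity operator.
open Classical in
theorem expAvg_eq {r : ℝ} (hr : 0 < r) (hδ : Measurable δ) (hfin : (range δ).Finite) (f : X → ℝ) :
    expAvg δ r f = (1 + r • gen (hfin.toFinset.erase 0)
      fun v => (expMeasure r).real {b | δ b = v} / r) f := by
  have hP := isProbabilityMeasure_expMeasure hr
  ext x
  have hm : ∀ v, MeasurableSet {b | δ b = v} := fun v => hδ (measurableSet_singleton v)
  have hsum : ∀ g : X → ℝ, ∫ b, g (δ b) ∂(expMeasure r) =
      ∑ v ∈ hfin.toFinset, (expMeasure r).real {b | δ b = v} * g v := by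
    intro g
    have h1 : ∀ b, g (δ b) = ∑ v ∈ hfin.toFinset, {b | δ b = v}.indicator (fun _ => g v) b := by
      intro b
      rw [Finset.sum_eq_single (δ b)]
      · rw [indicator_of_mem (by exact rfl)]
      · intro v _ hv
        exact indicator_of_notMem (fun h => hv (Eq.symm h)) _
      · intro h; simp at h
    simp_rw [h1]
    rw [integral_finsetSum _ fun v _ => (integrable_const _).indicator (hm v)]
    refine Finset.sum_congr rfl fun v _ => ?_
    rw [integral_indicator_const _ (hm v), smul_eq_mul]
  have h1 := hsum fun v => f (x + v) - f x
  have h2 := hsum fun _ => 1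
  have h3 := hsum fun v => f (x + v)
  simp only [integral_const, probReal_univ, smul_eq_mul, mul_one] at h2
  have h4 : ∑ v ∈ hfin.toFinset, (expMeasure r).real {b | δ b = v} * (f (x + v) - f x) =
      ∑ v ∈ hfin.toFinset.erase 0, (expMeasure r).real {b | δ b = v} * (f (x + v) - f x) := by
    rw [Finset.sum_erase]
    simp
  rw [LinearMap.add_apply, LinearMap.smul_apply, Module.End.one_apply, Pi.add_apply, Pi.smul_apply,
    gen_apply, smul_eq_mul, Finset.mul_sum]
  have h5 : ∑ v ∈ hfin.toFinset.erase 0,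
      r * ((expMeasure r).real {b | δ b = v} / r * (f (x + v) - f x)) =
      ∑ v ∈ hfin.toFinset.erase 0, (expMeasure r).real {b | δ b = v} * (f (x + v) - f x) :=
    Finset.sum_congr rfl fun v _ => by field_simp
  rw [h5, ← h4]
  simp_rw [mul_sub]
  rw [Finset.sum_sub_distrib, ← Finset.sum_mul, ← h2, one_mul]
  unfold expAvg
  rw [h3]
  ring

/-- On `(0, T]` the density lies between `r * exp (-(r * T))` and `r`. -/
theorem expMeasure_real_bounds {r T : ℝ} (hr : 0 < r) {A : Set ℝ} (hA : MeasurableSet A)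
    (hAT : A ⊆ Iic T) :
    Real.exp (-(r * T)) * volume.real (A ∩ Ioi 0) ≤ (expMeasure r).real A / r ∧
      (expMeasure r).real A / r ≤ volume.real (A ∩ Ioi 0) := by
  have hP := isProbabilityMeasure_expMeasure hr
  have hfin : volume (A ∩ Ioi 0) ≠ ∞ :=
    measure_ne_top_of_subset (show A ∩ Ioi 0 ⊆ Ioc 0 T from fun x hx => ⟨hx.2, hAT hx.1⟩) (by simp)
  have h1 : expMeasure r A = ∫⁻ a in A ∩ Ioi 0, ENNReal.ofReal (r * Real.exp (-(r * a))) := by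
    rw [← lintegral_indicator_one hA, lintegral_expMeasure (measurable_one.indicator hA),
      ← Measure.restrict_restrict hA, ← lintegral_indicator hA]
    refine lintegral_congr fun a => ?_
    by_cases ha : a ∈ A <;> simp [ha]
  have hmA := hA.inter (measurableSet_Ioi (a := (0 : ℝ)))
  have up : expMeasure r A ≤ ENNReal.ofReal r * volume (A ∩ Ioi 0) := by
    rw [h1, ← setLIntegral_const]
    refine setLIntegral_mono' hmA fun a ha => ENNReal.ofReal_le_ofReal ?_
    refine mul_le_of_le_one_right hr.le (Real.exp_le_one_iff.2 ?_)
    have := mul_pos hr ha.2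
    linarith
  have lo : ENNReal.ofReal (r * Real.exp (-(r * T))) * volume (A ∩ Ioi 0) ≤ expMeasure r A := by
    rw [h1, ← setLIntegral_const]
    refine setLIntegral_mono' hmA fun a ha => ENNReal.ofReal_le_ofReal ?_
    refine mul_le_mul_of_nonneg_left (Real.exp_le_exp.2 ?_) hr.le
    have := mul_le_mul_of_nonneg_left (show a ≤ T from hAT ha.1) hr.le
    linarith
  have up' := ENNReal.toReal_mono (ENNReal.mul_ne_top ENNReal.ofReal_ne_top hfin) up
  have lo' := ENNReal.toReal_mono (measure_ne_top _ _) lo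
  rw [ENNReal.toReal_mul, ENNReal.toReal_ofReal hr.le] at up'
  rw [ENNReal.toReal_mul, ENNReal.toReal_ofReal (by positivity)] at lo'
  refine ⟨(le_div_iff₀ hr).2 ?_, (div_le_iff₀ hr).2 ?_⟩
  · refine le_trans (le_of_eq ?_) lo'
    unfold Measure.real
    ring
  · refine up'.trans (le_of_eq ?_)
    unfold Measure.real
    ring

/-- Poisson limit: the mean of `f` after `s` independent rare jumps converges as the rate of the
jumps tends to `0` and the mean number of jumps converges. -/
theorem exists_tendsto_expAvg_iterate {l : Filter ℕ} {T : ℝ} (hδ : Measurable δ)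
    (hfin : (range δ).Finite) (hT : ∀ b, T < b → δ b = 0) {f : ℕ → X → ℝ}
    (hf1 : ∀ m x, |f m x| ≤ 1)
    (hf : ∀ x, ∃ θ, Tendsto (fun m => f m x) l (𝓝 θ)) {r : ℕ → ℝ} {s : ℕ → ℕ} {c : ℝ}
    (hr0 : ∀ m, 0 < r m) (hr : Tendsto r l (𝓝 0)) (hs : Tendsto (fun m => s m * r m) l (𝓝 c))
    (x : X) :
    ∃ θ, Tendsto (fun m => (expAvg δ (r m))^[s m] (f m) x) l (𝓝 θ) := by
  classical
  have hit : ∀ m, (expAvg δ (r m))^[s m] (f m) = ((1 + r m • gen (hfin.toFinset.erase 0)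
      fun v => (expMeasure (r m)).real {b | δ b = v} / r m) ^ s m) (f m) := by
    intro m
    rw [Module.End.pow_apply]
    congr 2
    funext g
    exact expAvg_eq (hr0 m) hδ hfin g
  have hb : ∀ m, ∀ v ∈ hfin.toFinset.erase 0, _ ∧ _ := fun m v hv =>
    expMeasure_real_bounds (T := T) (hr0 m) (A := {b | δ b = v}) (hδ (measurableSet_singleton v))
      fun b hb => not_lt.1 fun h => (Finset.mem_erase.1 hv).1 ((show δ b = v from hb) ▸ hT b h)
  simp_rw [hit]
  -- Divided by `r m`, the probability of the jump `v` tends to the Lebesgue measure of the positive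
  -- times that produce it, finite because these times are at most `T`. The same measures give the
  -- uniform bound `W`.
  refine exists_tendsto_one_add_pow
    (W := ∑ v ∈ hfin.toFinset.erase 0, volume.real ({b | δ b = v} ∩ Ioi 0))
    (fun m v _ => div_nonneg measureReal_nonneg (hr0 m).le)
    (fun m => Finset.sum_le_sum fun v hv => (hb m v hv).2) (fun v hv => ?_) hf1 hf
    (fun m => (hr0 m).le) hr hs x
  refine ⟨volume.real ({b | δ b = v} ∩ Ioi 0), tendsto_of_tendsto_of_tendsto_of_le_of_le ?_
    tendsto_const_nhds (fun m => (hb m v hv).1) (fun m => (hb m v hv).2)⟩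
  have h1 : Tendsto (fun m => Real.exp (-(r m * T))) l (𝓝 1) := by
    have := (Real.continuous_exp.tendsto _).comp ((hr.mul_const T).neg)
    simpa [Function.comp_def] using this
  simpa using h1.mul_const (volume.real ({b | δ b = v} ∩ Ioi 0))

theorem expAvg_mem {r : ℝ} (hr : 0 < r) (hδ : Measurable δ) (hfin : (range δ).Finite) {f : X → ℝ}
    (hf : ∀ x, 0 ≤ f x ∧ f x ≤ 1) (x : X) :
    (0 ≤ expAvg δ r f x ∧ expAvg δ r f x ≤ 1) ∧
    ∫⁻ b, ENNReal.ofReal (f (x + δ b)) ∂(expMeasure r) = ENNReal.ofReal (expAvg δ r f x) := by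
  have hP := isProbabilityMeasure_expMeasure hr
  have hm : Measurable fun b => f (x + δ b) := by
    have := hfin.countable
    have h1 : Measurable (rangeFactorization δ) := hδ.subtype_mk
    have h2 : Countable (range δ) := this.to_subtype
    exact (measurable_of_countable fun v : range δ => f (x + v)).comp h1
  have hi : Integrable (fun b => f (x + δ b)) (expMeasure r) :=
    Integrable.of_bound hm.aestronglyMeasurable 1 (ae_of_all _ fun b => by
      rw [Real.norm_of_nonneg (hf _).1]; exact (hf _).2)
  refine ⟨⟨integral_nonneg fun b => (hf _).1, ?_⟩, ?_⟩
  · refine (integral_mono hi (integrable_const 1) fun b => (hf _).2).trans (by simp)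
  · rw [expAvg, ofReal_integral_eq_lintegral_ofReal hi (ae_of_all _ fun b => (hf _).1)]

theorem expAvg_iterate_mem {r : ℝ} (hr : 0 < r) (hδ : Measurable δ) (hfin : (range δ).Finite)
    (s : ℕ) {f : X → ℝ} (hf : ∀ x, 0 ≤ f x ∧ f x ≤ 1) (x : X) :
    0 ≤ (expAvg δ r)^[s] f x ∧ (expAvg δ r)^[s] f x ≤ 1 := by
  induction s generalizing x with
  | zero => exact hf x
  | succ s ih =>
    rw [Function.iterate_succ_apply']
    exact (expAvg_mem hr hδ hfin ih x).1

-- Integrating out one coordinate of `T` applies `expAvg` once. The function `H` may still depend on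
-- coordinates outside `T`, which allows a second group of edges with another jump to be treated by
-- a second application.
open Classical in
theorem lintegral_pi_expAvg {I : Type*} [Fintype I] [Countable X] {r : ℝ} (hr : 0 < r)
    (hδ : Measurable δ) (hfin : (range δ).Finite) (T : Finset I) {H : (I → ℝ) → X → ℝ≥0∞}
    (hH : ∀ x, Measurable fun B => H B x) (hT : ∀ i ∈ T, ∀ B b, H (Function.update B i b) = H B)
    {f : X → ℝ} (hf : ∀ x, 0 ≤ f x ∧ f x ≤ 1)
    (hHf : ∀ x, ∫⁻ B, H B x ∂(Measure.pi fun _ : I => expMeasure r) = ENNReal.ofReal (f x)) :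
    ∀ x, ∫⁻ B, H B (x + ∑ i ∈ T, δ (B i)) ∂(Measure.pi fun _ : I => expMeasure r) =
      ENNReal.ofReal ((expAvg δ r)^[T.card] f x) := by
  have hP := isProbabilityMeasure_expMeasure hr
  have hjoint : Measurable fun q : (I → ℝ) × X => H q.1 q.2 :=
    measurable_from_prod_countable_left hH
  induction T using Finset.induction_on with
  | empty => intro x; simpa using hHf x
  | insert a T ha ih =>
    intro x
    have ih' := ih fun i hi => hT i (Finset.mem_insert_of_mem hi)
    have hm : ∀ T : Finset I, ∀ x, Measurable fun B : I → ℝ => H B (x + ∑ i ∈ T, δ (B i)) := by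
      intro T x
      have : Measurable fun B : I → ℝ => x + ∑ i ∈ T, δ (B i) := by
        have h1 : Measurable fun (B : I → ℝ) (i : T) => δ (B i) :=
          measurable_pi_lambda _ fun i => hδ.comp (measurable_pi_apply _)
        have h2 := (measurable_of_countable fun y : T → X => x + ∑ i : T, y i).comp h1
        have h3 : (fun B : I → ℝ => x + ∑ i ∈ T, δ (B i)) =
            (fun y : T → X => x + ∑ i : T, y i) ∘ fun B i => δ (B i) := by
          funext B
          simp only [Function.comp_apply]
          rw [Finset.sum_coe_sort T fun i => δ (B i)]
        rwa [h3]
      exact hjoint.comp (measurable_id.prodMk this)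
    rw [Finset.card_insert_of_notMem ha, Function.iterate_succ_apply',
      lintegral_pi_update _ a (hm _ x)]
    have h1 : ∀ (B : I → ℝ) (b : ℝ), H (Function.update B a b)
        (x + ∑ i ∈ insert a T, δ (Function.update B a b i)) =
        H B (x + δ b + ∑ i ∈ T, δ (B i)) := by
      intro B b
      rw [hT a (Finset.mem_insert_self a T), Finset.sum_insert ha, Function.update_self, add_assoc]
      congr 3
      exact Finset.sum_congr rfl fun i hi => by
        rw [Function.update_of_ne (ne_of_mem_of_not_mem hi ha)]
    simp_rw [h1]
    have hm2 : Measurable fun q : (I → ℝ) × ℝ => H q.1 (x + δ q.2 + ∑ i ∈ T, δ (q.1 i)) := by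
      have h3 : Measurable fun q : (I → ℝ) × X => H q.1 (x + q.2 + ∑ i ∈ T, δ (q.1 i)) :=
        measurable_from_prod_countable_left fun v => hm T (x + v)
      exact h3.comp (measurable_fst.prodMk (hδ.comp measurable_snd))
    rw [lintegral_lintegral_swap hm2.aemeasurable]
    simp_rw [ih']
    exact (expAvg_mem hr hδ hfin (expAvg_iterate_mem hr hδ hfin T.card hf) x).2

end Averaging

/-! ### Joint undecodability of finitely many versions. -/

section Levels

/-- Which of the levels are reached by an edge whose last activation is `b` time units ago
(for an edge from a subscriber). -/
noncomputable def jumpFst (L : Finset ℕ) (t : ℕ → ℝ) (b : ℝ) : (L → ℕ) × (L → ℕ) :=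
  (fun q => if b ≤ t q then 1 else 0, 0)

/-- Which of the levels are reached by an edge whose last activation is `b` time units ago
(for an edge from a nonsubscriber). -/
noncomputable def jumpSnd (L : Finset ℕ) (t : ℕ → ℝ) (b : ℝ) : (L → ℕ) × (L → ℕ) :=
  (0, fun q => if b ≤ t q then 1 else 0)

/-- The probability that no level can be decoded, given the numbers of subscribers and
nonsubscribers that have been heard from on every level. -/
noncomputable def prodHyp (k N K a₀ b₀ : ℕ) {L : Finset ℕ} (x : (L → ℕ) × (L → ℕ)) : ℝ :=
  ∏ q : L, hyp k (b₀ + x.2 q) N K (a₀ + x.1 q)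

/-- The probability that no version of a finite set `L` of versions can be decoded, when version
`q` has age `t q`. -/
noncomputable def levelProb (k N K s₁ s₂ a₀ b₀ : ℕ) (r : ℝ) (L : Finset ℕ) (t : ℕ → ℝ) : ℝ :=
  (expAvg (jumpFst L t) r)^[s₁] ((expAvg (jumpSnd L t) r)^[s₂] (prodHyp k N K a₀ b₀)) 0

theorem measurable_jumpFst (L : Finset ℕ) (t : ℕ → ℝ) : Measurable (jumpFst L t) := by
  refine Measurable.prodMk (measurable_pi_lambda _ fun q => ?_) measurable_const
  exact Measurable.ite measurableSet_Iic measurable_const measurable_const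

theorem measurable_jumpSnd (L : Finset ℕ) (t : ℕ → ℝ) : Measurable (jumpSnd L t) := by
  refine Measurable.prodMk measurable_const (measurable_pi_lambda _ fun q => ?_)
  exact Measurable.ite measurableSet_Iic measurable_const measurable_const

theorem finite_range_jump (L : Finset ℕ) (t : ℕ → ℝ) :
    (range fun b (q : L) => if b ≤ t q then (1 : ℕ) else 0).Finite := by
  refine (Finite.pi (fun _ : L => (finite_le_nat 1))).subset ?_
  rintro _ ⟨b, rfl⟩ q _
  simp only [mem_ofPred_eq]
  split_ifs <;> simp

theorem finite_range_jumpFst (L : Finset ℕ) (t : ℕ → ℝ) : (range (jumpFst L t)).Finite :=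
  ((finite_range_jump L t).image fun x => (x, 0)).subset
    (by rintro _ ⟨b, rfl⟩; exact ⟨_, ⟨b, rfl⟩, rfl⟩)

theorem finite_range_jumpSnd (L : Finset ℕ) (t : ℕ → ℝ) : (range (jumpSnd L t)).Finite :=
  ((finite_range_jump L t).image fun x => (0, x)).subset
    (by rintro _ ⟨b, rfl⟩; exact ⟨_, ⟨b, rfl⟩, rfl⟩)

theorem prodHyp_mem (k N K a₀ b₀ : ℕ) {L : Finset ℕ} (x : (L → ℕ) × (L → ℕ)) :
    0 ≤ prodHyp k N K a₀ b₀ x ∧ prodHyp k N K a₀ b₀ x ≤ 1 :=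
  ⟨Finset.prod_nonneg fun _ _ => (hyp_mem _ _ _ _ _).1,
    Finset.prod_le_one (fun _ _ => (hyp_mem _ _ _ _ _).1) fun _ _ => (hyp_mem _ _ _ _ _).2⟩

theorem levelProb_mem (k N K s₁ s₂ a₀ b₀ : ℕ) {r : ℝ} (hr : 0 < r) (L : Finset ℕ) (t : ℕ → ℝ) :
    0 ≤ levelProb k N K s₁ s₂ a₀ b₀ r L t ∧ levelProb k N K s₁ s₂ a₀ b₀ r L t ≤ 1 :=
  expAvg_iterate_mem hr (measurable_jumpFst L t) (finite_range_jumpFst L t) s₁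
    (expAvg_iterate_mem hr (measurable_jumpSnd L t) (finite_range_jumpSnd L t) s₂
      (prodHyp_mem k N K a₀ b₀)) 0

/-- The integrand depends on the clocks only through counts, which are sums of independent jumps;
`lintegral_pi_expAvg` is applied to the clocks outside `P` and then to those in `P`. -/
theorem lintegral_prod_hyp {I : Type*} [Fintype I] (k N K a₀ b₀ : ℕ) {r : ℝ} (hr : 0 < r)
    (L : Finset ℕ) (t : ℕ → ℝ) (P : I → Prop) [DecidablePred P] :
    ∫⁻ B, ∏ q ∈ L, ENNReal.ofReal (hyp k
        (b₀ + (Finset.univ.filter fun i => ¬ P i ∧ B i ≤ t q).card) N K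
        (a₀ + (Finset.univ.filter fun i => P i ∧ B i ≤ t q).card))
      ∂(Measure.pi fun _ : I => expMeasure r) =
    ENNReal.ofReal (levelProb k N K (Finset.univ.filter fun i => P i).card
      (Finset.univ.filter fun i => ¬ P i).card a₀ b₀ r L t) := by
  classical
  have hP := isProbabilityMeasure_expMeasure hr
  have m1 := measurable_jumpFst L t
  have m2 := measurable_jumpSnd L t
  have f1 := finite_range_jumpFst L t
  have f2 := finite_range_jumpSnd L t
  set T₁ : Finset I := Finset.univ.filter fun i => P i with hT₁
  set T₂ : Finset I := Finset.univ.filter fun i => ¬ P i with hT₂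
  have hmem := prodHyp_mem k N K a₀ b₀ (L := L)
  have h1 := lintegral_pi_expAvg hr m2 f2 T₂ (H := fun _ x => ENNReal.ofReal
    (prodHyp k N K a₀ b₀ x)) (fun x => measurable_const) (fun _ _ _ _ => rfl) hmem
    (fun x => by simp)
  have hm : ∀ x, Measurable fun B : I → ℝ => ENNReal.ofReal
      (prodHyp k N K a₀ b₀ (x + ∑ i ∈ T₂, jumpSnd L t (B i))) := by
    intro x
    have e1 : Measurable fun (B : I → ℝ) (i : T₂) => jumpSnd L t (B i) :=
      measurable_pi_lambda _ fun i => m2.comp (measurable_pi_apply _)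
    have e2 := (measurable_of_countable fun y : T₂ → (L → ℕ) × (L → ℕ) => ENNReal.ofReal
      (prodHyp k N K a₀ b₀ (x + ∑ i : T₂, y i))).comp e1
    have e3 : (fun B : I → ℝ => ENNReal.ofReal
        (prodHyp k N K a₀ b₀ (x + ∑ i ∈ T₂, jumpSnd L t (B i)))) =
        (fun y : T₂ → (L → ℕ) × (L → ℕ) => ENNReal.ofReal
          (prodHyp k N K a₀ b₀ (x + ∑ i : T₂, y i))) ∘ fun B i => jumpSnd L t (B i) := by
      funext B
      simp only [Function.comp_apply]
      rw [Finset.sum_coe_sort T₂ fun i => jumpSnd L t (B i)]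
    rwa [e3]
  have h2 := lintegral_pi_expAvg hr m1 f1 T₁ (H := fun B x => ENNReal.ofReal
    (prodHyp k N K a₀ b₀ (x + ∑ i ∈ T₂, jumpSnd L t (B i)))) hm
    (fun i hi B b => by
      funext x
      congr 3
      refine Finset.sum_congr rfl fun i' hi' => ?_
      rw [Function.update_of_ne]
      rintro rfl
      exact (Finset.mem_filter.1 hi').2 (Finset.mem_filter.1 hi).2)
    (expAvg_iterate_mem hr m2 f2 T₂.card hmem) h1 0
  refine Eq.trans (lintegral_congr fun B => ?_) h2
  rw [prodHyp, ENNReal.ofReal_prod_of_nonneg fun _ _ => (hyp_mem _ _ _ _ _).1,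
    ← Finset.prod_coe_sort]
  refine Finset.prod_congr rfl fun q _ => ?_
  have c1 : (0 + ∑ i ∈ T₁, jumpFst L t (B i) + ∑ i ∈ T₂, jumpSnd L t (B i)).1 q =
      (Finset.univ.filter fun i => P i ∧ B i ≤ t q).card := by
    rw [← Finset.filter_filter, Finset.card_filter]
    simp [Prod.fst_sum, jumpFst, jumpSnd, hT₁]
  have c2 : (0 + ∑ i ∈ T₁, jumpFst L t (B i) + ∑ i ∈ T₂, jumpSnd L t (B i)).2 q =
      (Finset.univ.filter fun i => ¬ P i ∧ B i ≤ t q).card := by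
    rw [← Finset.filter_filter, Finset.card_filter]
    simp [Prod.snd_sum, jumpFst, jumpSnd, hT₂]
  rw [c1, c2]

/-- The Poisson limit is taken twice: the converging average over nonsubscribers is the input for
the average over subscribers. Clocks exceeding every age in `L` cause no jump. -/
theorem exists_tendsto_levelProb {l : Filter ℕ} {N K s₁ s₂ : ℕ → ℕ} (k a₀ b₀ : ℕ) {r : ℕ → ℝ}
    (hhyp : ∀ b a, ∃ θ, Tendsto (fun m => hyp k b (N m) (K m) a) l (𝓝 θ)) {c₁ c₂ : ℝ}
    (hr0 : ∀ m, 0 < r m) (hr : Tendsto r l (𝓝 0)) (h₁ : Tendsto (fun m => s₁ m * r m) l (𝓝 c₁))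
    (h₂ : Tendsto (fun m => s₂ m * r m) l (𝓝 c₂)) (L : Finset ℕ) (t : ℕ → ℝ) :
    ∃ θ, Tendsto (fun m => levelProb k (N m) (K m) (s₁ m) (s₂ m) a₀ b₀ (r m) L t) l (𝓝 θ) := by
  have m1 := measurable_jumpFst L t
  have m2 := measurable_jumpSnd L t
  have f1 := finite_range_jumpFst L t
  have f2 := finite_range_jumpSnd L t
  obtain ⟨T, hT⟩ : ∃ T, ∀ q ∈ L, t q ≤ T :=
    (L.finite_toSet.image t).bddAbove.imp fun T h q hq => h ⟨q, hq, rfl⟩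
  have z1 : ∀ b, T < b → jumpFst L t b = 0 := fun b hb => by
    ext q <;> simp [jumpFst, ((hT q.1 q.2).trans_lt hb)]
  have z2 : ∀ b, T < b → jumpSnd L t b = 0 := fun b hb => by
    ext q <;> simp [jumpSnd, ((hT q.1 q.2).trans_lt hb)]
  have habs : ∀ {y : ℝ}, 0 ≤ y ∧ y ≤ 1 → |y| ≤ 1 := fun h => by rw [abs_of_nonneg h.1]; exact h.2
  have g1 := exists_tendsto_expAvg_iterate m2 f2 z2
    (f := fun m => prodHyp k (N m) (K m) a₀ b₀ (L := L)) (fun m x => habs (prodHyp_mem _ _ _ _ _ x))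
    (fun x => by
      choose θ hθ using hhyp
      exact ⟨_, tendsto_finsetProd _ fun q _ => hθ (b₀ + x.2 q) (a₀ + x.1 q)⟩) hr0 hr h₂
  exact exists_tendsto_expAvg_iterate m1 f1 z1 (fun m x => habs (expAvg_iterate_mem (hr0 m) m2 f2 _
    (prodHyp_mem _ _ _ _ _) x)) g1 hr0 hr h₁ 0

/-- The mean lag of a node. -/
noncomputable def nodeMean (k N K s₁ s₂ a₀ b₀ : ℕ) (lamS r u : ℝ) : ℝ≥0∞ :=
  ∑' p, ∫⁻ x, {x | psum x (p + 1) ≤ u}.indicator (fun x => ENNReal.ofReal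
    (levelProb k N K s₁ s₂ a₀ b₀ r (Finset.Ico p (cnt u x)) fun q => u - psum x (q + 1))) x
      ∂(Measure.infinitePi fun _ : ℕ => expMeasure lamS)

theorem tsum_measure_psum_le {lamS : ℝ} (hS : 0 < lamS) (u : ℝ) :
    ∑' p, (Measure.infinitePi fun _ : ℕ => expMeasure lamS) {x | psum x (p + 1) ≤ u} ≠ ∞ := by
  have h := tsum_lintegral_window hS (G := fun _ => 1) measurable_const 0 u
  have hm : ∀ p, MeasurableSet {x : ℕ → ℝ | psum x (p + 1) ≤ u} := fun p =>
    measurableSet_le (measurable_psum (p + 1)) measurable_const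
  simp only [sub_zero] at h
  have h2 : ∑' p, (Measure.infinitePi fun _ : ℕ => expMeasure lamS) {x | psum x (p + 1) ≤ u} = _ :=
    (tsum_congr fun p => (lintegral_indicator_one (hm p)).symm).trans h
  rw [h2]
  exact ENNReal.mul_ne_top ENNReal.ofReal_ne_top (by simp)

/-- Dominated convergence, first over the creation times and then over `p`. Both are dominated by
the existence of version `p + 1` by time `u`, whose probabilities have finite sum by Campbell's
formula. -/
theorem exists_tendsto_nodeMean {l : Filter ℕ} [l.IsCountablyGenerated] {N K s₁ s₂ : ℕ → ℕ}
    (k a₀ b₀ : ℕ) {r : ℕ → ℝ}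
    (hhyp : ∀ b a, ∃ θ, Tendsto (fun m => hyp k b (N m) (K m) a) l (𝓝 θ)) {c₁ c₂ : ℝ}
    (hr0 : ∀ m, 0 < r m) (hr : Tendsto r l (𝓝 0)) (h₁ : Tendsto (fun m => s₁ m * r m) l (𝓝 c₁))
    (h₂ : Tendsto (fun m => s₂ m * r m) l (𝓝 c₂)) {lamS : ℝ} (hS : 0 < lamS) (u : ℝ)
    (hmeas : ∀ᶠ m in l, ∀ p, AEMeasurable (fun x => {x | psum x (p + 1) ≤ u}.indicator
      (fun x => ENNReal.ofReal (levelProb k (N m) (K m) (s₁ m) (s₂ m) a₀ b₀ (r m)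
        (Finset.Ico p (cnt u x)) fun q => u - psum x (q + 1))) x)
          (Measure.infinitePi fun _ : ℕ => expMeasure lamS)) :
    ∃ θ, θ ≠ ∞ ∧ Tendsto (fun m => nodeMean k (N m) (K m) (s₁ m) (s₂ m) a₀ b₀ lamS (r m) u)
      l (𝓝 θ) := by
  rcases eq_or_neBot l with rfl | hl
  · exact ⟨0, by simp, tendsto_bot⟩
  have hP := isProbabilityMeasure_expMeasure hS
  set Q := Measure.infinitePi fun _ : ℕ => expMeasure lamS
  have hms : ∀ p, MeasurableSet {x : ℕ → ℝ | psum x (p + 1) ≤ u} := fun p =>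
    measurableSet_le (measurable_psum (p + 1)) measurable_const
  choose θ hθ using fun (p : ℕ) (x : ℕ → ℝ) => exists_tendsto_levelProb k a₀ b₀ hhyp hr0 hr h₁ h₂
    (Finset.Ico p (cnt u x)) fun q => u - psum x (q + 1)
  have hb : ∀ m p x, {x | psum x (p + 1) ≤ u}.indicator
      (fun x => ENNReal.ofReal (levelProb k (N m) (K m) (s₁ m) (s₂ m) a₀ b₀ (r m)
        (Finset.Ico p (cnt u x)) fun q => u - psum x (q + 1))) x ≤
      {x | psum x (p + 1) ≤ u}.indicator (1 : (ℕ → ℝ) → ℝ≥0∞) x := fun m p x =>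
    indicator_le_indicator (ENNReal.ofReal_le_one.2 (levelProb_mem _ _ _ _ _ _ _ (hr0 m) _ _).2)
  have h1 : ∀ p, Tendsto (fun m => ∫⁻ x, {x | psum x (p + 1) ≤ u}.indicator
      (fun x => ENNReal.ofReal (levelProb k (N m) (K m) (s₁ m) (s₂ m) a₀ b₀ (r m)
        (Finset.Ico p (cnt u x)) fun q => u - psum x (q + 1))) x ∂Q) l
      (𝓝 (∫⁻ x, {x | psum x (p + 1) ≤ u}.indicator (fun x => ENNReal.ofReal (θ p x)) x ∂Q)) := by
    intro p
    refine tendsto_lintegral_filter_of_dominated_convergence'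
      ({x | psum x (p + 1) ≤ u}.indicator (1 : (ℕ → ℝ) → ℝ≥0∞)) (hmeas.mono fun m h => h p)
      (Eventually.of_forall fun m => ae_of_all _ fun x => hb m p x) ?_ (ae_of_all _ fun x => ?_)
    · rw [lintegral_indicator_one (hms p)]
      exact measure_ne_top _ _
    · by_cases hx : psum x (p + 1) ≤ u
      · simp only [indicator_of_mem (show x ∈ {x | psum x (p + 1) ≤ u} from hx)]
        exact ENNReal.tendsto_ofReal (hθ p x)
      · simp only [indicator_of_notMem (show x ∉ {x | psum x (p + 1) ≤ u} from hx)]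
        exact tendsto_const_nhds
  have h2 : ∀ m p, ∫⁻ x, {x | psum x (p + 1) ≤ u}.indicator
      (fun x => ENNReal.ofReal (levelProb k (N m) (K m) (s₁ m) (s₂ m) a₀ b₀ (r m)
        (Finset.Ico p (cnt u x)) fun q => u - psum x (q + 1))) x ∂Q ≤
      Q {x | psum x (p + 1) ≤ u} := fun m p => by
    rw [← lintegral_indicator_one (hms p)]
    exact lintegral_mono (hb m p)
  have h3 := tendsto_lintegral_filter_of_dominated_convergence (μ := Measure.count) (l := l)
    (fun p => Q {x | psum x (p + 1) ≤ u}) (Eventually.of_forall fun m => measurable_of_countable _)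
    (Eventually.of_forall fun m => ae_of_all _ fun p => h2 m p)
    (by rw [lintegral_count]; exact tsum_measure_psum_le hS u) (ae_of_all _ h1)
  simp only [lintegral_count] at h3
  refine ⟨_, ?_, h3⟩
  refine ne_top_of_le_ne_top (tsum_measure_psum_le hS u) (ENNReal.tsum_le_tsum fun p => ?_)
  exact le_of_tendsto (h1 p) (Eventually.of_forall fun m => h2 m p)

end Levels

/-! ### The mean lag as a function of cardinalities. -/

section MeanFormula

variable {m : ℕ}

-- Condition on creation times and clocks. The sets of key holders of distinct versions are
-- independent, so staleness has a product of hypergeometric probabilities; integrating over the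
-- clocks gives `levelProb`, in which `S` enters only through its size and through whether `j ∈ S`.
open Classical in
theorem meanLag_decodes_eq {k n : ℕ} {S : Finset (Fin m)} {lamS r : ℝ} (hlamS : 0 < lamS)
    (hr : 0 < r) (hS : S.card ≤ n) (hn : n ≤ m) (j : Fin m) {u : ℝ} (hu : 0 ≤ u) :
    (∀ p, AEMeasurable (fun x => {x | psum x (p + 1) ≤ u}.indicator
      (fun x => ENNReal.ofReal (levelProb k (m - S.card) (n - S.card)
        (if j ∈ S then S.card - 1 else S.card) (if j ∈ S then m - S.card else m - S.card - 1)
        (if j ∈ S then 1 else 0) (if j ∈ S then 0 else 1) r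
        (Finset.Ico p (cnt u x)) fun q => u - psum x (q + 1))) x)
          (Measure.infinitePi fun _ : ℕ => expMeasure lamS)) ∧
    meanLag (decodes k S j) lamS r (markLaw n S) u = nodeMean k (m - S.card) (n - S.card)
        (if j ∈ S then S.card - 1 else S.card) (if j ∈ S then m - S.card else m - S.card - 1)
        (if j ∈ S then 1 else 0) (if j ∈ S then 0 else 1) lamS r u := by
  have hP1 := isProbabilityMeasure_expMeasure hlamS
  have hP2 := isProbabilityMeasure_expMeasure hr
  have hP3 := isProbabilityMeasure_markLaw S hn
  have c1 : (Finset.univ.filter fun i : {i : Fin m // i ≠ j} => i.1 ∈ S).card =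
      if j ∈ S then S.card - 1 else S.card := by
    have : (Finset.univ.filter fun i : {i : Fin m // i ≠ j} => i.1 ∈ S).card =
        (S.erase j).card := by
      refine Finset.card_bij (fun i _ => i.1) (fun i hi => ?_) (fun a _ b _ h => Subtype.ext h)
        (fun i hi => ?_)
      · exact Finset.mem_erase.2 ⟨i.2, (Finset.mem_filter.1 hi).2⟩
      · exact ⟨⟨i, (Finset.mem_erase.1 hi).1⟩, by simpa using (Finset.mem_erase.1 hi).2, rfl⟩
    rw [this, Finset.card_erase_eq_ite]
  have c2 : (Finset.univ.filter fun i : {i : Fin m // i ≠ j} => i.1 ∉ S).card =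
      if j ∈ S then m - S.card else m - S.card - 1 := by
    have : (Finset.univ.filter fun i : {i : Fin m // i ≠ j} => i.1 ∉ S).card =
        (Sᶜ.erase j).card := by
      refine Finset.card_bij (fun i _ => i.1) (fun i hi => ?_) (fun a _ b _ h => Subtype.ext h)
        (fun i hi => ?_)
      · exact Finset.mem_erase.2 ⟨i.2, Finset.mem_compl.2 (Finset.mem_filter.1 hi).2⟩
      · exact ⟨⟨i, (Finset.mem_erase.1 hi).1⟩, by simpa using (Finset.mem_erase.1 hi).2, rfl⟩
    rw [this, Finset.card_erase_eq_ite, Finset.card_compl, Fintype.card_fin]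
    by_cases h : j ∈ S <;> simp [h]
  rw [← c1, ← c2]
  set μB := Measure.pi fun _ : {i : Fin m // i ≠ j} => expMeasure r with hμB
  set μy := Measure.infinitePi fun _ : ℕ => markLaw n S with hμy
  set μx := Measure.infinitePi fun _ : ℕ => expMeasure lamS with hμx
  have hms : ∀ p, MeasurableSet {q : (ℕ → ℝ) × (ℕ → Finset (Fin m)) × ({i : Fin m // i ≠ j} → ℝ) |
      SStale (decodes k S j) u p (q.1, q.2.1) q.2.2} := fun p =>
    measurableSet_setOfPred.2 ((measurable_sStale (dec := decodes k S j) u p).comp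
      ((measurable_fst.prodMk measurable_snd.fst).prodMk measurable_snd.snd))
  have key : ∀ p x, Good x → (μy.prod μB) {q | SStale (decodes k S j) u p (x, q.1) q.2} =
      {x | psum x (p + 1) ≤ u}.indicator (fun x => ENNReal.ofReal (levelProb k (m - S.card)
        (n - S.card) (Finset.univ.filter fun i : {i : Fin m // i ≠ j} => i.1 ∈ S).card
        (Finset.univ.filter fun i : {i : Fin m // i ≠ j} => i.1 ∉ S).card
        (if j ∈ S then 1 else 0) (if j ∈ S then 0 else 1) r
        (Finset.Ico p (cnt u x)) fun q => u - psum x (q + 1))) x := by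
    intro p x hx
    by_cases hp : psum x (p + 1) ≤ u
    · rw [indicator_of_mem (by exact hp), ← lintegral_prod_hyp (I := {i : Fin m // i ≠ j}) k
        (m - S.card) (n - S.card) _ _ hr _ _ fun i => i.1 ∈ S,
        Measure.prod_apply_symm (by exact (measurable_const.prodMk measurable_id) (hms p))]
      refine lintegral_congr fun B => ?_
      have h1 : (fun y => (y, B)) ⁻¹' {q | SStale (decodes k S j) u p (x, q.1) q.2} =
          Set.pi (Finset.Ico p (cnt u x) : Finset ℕ) fun q =>
            {e | ¬ decodes k S j e {i | B i ≤ u - psum x (q + 1)}} := by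
        ext y
        simp only [mem_preimage, mem_ofPred_eq, SStale, Set.mem_pi, Finset.coe_Ico, mem_Ico, hp,
          true_and]
        refine forall_congr' fun q => ?_
        rw [and_imp, hx.le_iff hu]
        rfl
      rw [h1, Measure.infinitePi_pi _ fun _ _ => (Set.toFinite _).measurableSet]
      refine Finset.prod_congr rfl fun q _ => ?_
      refine (markLaw_not_decodes hS hn j _).trans ?_
      congr!
    · rw [indicator_of_notMem (by exact hp)]
      exact measure_mono_null (t := ∅) (fun q hq => hp hq.1) measure_empty
  have hae : ∀ p, (fun x => (μy.prod μB) {q | SStale (decodes k S j) u p (x, q.1) q.2}) =ᵐ[μx]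
      fun x => {x | psum x (p + 1) ≤ u}.indicator (fun x => ENNReal.ofReal (levelProb k (m - S.card)
        (n - S.card) (Finset.univ.filter fun i : {i : Fin m // i ≠ j} => i.1 ∈ S).card
        (Finset.univ.filter fun i : {i : Fin m // i ≠ j} => i.1 ∉ S).card
        (if j ∈ S then 1 else 0) (if j ∈ S then 0 else 1) r
        (Finset.Ico p (cnt u x)) fun q => u - psum x (q + 1))) x := fun p => by
    filter_upwards [ae_good hlamS] with x hx using key p x hx
  -- Measurability comes for free: the integrand agrees almost everywhere with the section measures
  -- of a measurable set.
  refine ⟨fun p => AEMeasurable.congr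
    (by exact (measurable_measure_prodMk_left (hms p)).aemeasurable) (hae p), ?_⟩
  rw [meanLag_eq_tsum hlamS hr hu, nodeMean]
  refine tsum_congr fun p => ?_
  have mp := (measurePreserving_prodAssoc μx μy μB).measure_preimage (hms p).nullMeasurableSet
  rw [Measure.prod_apply (hms p)] at mp
  exact mp.trans (lintegral_congr_ae (hae p))

end MeanFormula

/-! ### A tail estimate uniform in the network size. -/

section Tail

/-- Each term is at most `(C * t) ^ d / d! * exp (-(c * t))`, and half of the exponential decay
absorbs the power of `t`. Only `C` and `c` enter, so the bound is uniform in `n` and `r`. -/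
theorem binLt_le_exp {n k : ℕ} {r c C t : ℝ} (hr : 0 < r) (hc : 0 < c) (hk : k ≤ n)
    (hC : n * r ≤ C) (hcn : c ≤ r * (n - k : ℝ)) (ht : 0 ≤ t) :
    binLt (Real.exp (-(r * t))) n (k + 1) ≤
      (∑ d ∈ Finset.range (k + 1), (2 * C / c) ^ d) * Real.exp (-(c / 2) * t) := by
  rw [binLt, Finset.sum_mul]
  refine Finset.sum_le_sum fun d hd => ?_
  have hdk : d ≤ k := Nat.lt_succ_iff.1 (Finset.mem_range.1 hd)
  have hrt : 0 ≤ r * t := mul_nonneg hr.le ht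
  have hC0 : 0 ≤ C := le_trans (by positivity) hC
  have h1 : (1 - Real.exp (-(r * t))) ^ d ≤ (r * t) ^ d := by
    refine pow_le_pow_left₀ ?_ ?_ d
    · linarith [Real.exp_le_one_iff.2 (show -(r * t) ≤ 0 by linarith)]
    · linarith [Real.add_one_le_exp (-(r * t))]
  have h2 : (n.choose d : ℝ) ≤ (n : ℝ) ^ d / d.factorial := Nat.choose_le_pow_div d n
  have h3 : Real.exp (-(r * t)) ^ (n - d) ≤ Real.exp (-(c * t)) := by
    rw [← Real.exp_nat_mul]
    refine Real.exp_le_exp.2 ?_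
    rw [Nat.cast_sub (hdk.trans hk)]
    have h4 : (d : ℝ) ≤ k := by exact_mod_cast hdk
    have h5 : c * t ≤ r * (n - d : ℝ) * t := by
      refine mul_le_mul_of_nonneg_right (hcn.trans ?_) ht
      exact mul_le_mul_of_nonneg_left (by linarith) hr.le
    linarith
  have h6 : (c / 2 * t) ^ d / d.factorial ≤ Real.exp (c / 2 * t) :=
    Real.pow_div_factorial_le_exp _ (by positivity) d
  have h7 : 0 ≤ 1 - Real.exp (-(r * t)) := by
    linarith [Real.exp_le_one_iff.2 (show -(r * t) ≤ 0 by linarith)]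
  calc binEq (Real.exp (-(r * t))) n d
      ≤ ((n : ℝ) ^ d / d.factorial) * (r * t) ^ d * Real.exp (-(c * t)) := by
        unfold binEq
        gcongr
    _ = ((n * r) * t) ^ d / d.factorial * Real.exp (-(c * t)) := by
        rw [mul_assoc (n : ℝ), mul_pow (n : ℝ)]; ring
    _ ≤ (C * t) ^ d / d.factorial * Real.exp (-(c * t)) := by gcongr
    _ = (2 * C / c) ^ d * ((c / 2 * t) ^ d / d.factorial) * Real.exp (-(c * t)) := by
        rw [show C * t = 2 * C / c * (c / 2 * t) by field_simp, mul_pow]; ring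
    _ ≤ (2 * C / c) ^ d * Real.exp (c / 2 * t) * Real.exp (-(c * t)) := by gcongr
    _ = (2 * C / c) ^ d * Real.exp (-(c / 2) * t) := by
        rw [mul_assoc, ← Real.exp_add]; congr 2; ring

theorem lagTail_le {n k : ℕ} {r c C u : ℝ} (hr : 0 < r) (hc : 0 < c) (hk : k ≤ n)
    (hC : n * r ≤ C) (hcn : c ≤ r * (n - k : ℝ)) (hu : 0 ≤ u) :
    lagTail k n r u ≤ ENNReal.ofReal ((∑ d ∈ Finset.range (k + 1), (2 * C / c) ^ d) *
      (Real.exp (-(c / 2) * u) / (c / 2))) := by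
  have hC0 : 0 ≤ C := le_trans (by positivity) hC
  have hM : 0 ≤ ∑ d ∈ Finset.range (k + 1), (2 * C / c) ^ d :=
    Finset.sum_nonneg fun d _ => by positivity
  have hi : IntegrableOn (fun t => (∑ d ∈ Finset.range (k + 1), (2 * C / c) ^ d) *
      Real.exp (-(c / 2) * t)) (Ioi u) :=
    (integrableOn_exp_mul_Ioi (by linarith) u).const_mul _
  have h1 := ofReal_integral_eq_lintegral_ofReal hi (ae_of_all _ fun t => by positivity)
  rw [integral_const_mul, integral_exp_mul_Ioi (by linarith) u, neg_div_neg_eq] at h1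
  rw [h1, lagTail, setLIntegral_congr Ioi_ae_eq_Ici.symm]
  exact setLIntegral_mono' measurableSet_Ioi fun t ht =>
    ENNReal.ofReal_le_ofReal (binLt_le_exp hr hc hk hC hcn (hu.trans (le_of_lt ht)))

end Tail

/-! ### Bounds and limits of the ages. -/

section Limit

/-- The mean lag at time `u` of a subscriber (if `q`) or a nonsubscriber (otherwise). -/
noncomputable def kindMean (q : Bool) (k n m s : ℕ) (lamS lamE u : ℝ) : ℝ≥0∞ :=
  nodeMean k (m - s) (n - s) (if q then s - 1 else s) (if q then m - s else m - s - 1)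
    (if q then 1 else 0) (if q then 0 else 1) lamS (edgeRate lamE m) u

/-- The version age of a subscriber (if `q`) or a nonsubscriber (otherwise). -/
noncomputable def kindAge (q : Bool) (k n m s : ℕ) (lamS lamE : ℝ) : ℝ≥0∞ :=
  ⨆ u : ℕ, kindMean q k n m s lamS lamE u

variable {m : ℕ} {q : Bool} {k n : ℕ} {S : Finset (Fin m)} {lamS lamE : ℝ}

theorem meanLag_eq_kindMean (hS : S.card ≤ n) (hn : n ≤ m) (hlamS : 0 < lamS) (hlamE : 0 < lamE)
    {j : Fin m} (hj : j ∈ S ↔ q) {u : ℝ} (hu : 0 ≤ u) :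
    meanLag (decodes k S j) lamS (edgeRate lamE m) (markLaw n S) u =
      kindMean q k n m S.card lamS lamE u := by
  have := (meanLag_decodes_eq (k := k) hlamS (edgeRate_pos hlamE m) hS hn j hu).2
  rw [this, kindMean]
  cases q <;> simp [hj]

/-- By monotonicity the supremum may be taken over integer times, where the mean formula applies. -/
theorem nodeAge_eq_kindAge (hS : S.card ≤ n) (hn : n ≤ m) (hlamS : 0 < lamS) (hlamE : 0 < lamE)
    {j : Fin m} (hj : j ∈ S ↔ q) :
    nodeAge k n S lamS lamE j = kindAge q k n m S.card lamS lamE := by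
  have p3 := isProbabilityMeasure_markLaw S hn
  refine le_antisymm (iSup_le fun u => ?_) (iSup_le fun N => ?_)
  · obtain ⟨N, hN⟩ := exists_nat_ge u
    refine (meanLag_mono hlamS (edgeRate_pos hlamE m) hN).trans ?_
    rw [meanLag_eq_kindMean hS hn hlamS hlamE hj (Nat.cast_nonneg N)]
    exact le_iSup (fun N : ℕ => kindMean q k n m S.card lamS lamE N) N
  · rw [← meanLag_eq_kindMean hS hn hlamS hlamE hj (Nat.cast_nonneg N)]
    exact le_iSup (fun u => meanLag (decodes k S j) lamS (edgeRate lamE m) (markLaw n S) u) (N : ℝ)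

theorem exists_node {s : ℕ} (hs : s < m) (hq : q = true → 0 < s) :
    ∃ (S : Finset (Fin m)) (j : Fin m), S.card = s ∧ (j ∈ S ↔ q) := by
  obtain ⟨S, -, hS⟩ := Finset.exists_subset_card_eq
    (s := (Finset.univ : Finset (Fin m))) (n := s) (by simpa using hs.le)
  cases q with
  | true =>
    obtain ⟨j, hj⟩ := Finset.card_pos.1 (hS ▸ hq rfl)
    exact ⟨S, j, hS, by simpa using hj⟩
  | false =>
    obtain ⟨j, hj⟩ : ∃ j, j ∉ S := by
      by_contra! h
      rw [Finset.eq_univ_iff_forall.2 h, Finset.card_univ, Fintype.card_fin] at hS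
      omega
    exact ⟨S, j, hS, by simpa using hj⟩

/-- An upper bound for the version age. -/
noncomputable def ageBound (k n m : ℕ) (lamS lamE : ℝ) : ℝ :=
  lamS * ∑ d ∈ Finset.range (k + 1), 1 / (edgeRate lamE m * (n - d : ℝ))

theorem kindAge_bounds {s : ℕ} (hk : k < n) (hs : s < n) (hn : n ≤ m) (hm : 2 ≤ m)
    (hlamS : 0 < lamS) (hlamE : 0 < lamE) (hq : q = true → 0 < s) :
    kindAge q k n m s lamS lamE ≠ ∞ ∧ k * lamS / lamE ≤ (kindAge q k n m s lamS lamE).toReal ∧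
      (kindAge q k n m s lamS lamE).toReal ≤ ageBound k n m lamS lamE := by
  obtain ⟨S, j, rfl, hj⟩ := exists_node (q := q) (hs.trans_le hn) hq
  rw [← nodeAge_eq_kindAge hs.le hn hlamS hlamE hj]
  have up := nodeAge_le hk hs.le hn hlamS hlamE j
  have lo := le_nodeAge (S := S) hk hn hlamS hlamE j
  have hfin := ne_top_of_le_ne_top ENNReal.ofReal_ne_top up
  have hm1 : (1 : ℝ) < m := by exact_mod_cast (by omega : 1 < m)
  have hm0 : (0 : ℝ) < (m : ℝ) - 1 := by linarith
  have hr : edgeRate lamE m = lamE / ((m : ℝ) - 1) := by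
    rw [edgeRate, if_neg (by omega)]
  refine ⟨hfin, le_trans ?_ ((ENNReal.ofReal_le_iff_le_toReal hfin).1 lo),
    ENNReal.toReal_le_of_le_ofReal ?_ up⟩
  · have h1 : ∀ d ∈ Finset.range k, 1 / lamE ≤
        1 / (edgeRate lamE m * ((m - 1 : ℕ) - d : ℝ)) := by
      intro d hd
      have hd' : d < m - 1 := by have := Finset.mem_range.1 hd; omega
      have h2 : (0 : ℝ) < ((m - 1 : ℕ) : ℝ) - d := by
        have : (d : ℝ) < (m - 1 : ℕ) := by exact_mod_cast hd'
        linarith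
      refine one_div_le_one_div_of_le (mul_pos (edgeRate_pos hlamE m) h2) ?_
      rw [hr, div_mul_eq_mul_div, div_le_iff₀ hm0]
      refine mul_le_mul_of_nonneg_left ?_ hlamE.le
      rw [Nat.cast_sub (by omega)]
      have : (0 : ℝ) ≤ d := Nat.cast_nonneg d
      push_cast
      linarith
    have h3 := Finset.sum_le_sum h1
    rw [Finset.sum_const, Finset.card_range, nsmul_eq_mul] at h3
    calc (k : ℝ) * lamS / lamE = lamS * (k * (1 / lamE)) := by ring
      _ ≤ _ := mul_le_mul_of_nonneg_left h3 hlamS.le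
  · refine mul_nonneg hlamS.le (Finset.sum_nonneg fun d hd => ?_)
    have h2 : (0 : ℝ) < (n : ℝ) - d := by
      have : (d : ℝ) < n := by exact_mod_cast (Finset.mem_range.1 hd).trans_le hk
      linarith
    have := edgeRate_pos hlamE m
    positivity

theorem tendsto_edgeRate_mul (lamE : ℝ) {x : ℕ → ℝ} {σ : ℝ}
    (hx : Tendsto (fun m : ℕ => x m / m) atTop (𝓝 σ)) :
    Tendsto (fun m => x m * edgeRate lamE m) atTop (𝓝 (σ * lamE)) := by
  have h1 := tendsto_div_of_bounded_shift (x := x) (x' := x) (y := fun m : ℕ => (m : ℝ))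
    (y' := fun m => (m : ℝ) - 1) (C := 1) tendsto_natCast_atTop_atTop hx (by simp) (by simp)
  refine (h1.mul_const lamE).congr' ?_
  filter_upwards [eventually_ge_atTop 2] with m hm
  rw [edgeRate, if_neg (by omega)]
  ring

theorem tendsto_edgeRate (lamE : ℝ) : Tendsto (fun m => edgeRate lamE m) atTop (𝓝 0) := by
  have h1 : Tendsto (fun m : ℕ => (1 : ℝ) / m) atTop (𝓝 0) := tendsto_one_div_atTop_nhds_zero_nat
  simpa using tendsto_edgeRate_mul lamE (x := fun _ => 1) h1

/-- A sequence that is eventually within any `ε` of some convergent sequence is Cauchy. -/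
theorem exists_tendsto_of_approx {A : ℕ → ℝ}
    (h : ∀ ε > 0, ∃ Y : ℕ → ℝ, (∃ θ, Tendsto Y atTop (𝓝 θ)) ∧ ∀ᶠ m in atTop, |A m - Y m| ≤ ε) :
    ∃ θ, Tendsto A atTop (𝓝 θ) := by
  refine cauchySeq_tendsto_of_complete (Metric.cauchySeq_iff'.2 fun ε hε => ?_)
  obtain ⟨Y, ⟨θ, hθ⟩, hY⟩ := h (ε / 8) (by positivity)
  have h2 := Metric.tendsto_nhds.1 hθ (ε / 8) (by positivity)
  obtain ⟨M, hM⟩ := eventually_atTop.1 (hY.and h2)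
  refine ⟨M, fun m hm => ?_⟩
  obtain ⟨a1, a2⟩ := hM m hm
  obtain ⟨b1, b2⟩ := hM M le_rfl
  rw [Real.dist_eq] at a2 b2 ⊢
  rw [abs_le] at a1 b1
  rw [abs_lt] at a2 b2 ⊢
  constructor <;> linarith [a1.1, a1.2, b1.1, b1.2, a2.1, a2.2, b2.1, b2.2]

variable {α : ℝ} {s : ℕ → ℕ}

theorem tendsto_floor_div (hα : 0 < α) :
    Tendsto (fun m : ℕ => (⌊α * (m : ℝ)⌋₊ : ℝ) / m) atTop (𝓝 α) :=
  (tendsto_nat_floor_mul_div_atTop hα.le).comp tendsto_natCast_atTop_atTop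

theorem floor_mul_le (hα' : α ≤ 1) (m : ℕ) : ⌊α * (m : ℝ)⌋₊ ≤ m := by
  refine Nat.floor_le_of_le ?_
  exact mul_le_of_le_one_left (Nat.cast_nonneg m) hα'

theorem eventually_lt_floor (hα : 0 < α) (k : ℕ) :
    ∀ᶠ m : ℕ in atTop, k < ⌊α * (m : ℝ)⌋₊ := by
  have h : Tendsto (fun m : ℕ => ⌊α * (m : ℝ)⌋₊) atTop atTop :=
    tendsto_nat_floor_atTop.comp (tendsto_natCast_atTop_atTop.const_mul_atTop hα)
  exact h.eventually_gt_atTop k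

/-- For `α < 1` one has `σ ≤ α < 1`, so the number of nonsubscribers tends to infinity and the ratio
tends to `(α - σ) / (1 - σ)`. For `α = 1` every node gets a key. -/
theorem exists_tendsto_hyp (hα : 0 < α) (hα' : α ≤ 1)
    (hs : ∀ᶠ m : ℕ in atTop, s m < ⌊α * (m : ℝ)⌋₊) {σ : ℝ}
    (hσ : Tendsto (fun m : ℕ => (s m : ℝ) / m) atTop (𝓝 σ)) (k b a : ℕ) :
    ∃ θ, Tendsto (fun m => hyp k b (m - s m) (⌊α * (m : ℝ)⌋₊ - s m) a) atTop (𝓝 θ) := by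
  rcases hα'.eq_or_lt with rfl | h1
  · exact tendsto_hyp_of_le k b _ _ a (Eventually.of_forall fun m => by simp)
  · have hfl := tendsto_floor_div hα
    have hσα : σ ≤ α := le_of_tendsto_of_tendsto hσ hfl (hs.mono fun m hm => by
      have : (s m : ℝ) ≤ ⌊α * (m : ℝ)⌋₊ := by exact_mod_cast hm.le
      exact div_le_div_of_nonneg_right this (Nat.cast_nonneg m))
    have hN1 : Tendsto (fun m : ℕ => ((m - s m : ℕ) : ℝ) / m) atTop (𝓝 (1 - σ)) := by
      refine (tendsto_const_nhds.sub hσ).congr' ?_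
      filter_upwards [hs, eventually_gt_atTop 0] with m hm h0
      have h0' : (m : ℝ) ≠ 0 := by positivity
      rw [Nat.cast_sub (hm.le.trans (floor_mul_le hα' m)), sub_div, div_self h0']
    have hK1 : Tendsto (fun m : ℕ => ((⌊α * (m : ℝ)⌋₊ - s m : ℕ) : ℝ) / m) atTop (𝓝 (α - σ)) := by
      refine (hfl.sub hσ).congr' ?_
      filter_upwards [hs] with m hm
      rw [Nat.cast_sub hm.le, sub_div]
    have hN : Tendsto (fun m => m - s m) atTop atTop := by
      rw [← tendsto_natCast_atTop_iff (R := ℝ)]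
      refine (hN1.pos_mul_atTop (by linarith) tendsto_natCast_atTop_atTop).congr' ?_
      filter_upwards [eventually_gt_atTop 0] with m h0
      have h0' : (m : ℝ) ≠ 0 := by positivity
      exact div_mul_cancel₀ _ h0'
    have hKN := hK1.div hN1 (by linarith : 0 < 1 - σ).ne'
    refine (tendsto_hyp_of_div hN (hKN.congr' ?_) k b 0 0 a)
    filter_upwards [eventually_gt_atTop 0] with m h0
    have h0' : (m : ℝ) ≠ 0 := by positivity
    exact div_div_div_cancel_right₀ h0' _ _

theorem exists_tendsto_kindMean (hα : 0 < α) (hα' : α ≤ 1)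
    (hs : ∀ᶠ m : ℕ in atTop, s m < ⌊α * (m : ℝ)⌋₊) (hlamS : 0 < lamS) (hlamE : 0 < lamE) {σ : ℝ}
    (hσ : Tendsto (fun m : ℕ => (s m : ℝ) / m) atTop (𝓝 σ))
    (hq : q = true → ∀ᶠ m in atTop, 0 < s m) (k : ℕ) {u : ℝ} (hu : 0 ≤ u) :
    ∃ θ, θ ≠ ∞ ∧ Tendsto (fun m : ℕ => kindMean q k ⌊α * (m : ℝ)⌋₊ m (s m) lamS lamE u) atTop (𝓝 θ) := by
  have hN1 : Tendsto (fun m : ℕ => ((m - s m : ℕ) : ℝ) / m) atTop (𝓝 (1 - σ)) := by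
    refine (tendsto_const_nhds.sub hσ).congr' ?_
    filter_upwards [hs, eventually_gt_atTop 0] with m hm h0
    have h0' : (m : ℝ) ≠ 0 := by positivity
    rw [Nat.cast_sub (hm.le.trans (floor_mul_le hα' m)), sub_div, div_self h0']
  have hsh : ∀ x : ℕ → ℕ, ∀ m, |((x m - 1 : ℕ) : ℝ) - x m| ≤ 1 := by
    intro x m
    rw [abs_sub_comm, abs_of_nonneg (sub_nonneg.2 (by exact_mod_cast Nat.sub_le _ _)),
      sub_le_iff_le_add]
    exact_mod_cast (show x m ≤ 1 + (x m - 1) by omega)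
  have h₁ : ∃ c, Tendsto (fun m => ((if q then s m - 1 else s m : ℕ) : ℝ) * edgeRate lamE m) atTop
      (𝓝 c) := by
    refine ⟨_, tendsto_edgeRate_mul lamE (σ := σ) ?_⟩
    refine tendsto_div_of_bounded_shift (C := 1) tendsto_natCast_atTop_atTop hσ (fun m => ?_)
      (fun m => by simp)
    cases q
    · simp
    · exact hsh s m
  have h₂ : ∃ c, Tendsto (fun m => ((if q then m - s m else m - s m - 1 : ℕ) : ℝ) *
      edgeRate lamE m) atTop (𝓝 c) := by
    refine ⟨_, tendsto_edgeRate_mul lamE (σ := 1 - σ) ?_⟩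
    refine tendsto_div_of_bounded_shift (C := 1) tendsto_natCast_atTop_atTop hN1 (fun m => ?_)
      (fun m => by simp)
    cases q
    · exact hsh (fun m => m - s m) m
    · simp
  obtain ⟨c₁, h₁⟩ := h₁
  obtain ⟨c₂, h₂⟩ := h₂
  refine exists_tendsto_nodeMean k _ _ (exists_tendsto_hyp hα hα' hs hσ k)
    (fun m => edgeRate_pos hlamE m) (tendsto_edgeRate lamE) h₁ h₂ hlamS u ?_
  have hq' : ∀ᶠ m in atTop, q = true → 0 < s m := by
    cases q
    · simp
    · simpa using hq rfl
  filter_upwards [hs, hq'] with m hm hqm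
  have hn := floor_mul_le hα' m
  obtain ⟨S, j, hS, hj⟩ := exists_node (q := q) (hm.trans_le hn) hqm
  rw [← hS] at hm ⊢
  have := (meanLag_decodes_eq (k := k) hlamS (edgeRate_pos hlamE m) hm.le hn j hu).1
  cases q <;> simpa [hj] using this

/-- Both `n * r` and `r * (n - k)` tend to `α * lamE`; the constants `C = 2 * lamE` and `c = α *
lamE / 2` lie strictly on either side of this limit. -/
theorem exists_tail_le (hα : 0 < α) (hα' : α ≤ 1) (hlamE : 0 < lamE) (k : ℕ) (lamS : ℝ)
    (hlamS : 0 < lamS) {ε : ℝ} (hε : 0 < ε) :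
    ∃ u : ℝ, 0 ≤ u ∧ ∀ᶠ m : ℕ in atTop,
      ENNReal.ofReal lamS * lagTail k ⌊α * (m : ℝ)⌋₊ (edgeRate lamE m) u ≤ ENNReal.ofReal ε := by
  set C := 2 * lamE
  set c := α * lamE / 2 with hc_def
  have hc : 0 < c := by positivity
  set M := ∑ d ∈ Finset.range (k + 1), (2 * C / c) ^ d
  have h1 : Tendsto (fun u : ℝ => lamS * (M * (Real.exp (-(c / 2) * u) / (c / 2)))) atTop (𝓝 0) := by
    have h2 : Tendsto (fun u : ℝ => Real.exp (-(c / 2) * u)) atTop (𝓝 0) :=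
      Real.tendsto_exp_atBot.comp (tendsto_id.const_mul_atTop_of_neg (by linarith))
    simpa using ((h2.div_const (c / 2)).const_mul M).const_mul lamS
  obtain ⟨u, hu1, hu0⟩ := ((h1.eventually_le_const hε).and (eventually_ge_atTop 0)).exists
  have hnr : Tendsto (fun m : ℕ => (⌊α * (m : ℝ)⌋₊ : ℝ) * edgeRate lamE m) atTop (𝓝 (α * lamE)) :=
    tendsto_edgeRate_mul lamE (tendsto_floor_div hα)
  have hnk : Tendsto (fun m : ℕ => edgeRate lamE m * ((⌊α * (m : ℝ)⌋₊ : ℝ) - k)) atTop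
      (𝓝 (α * lamE)) := by
    have := hnr.sub ((tendsto_edgeRate lamE).mul_const (k : ℝ))
    rw [zero_mul, sub_zero] at this
    exact this.congr fun m => by ring
  refine ⟨u, hu0, ?_⟩
  filter_upwards [eventually_lt_floor hα k,
    hnr.eventually_le_const (show α * lamE < C by change _ < 2 * lamE; nlinarith),
    hnk.eventually_const_le (show c < α * lamE by rw [hc_def]; linarith [mul_pos hα hlamE])]
    with m a1 a2 a3
  refine (mul_le_mul_right (lagTail_le (edgeRate_pos hlamE m) hc a1.le a2 a3 hu0) _).trans ?_
  rw [← ENNReal.ofReal_mul hlamS.le]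
  exact ENNReal.ofReal_le_ofReal hu1

/-- The age exceeds the mean lag at time `u` by at most the tail, which is small uniformly in `m`,
and the mean lag at a fixed time converges. -/
theorem exists_tendsto_kindAge (hα : 0 < α) (hα' : α ≤ 1)
    (hs : ∀ᶠ m : ℕ in atTop, s m < ⌊α * (m : ℝ)⌋₊) (hlamS : 0 < lamS) (hlamE : 0 < lamE) {σ : ℝ}
    (hσ : Tendsto (fun m : ℕ => (s m : ℝ) / m) atTop (𝓝 σ))
    (hq : q = true → ∀ᶠ m in atTop, 0 < s m) (k : ℕ) :
    ∃ θ, Tendsto (fun m : ℕ => (kindAge q k ⌊α * (m : ℝ)⌋₊ m (s m) lamS lamE).toReal) atTop (𝓝 θ) := by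
  refine exists_tendsto_of_approx fun ε hε => ?_
  obtain ⟨u, hu, htail⟩ := exists_tail_le hα hα' hlamE k lamS hlamS hε
  obtain ⟨θ, hθ, hlim⟩ := exists_tendsto_kindMean hα hα' hs hlamS hlamE hσ hq k hu
  refine ⟨fun m => (kindMean q k ⌊α * (m : ℝ)⌋₊ m (s m) lamS lamE u).toReal,
    ⟨_, (ENNReal.tendsto_toReal hθ).comp hlim⟩, ?_⟩
  have hq' : ∀ᶠ m in atTop, q = true → 0 < s m := by
    cases q
    · simp
    · simpa using hq rfl
  filter_upwards [hs, hq', htail, eventually_lt_floor hα k, eventually_ge_atTop 2]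
    with m hm hqm ht hk hm2
  have hn := floor_mul_le hα' m
  obtain ⟨hfin, -, -⟩ := kindAge_bounds (q := q) hk hm hn hm2 hlamS hlamE hqm
  obtain ⟨S, j, hS, hj⟩ := exists_node (q := q) (hm.trans_le hn) hqm
  rw [← hS] at hm hfin ⊢
  rw [← nodeAge_eq_kindAge hm.le hn hlamS hlamE hj] at hfin ⊢
  rw [← meanLag_eq_kindMean hm.le hn hlamS hlamE hj hu]
  have lo : meanLag (decodes k S j) lamS (edgeRate lamE m) (markLaw ⌊α * (m : ℝ)⌋₊ S) u ≤
      nodeAge k ⌊α * (m : ℝ)⌋₊ S lamS lamE j := le_iSup (fun u => meanLag _ _ _ _ u) u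
  have up := (nodeAge_le_add hk hm.le hn hlamS hlamE j hu).trans (add_le_add_right ht _)
  have hfin2 := ne_top_of_le_ne_top hfin lo
  have lo' := ENNReal.toReal_mono hfin lo
  have up' := ENNReal.toReal_mono (ENNReal.add_ne_top.2 ⟨hfin2, ENNReal.ofReal_ne_top⟩) up
  rw [ENNReal.toReal_add hfin2 ENNReal.ofReal_ne_top, ENNReal.toReal_ofReal hε.le] at up'
  rw [abs_le]
  constructor <;> linarith

theorem tendsto_ageBound (hα : 0 < α) (hlamE : 0 < lamE) (k : ℕ) (lamS : ℝ) :
    Tendsto (fun m : ℕ => ageBound k ⌊α * (m : ℝ)⌋₊ m lamS lamE) atTop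
      (𝓝 ((k + 1) * lamS / (α * lamE))) := by
  have hnd : ∀ d : ℕ, Tendsto (fun m : ℕ => edgeRate lamE m * ((⌊α * (m : ℝ)⌋₊ : ℝ) - d)) atTop
      (𝓝 (α * lamE)) := by
    intro d
    have := (tendsto_edgeRate_mul lamE (tendsto_floor_div hα)).sub
      ((tendsto_edgeRate lamE).mul_const (d : ℝ))
    rw [zero_mul, sub_zero] at this
    exact this.congr fun m => by ring
  have h1 := (tendsto_finsetSum (Finset.range (k + 1)) fun d _ =>
    (tendsto_const_nhds (x := (1 : ℝ))).div (hnd d) (by positivity)).const_mul lamS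
  refine Eq.subst (motive := fun x => Tendsto _ _ (𝓝 x)) ?_ h1
  rw [Finset.sum_const, Finset.card_range, nsmul_eq_mul]
  push_cast
  ring

/-- The average version age over the graph. -/
noncomputable def graphAge (k n m s : ℕ) (lamS lamE : ℝ) : ℝ :=
  (s : ℝ) / m * (kindAge true k n m s lamS lamE).toReal +
    ((m - s : ℕ) : ℝ) / m * (kindAge false k n m s lamS lamE).toReal

theorem isGraphAge_graphAge (hk : k < n) (hS : S.card ≤ n) (hn : n ≤ m) (hlamS : 0 < lamS)
    (hlamE : 0 < lamE) : IsGraphAge k n S lamS lamE (graphAge k n m S.card lamS lamE) := by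
  refine ⟨(kindAge true k n m S.card lamS lamE).toReal,
    (kindAge false k n m S.card lamS lamE).toReal, fun j hj => ?_, fun j hj => ?_, ?_⟩
  · rw [← nodeAge_eq_kindAge hS hn hlamS hlamE (j := j) (by simpa using hj)]
    exact isNodeAge_nodeAge hk hS hn hlamS hlamE j
  · rw [← nodeAge_eq_kindAge hS hn hlamS hlamE (j := j) (by simpa using hj)]
    exact isNodeAge_nodeAge hk hS hn hlamS hlamE j
  · rw [graphAge, Finset.card_compl, Fintype.card_fin]

theorem graphAge_bounds {s : ℕ} (hk : k < n) (hs : s < n) (hn : n ≤ m) (hm : 2 ≤ m)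
    (hlamS : 0 < lamS) (hlamE : 0 < lamE) :
    k * lamS / lamE ≤ graphAge k n m s lamS lamE ∧
      graphAge k n m s lamS lamE ≤ ageBound k n m lamS lamE := by
  obtain ⟨-, b1, b2⟩ := kindAge_bounds (q := false) hk hs hn hm hlamS hlamE (by simp)
  have hm0 : (m : ℝ) ≠ 0 := by positivity
  have hw : ((m - s : ℕ) : ℝ) / m = 1 - (s : ℝ) / m := by
    rw [Nat.cast_sub (hs.le.trans hn), sub_div, div_self hm0]
  have hw0 : 0 ≤ ((m - s : ℕ) : ℝ) / m := by positivity
  have hs0 : 0 ≤ (s : ℝ) / m := by positivity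
  unfold graphAge
  -- Without subscribers their term has weight zero, and nothing needs to be known about its formal
  -- value.
  rcases Nat.eq_zero_or_pos s with rfl | h0
  · simpa [hm0] using ⟨b1, b2⟩
  · obtain ⟨-, a1, a2⟩ := kindAge_bounds (q := true) hk hs hn hm hlamS hlamE fun _ => h0
    constructor
    · have h1 := mul_le_mul_of_nonneg_left a1 hs0
      have h2 := mul_le_mul_of_nonneg_left b1 hw0
      have h3 : (s : ℝ) / m * (k * lamS / lamE) + ((m - s : ℕ) : ℝ) / m * (k * lamS / lamE) =
        k * lamS / lamE := by rw [hw]; ring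
      linarith
    · have h1 := mul_le_mul_of_nonneg_left a2 hs0
      have h2 := mul_le_mul_of_nonneg_left b2 hw0
      have h3 : (s : ℝ) / m * ageBound k n m lamS lamE +
        ((m - s : ℕ) : ℝ) / m * ageBound k n m lamS lamE = ageBound k n m lamS lamE := by
          rw [hw]; ring
      linarith

/-- If `σ = 0`, subscribers may be absent for infinitely many `m` and their age need not converge;
but their weight tends to zero while their age is bounded by `ageBound` whenever they exist. If `σ >
0`, they are eventually present and both ages converge. -/
theorem exists_tendsto_graphAge (hα : 0 < α) (hα' : α ≤ 1)
    (hs : ∀ᶠ m : ℕ in atTop, s m < ⌊α * (m : ℝ)⌋₊) (hlamS : 0 < lamS) (hlamE : 0 < lamE) {σ : ℝ}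
    (hσ : Tendsto (fun m : ℕ => (s m : ℝ) / m) atTop (𝓝 σ)) (k : ℕ) :
    ∃ θ, Tendsto (fun m : ℕ => graphAge k ⌊α * (m : ℝ)⌋₊ m (s m) lamS lamE) atTop (𝓝 θ) := by
  have hN1 : Tendsto (fun m : ℕ => ((m - s m : ℕ) : ℝ) / m) atTop (𝓝 (1 - σ)) := by
    refine (tendsto_const_nhds.sub hσ).congr' ?_
    filter_upwards [hs, eventually_gt_atTop 0] with m hm h0
    have h0' : (m : ℝ) ≠ 0 := by positivity
    rw [Nat.cast_sub (hm.le.trans (floor_mul_le hα' m)), sub_div, div_self h0']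
  obtain ⟨θb, hb⟩ := exists_tendsto_kindAge (q := false) hα hα' hs hlamS hlamE hσ (by simp) k
  have hσ0 : 0 ≤ σ := ge_of_tendsto' hσ fun m => by positivity
  rcases hσ0.eq_or_lt with rfl | hpos
  · have ha : Tendsto (fun m : ℕ => (s m : ℝ) / m *
        (kindAge true k ⌊α * (m : ℝ)⌋₊ m (s m) lamS lamE).toReal) atTop (𝓝 0) := by
      have hup := hσ.mul (tendsto_ageBound hα hlamE k lamS)
      rw [zero_mul] at hup
      refine tendsto_of_tendsto_of_tendsto_of_le_of_le' tendsto_const_nhds hup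
        (Eventually.of_forall fun m => by positivity) ?_
      filter_upwards [hs, eventually_lt_floor hα k, eventually_ge_atTop 2] with m hm hk hm2
      rcases Nat.eq_zero_or_pos (s m) with h0 | h0
      · simp [h0]
      · have := (kindAge_bounds (q := true) hk hm (floor_mul_le hα' m) hm2 hlamS hlamE
          fun _ => h0).2.2
        gcongr
    exact ⟨_, ha.add (hN1.mul hb)⟩
  · have hs0 : ∀ᶠ m in atTop, 0 < s m := by
      filter_upwards [hσ.eventually_const_lt hpos] with m hm
      by_contra h
      rw [Nat.eq_zero_of_not_pos h] at hm
      simp at hm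
    obtain ⟨θa, ha⟩ := exists_tendsto_kindAge (q := true) hα hα' hs hlamS hlamE hσ
      (fun _ => hs0) k
    exact ⟨_, (hσ.mul ha).add (hN1.mul hb)⟩

end Limit

end CodedGossip

/-! ### The main theorem. -/

theorem mainTheorem11 (k : ℕ) (lamS lamE α : ℝ) (hlamS : 0 < lamS) (hlamE : 0 < lamE)
    (hα : 0 < α) (hα' : α ≤ 1) (s : ℕ → ℕ)
    (hs : ∀ᶠ m : ℕ in Filter.atTop, s m < ⌊α * (m : ℝ)⌋₊) :
    ∃ Δ : ℕ → ℝ,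
      (∀ m : ℕ, k < ⌊α * (m : ℝ)⌋₊ → s m < ⌊α * (m : ℝ)⌋₊ →
        ∀ S : Finset (Fin m), S.card = s m →
          CodedGossip.IsGraphAge k ⌊α * (m : ℝ)⌋₊ S lamS lamE (Δ m)) ∧
      (∀ ε : ℝ, 0 < ε → ∀ᶠ m : ℕ in Filter.atTop,
        k * lamS / lamE - ε ≤ Δ m ∧ Δ m ≤ (k + 1) * lamS / (α * lamE) + ε) ∧
      (∀ σ : ℝ, Filter.Tendsto (fun m : ℕ => (s m : ℝ) / (m : ℝ)) Filter.atTop (nhds σ) →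
        ∃ L : ℝ, Filter.Tendsto Δ Filter.atTop (nhds L) ∧
          k * lamS / lamE ≤ L ∧ L ≤ (k + 1) * lamS / (α * lamE)) := by
  have hU := CodedGossip.tendsto_ageBound hα hlamE k lamS
  have hbounds : ∀ᶠ m : ℕ in atTop,
      k * lamS / lamE ≤ CodedGossip.graphAge k ⌊α * (m : ℝ)⌋₊ m (s m) lamS lamE ∧
      CodedGossip.graphAge k ⌊α * (m : ℝ)⌋₊ m (s m) lamS lamE ≤
        CodedGossip.ageBound k ⌊α * (m : ℝ)⌋₊ m lamS lamE := by
    filter_upwards [hs, CodedGossip.eventually_lt_floor hα k, eventually_ge_atTop 2] with m hm hk hm2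
    exact CodedGossip.graphAge_bounds hk hm (CodedGossip.floor_mul_le hα' m) hm2 hlamS hlamE
  -- `graphAge` takes only the number of subscribers, so a single value serves every set `S` of that
  -- size.
  refine ⟨fun m => CodedGossip.graphAge k ⌊α * (m : ℝ)⌋₊ m (s m) lamS lamE, ?_, ?_, ?_⟩
  · intro m hk hm S hS
    rw [← hS] at hm
    change CodedGossip.IsGraphAge k _ S lamS lamE (CodedGossip.graphAge k _ m (s m) lamS lamE)
    rw [← hS]
    exact CodedGossip.isGraphAge_graphAge hk hm.le (CodedGossip.floor_mul_le hα' m) hlamS hlamE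
  · intro ε hε
    filter_upwards [hbounds, hU.eventually_le_const (lt_add_of_pos_right _ hε)] with m hm hm2
    exact ⟨by linarith [hm.1], hm.2.trans hm2⟩
  · intro σ hσ
    obtain ⟨L, hL⟩ := CodedGossip.exists_tendsto_graphAge hα hα' hs hlamS hlamE hσ k
    exact ⟨L, hL, ge_of_tendsto hL (hbounds.mono fun m h => h.1),
      le_of_tendsto_of_tendsto hL hU (hbounds.mono fun m h => h.2)⟩
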